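/- Let $\mathsf A$ be an abelian category with a torsion pair $(\mathcal T,\mathcal F)$: two classes of objects, closed under isomorphism, such that $\operatorname{Hom}(T,F)=0$ for $T\in\mathcal T$, $F\in\mathcal F$, and every object $X$ fits in a short exact sequence $0\to T\to X\to F\to 0$ with $T\in\mathcal T$, $F\in\mathcal F$. **The category $\mathsf B$.** Objects are the two-term complexes $\mathbb X=[d\colon X^{-1}\to X^0]$ in $\mathsf A$ with $\ker d\in\mathcal F$ and $\operatorname{coker} d\in\mathcal T$. A morphism $\mathbb X\to\mathbb Y$ is an isomorphism class of butterflies, that is, of objects $E$ with maps $\kappa\colon X^{-1}\to E$, $\iota\colon Y^{-1}\to E$, $\sigma\colon E\to X^0$, $\rho\colon E\to Y^0$ such that $\sigma\kappa=d_X$, $\rho\iota=d_Y$, $\rho\kappa=0$ and $0\to Y^{-1}\xrightarrow{\iota}E\xrightarrow{\sigma}X^0\to 0$ is exact. The composite of $E\colon\mathbb X\to\mathbb Y$ and $F\colon\mathbb Y\to\mathbb Z$ is $\operatorname{coker}\bigl((\iota,\kappa')\colon Y^{-1}\to E\times_{Y^0}F\bigr)$ with the evident maps. The category $\mathsf B$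 is abelian. A morphism of complexes $f=(f^{-1},f^0)\colon\mathbb X\to\mathbb Y$ gives a (strict) morphism of $\mathsf B$, with $E=X^0\oplus Y^{-1}$, $\kappa=(d_X,-f^{-1})$, $\iota$ and $\sigma$ the inclusion and the projection, and $\rho=f^0+d_Y$. Let $\mathsf{Ch}(\mathsf B)$ be the category of (unbounded) cochain complexes in $\mathsf B$ and $\mathcal D(\mathsf B)$ its derived category. Let $\mathsf{Ch}^{st}(\mathsf B)$ be the category with the same objects as $\mathsf{Ch}(\mathsf B)$, in which a morphism $\mathbf X\to\mathbf Y$ is a family of morphisms of two-term complexes $f_n=(f_n^{-1},f_n^0)\colon{}^n\mathbb X\to{}^n\mathbb Y$, $n\in\mathbb Z$, whose classes in $\mathsf B$ commute with the differentials; there is an evident functor $I\colon\mathsf{Ch}^{st}(\mathsf B)\to\mathsf{Ch}(\mathsf B)$. **Decorated complexes.** Let $\mathsf{Ch}(\mathsf A,\mathcal T,\mathcal F)$ be the category of pairs $(E^\bullet,M^\bullet)$ of a cochain complex $(E^\bullet,\delta)$ in $\mathsf A$ and subobjects $M^n\subseteq E^n$, $n\in\mathbb Z$, such that for every $n$ the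 map $M^n\to E^{n+1}/M^{n+1}$ induced by $\delta$ has its kernel $H^{-1,n}$ in $\mathcal F$ and its cokernel $H^{0,n}$ in $\mathcal T$; a morphism $(E^\bullet,M^\bullet)\to(F^\bullet,N^\bullet)$ is a chain map $f\colon E^\bullet\to F^\bullet$ with $f(M^n)\subseteq N^n$ for all $n$. Let $\mathcal S_{sis}$ be the class of morphisms that induce isomorphisms on all $H^{-1,n}$ and all $H^{0,n}$, and $\mathcal S_{qis}$ the class of morphisms that induce isomorphisms on all cohomology objects $H^n(E^\bullet)$. **The functor $\operatorname{Tot}\colon\mathsf{Ch}^{st}(\mathsf B)\to\mathsf{Ch}(\mathsf A,\mathcal T,\mathcal F)$.** For a complex $\mathbf X$ in $\mathsf B$ choose, for each $n$, a butterfly $(E^n;\kappa_n,\iota_n,\sigma_n,\rho_n)$ representing the differential ${}^{n-1}\mathbb X\to{}^n\mathbb X$. There are unique maps $\delta\colon E^n\to E^{n+1}$ with $\delta\kappa_n=0$, $\delta\iota_n=\kappa_{n+1}$, $\sigma_{n+1}\delta=\rho_n$, $\rho_{n+1}\delta=0$; they satisfy $\delta^2=0$, and $\operatorname{Tot}(\mathbf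 X)=(E^\bullet,M^\bullet)$ with $M^n=\iota_n({}^nX^{-1})$. A morphism $(f_n)\colon\mathbf X\to\mathbf Y$ in $\mathsf{Ch}^{st}(\mathsf B)$, with $\operatorname{Tot}(\mathbf Y)=(F^\bullet,N^\bullet)$ built from butterflies $(F^n;\kappa'_n,\iota'_n,\sigma'_n,\rho'_n)$, is sent to the chain map formed by the unique maps $s_n\colon E^n\to F^n$ with $s_n\kappa_n=\kappa'_nf_{n-1}^{-1}$, $s_n\iota_n=\iota'_nf_n^{-1}$, $\sigma'_ns_n=f_{n-1}^0\sigma_n$, $\rho'_ns_n=f_n^0\rho_n$. **Statement.** $\operatorname{Tot}$ induces equivalences of categories $$\Phi\colon\mathsf{Ch}(\mathsf B)\xrightarrow{\ \sim\ }\mathcal S_{sis}^{-1}\mathsf{Ch}(\mathsf A,\mathcal T,\mathcal F),\qquad \Psi\colon\mathcal D(\mathsf B)\xrightarrow{\ \sim\ }\mathcal S_{qis}^{-1}\mathsf{Ch}(\mathsf A,\mathcal T,\mathcal F).$$ That is, there are equivalences $\Phi$ and $\Psi$ such that $\Phi\circ I$ is isomorphic to $\operatorname{Tot}$ followed by the localization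 functor of $\mathcal S_{sis}$, and $\Psi\circ L\circ I$ is isomorphic to $\operatorname{Tot}$ followed by the localization functor of $\mathcal S_{qis}$, where $L\colon\mathsf{Ch}(\mathsf B)\to\mathcal D(\mathsf B)$ is the localization functor. -/

import Mathlib

open CategoryTheory CategoryTheory.Limits

attribute [-instance] CategoryTheory.catToReflQuiver

universe w v u

namespace HRS

noncomputable section

variable {A : Type u} [Category.{v} A] [Abelian A]

/-- A diagram ("butterfly") from the two-term complex `X = [X⁻¹ ⟶ X⁰]` to `Y = [Y⁻¹ ⟶ Y⁰]`.
A two-term complex is an object of `Arrow A`; `X⁻¹` is `X.left` and `X⁰` is `X.right`. -/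
structure Butterfly (X Y : Arrow A) where
  /-- the central object -/
  E : A
  κ : X.left ⟶ E
  ι : Y.left ⟶ E
  σ : E ⟶ X.right
  ρ : E ⟶ Y.right
  κ_σ : κ ≫ σ = X.hom
  ι_ρ : ι ≫ ρ = Y.hom
  κ_ρ : κ ≫ ρ = 0
  ι_σ : ι ≫ σ = 0
  shortExact : (ShortComplex.mk ι σ ι_σ).ShortExact

attribute [local simp] pullback.lift_fst pullback.lift_snd pullback.lift_fst_assoc
  pullback.lift_snd_assoc pushout.inl_desc pushout.inr_desc pushout.inl_desc_assoc
  pushout.inr_desc_assoc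

namespace Butterfly

attribute [simp] κ_σ ι_ρ κ_ρ ι_σ

variable {X Y Z W : Arrow A}

instance (P : Butterfly X Y) : Mono P.ι := P.shortExact.mono_f
instance (P : Butterfly X Y) : Epi P.σ := P.shortExact.epi_g

@[simp] lemma κ_σ' (P : Butterfly X Y) {T : A} (f : X.right ⟶ T) :
    P.κ ≫ P.σ ≫ f = X.hom ≫ f := by rw [← Category.assoc, P.κ_σ]
@[simp] lemma ι_ρ' (P : Butterfly X Y) {T : A} (f : Y.right ⟶ T) :
    P.ι ≫ P.ρ ≫ f = Y.hom ≫ f := by rw [← Category.assoc, P.ι_ρ]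
@[simp] lemma κ_ρ' (P : Butterfly X Y) {T : A} (f : Y.right ⟶ T) :
    P.κ ≫ P.ρ ≫ f = 0 := by rw [← Category.assoc, P.κ_ρ, zero_comp]
@[simp] lemma ι_σ' (P : Butterfly X Y) {T : A} (f : X.right ⟶ T) :
    P.ι ≫ P.σ ≫ f = 0 := by rw [← Category.assoc, P.ι_σ, zero_comp]

lemma exists_lift (P : Butterfly X Y) {T : A} (f : T ⟶ P.E) (hf : f ≫ P.σ = 0) :
    ∃ g : T ⟶ Y.left, g ≫ P.ι = f :=
  ⟨P.shortExact.exact.lift f hf, P.shortExact.exact.lift_f f hf⟩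

lemma exists_desc (P : Butterfly X Y) {T : A} (f : P.E ⟶ T) (hf : P.ι ≫ f = 0) :
    ∃ g : X.right ⟶ T, P.σ ≫ g = f :=
  ⟨P.shortExact.exact.desc f hf, P.shortExact.exact.g_desc f hf⟩

/-- `φ` commutes with the four arrows of the butterflies `P` and `Q`. -/
structure IsHom (P Q : Butterfly X Y) (φ : P.E ⟶ Q.E) : Prop where
  κ : P.κ ≫ φ = Q.κ
  ι : P.ι ≫ φ = Q.ι
  σ : φ ≫ Q.σ = P.σ
  ρ : φ ≫ Q.ρ = P.ρ

/-- Isomorphism of butterflies. -/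
instance setoid (X Y : Arrow A) : Setoid (Butterfly X Y) where
  r P Q := ∃ e : P.E ≅ Q.E, IsHom P Q e.hom
  iseqv :=
    { refl := fun P => ⟨Iso.refl _, by simp, by simp, by simp, by simp⟩
      symm := by
        rintro P Q ⟨e, h⟩
        refine ⟨e.symm, ?_, ?_, ?_, ?_⟩
        · simp [← h.κ]
        · simp [← h.ι]
        · simp [← h.σ]
        · simp [← h.ρ]
      trans := by
        rintro P Q R ⟨e, h⟩ ⟨e', h'⟩
        refine ⟨e ≪≫ e', ?_, ?_, ?_, ?_⟩
        · rw [Iso.trans_hom, ← Category.assoc, h.κ, h'.κ]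
        · rw [Iso.trans_hom, ← Category.assoc, h.ι, h'.ι]
        · rw [Iso.trans_hom, Category.assoc, h'.σ, h.σ]
        · rw [Iso.trans_hom, Category.assoc, h'.ρ, h.ρ] }

/-- Any map of butterflies is an isomorphism. -/
lemma equiv_of_isHom {P Q : Butterfly X Y} {φ : P.E ⟶ Q.E} (h : IsHom P Q φ) : P ≈ Q := by
  let F : ShortComplex.mk P.ι P.σ P.ι_σ ⟶ ShortComplex.mk Q.ι Q.σ Q.ι_σ :=
    { τ₁ := 𝟙 _
      τ₂ := φ
      τ₃ := 𝟙 _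
      comm₁₂ := by simp [h.ι]
      comm₂₃ := by simp [h.σ] }
  have : IsIso F.τ₁ := inferInstanceAs (IsIso (𝟙 _))
  have : IsIso F.τ₃ := inferInstanceAs (IsIso (𝟙 _))
  have : IsIso φ := ShortComplex.isIso₂_of_shortExact_of_isIso₁₃ F P.shortExact Q.shortExact
  exact ⟨asIso φ, h⟩

/-- The butterfly of an actual morphism of two-term complexes. -/
abbrev strict (f : X ⟶ Y) : Butterfly X Y where
  E := X.right ⊞ Y.left
  κ := biprod.lift X.hom (-f.left)
  ι := biprod.inr
  σ := biprod.fst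
  ρ := biprod.desc f.right Y.hom
  κ_σ := by simp
  ι_ρ := by simp
  κ_ρ := by simp [biprod.lift_desc]
  ι_σ := by simp
  shortExact := (ShortComplex.Splitting.mk (S := ShortComplex.mk (biprod.inr : Y.left ⟶ X.right ⊞ Y.left)
    biprod.fst (by simp)) biprod.snd biprod.inl (by simp) (by simp)
    (by simp [add_comm (biprod.snd ≫ biprod.inr), biprod.total])).shortExact

/-- The map `(ι, κ') : Y⁻¹ ⟶ E ×_{Y⁰} F`. -/
abbrev compι (P : Butterfly X Y) (Q : Butterfly Y Z) : Y.left ⟶ pullback P.ρ Q.σ :=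
  pullback.lift P.ι Q.κ (by simp)

lemma comp_refine (P : Butterfly X Y) (Q : Butterfly Y Z) {T : A} (x : T ⟶ pullback P.ρ Q.σ)
    (hx : x ≫ cokernel.π (compι P Q) = 0) :
    ∃ (T' : A) (p : T' ⟶ T) (_ : Epi p) (y : T' ⟶ Y.left), p ≫ x = y ≫ compι P Q :=
  (CokernelCofork.IsColimit.comp_π_eq_zero_iff_up_to_refinements
    (cokernelIsCokernel (compι P Q)) x).1 hx

/-- The composition of butterflies: the central object is the cokernel of
`(ι, κ') : Y⁻¹ ⟶ E ×_{Y⁰} F`. -/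
abbrev comp (P : Butterfly X Y) (Q : Butterfly Y Z) : Butterfly X Z where
  E := cokernel (compι P Q)
  κ := pullback.lift P.κ 0 (by simp) ≫ cokernel.π _
  ι := pullback.lift 0 Q.ι (by simp) ≫ cokernel.π _
  σ := cokernel.desc _ (pullback.fst _ _ ≫ P.σ) (by simp)
  ρ := cokernel.desc _ (pullback.snd _ _ ≫ Q.ρ) (by simp)
  κ_σ := by simp
  ι_ρ := by simp
  κ_ρ := by simp
  ι_σ := by simp
  shortExact := by
    have hm : Mono (pullback.lift 0 Q.ι (by simp) ≫ cokernel.π (compι P Q)) := by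
      rw [Preadditive.mono_iff_cancel_zero]
      intro T z hz
      rw [← Category.assoc] at hz
      obtain ⟨T', p, _, y, hy⟩ := comp_refine P Q _ hz
      have h1 := hy =≫ pullback.fst _ _
      have h2 := hy =≫ pullback.snd _ _
      simp only [Category.assoc, pullback.lift_fst, comp_zero] at h1
      simp only [Category.assoc, pullback.lift_snd] at h2
      have hy0 : y = 0 := by
        rw [← cancel_mono P.ι, ← h1, zero_comp]
      rw [← cancel_epi p, ← cancel_mono Q.ι, Category.assoc, h2, hy0]
      simp
    have he : Epi (cokernel.desc (compι P Q) (pullback.fst _ _ ≫ P.σ) (by simp)) := by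
      have : Epi (cokernel.π (compι P Q) ≫
        cokernel.desc (compι P Q) (pullback.fst _ _ ≫ P.σ) (by simp)) := by
        rw [cokernel.π_desc]
        infer_instance
      exact epi_of_epi (cokernel.π (compι P Q)) _
    refine ShortComplex.ShortExact.mk' ?_ hm he
    rw [ShortComplex.exact_iff_exact_up_to_refinements]
    intro T x hx
    obtain ⟨T₁, p₁, _, l, hl⟩ := surjective_up_to_refinements_of_epi (cokernel.π (compι P Q)) x
    have h0 : (l ≫ pullback.fst _ _) ≫ P.σ = 0 := by
      have h2 : p₁ ≫ x ≫ cokernel.desc (compι P Q) (pullback.fst _ _ ≫ P.σ) (by simp) = 0 := by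
        rw [show x ≫ cokernel.desc (compι P Q) (pullback.fst _ _ ≫ P.σ) (by simp) = 0 from hx,
          Limits.comp_zero]
      rw [← Category.assoc, hl] at h2
      simpa using h2
    obtain ⟨y, hy⟩ := P.exists_lift _ h0
    have h1 : (l ≫ pullback.snd _ _ - y ≫ Q.κ) ≫ Q.σ = 0 := by
      have : l ≫ pullback.snd P.ρ Q.σ ≫ Q.σ = y ≫ Y.hom := by
        rw [← pullback.condition, ← Category.assoc, ← hy]; simp
      simp [Preadditive.sub_comp, this]
    obtain ⟨z, hz⟩ := Q.exists_lift _ h1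
    refine ⟨T₁, p₁, inferInstance, z, ?_⟩
    change p₁ ≫ x = z ≫ pullback.lift 0 Q.ι _ ≫ cokernel.π _
    have : l = z ≫ pullback.lift 0 Q.ι (by simp) + y ≫ compι P Q := by
      apply pullback.hom_ext
      · simp [hy]
      · simp [hz]
    rw [hl, this]
    simp

/-- A criterion for `R` to be (isomorphic to) a composition. -/
lemma comp_equiv {P : Butterfly X Y} {Q : Butterfly Y Z} {R : Butterfly X Z}
    (t : pullback P.ρ Q.σ ⟶ R.E) (h : compι P Q ≫ t = 0)
    (hκ : pullback.lift P.κ 0 (by simp) ≫ t = R.κ)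
    (hι : pullback.lift 0 Q.ι (by simp) ≫ t = R.ι)
    (hσ : t ≫ R.σ = pullback.fst _ _ ≫ P.σ)
    (hρ : t ≫ R.ρ = pullback.snd _ _ ≫ Q.ρ) : P.comp Q ≈ R := by
  apply equiv_of_isHom (φ := cokernel.desc _ t h)
  constructor
  · simp [comp, hκ]
  · simp [comp, hι]
  · ext; simp [comp, hσ]
  · ext; simp [comp, hρ]

lemma exists_of_comp_equiv {P : Butterfly X Y} {Q : Butterfly Y Z} {R : Butterfly X Z}
    (h : P.comp Q ≈ R) :
    ∃ t : pullback P.ρ Q.σ ⟶ R.E, compι P Q ≫ t = 0 ∧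
      pullback.lift P.κ 0 (by simp) ≫ t = R.κ ∧
      pullback.lift 0 Q.ι (by simp) ≫ t = R.ι ∧
      t ≫ R.σ = pullback.fst _ _ ≫ P.σ ∧ t ≫ R.ρ = pullback.snd _ _ ≫ Q.ρ := by
  obtain ⟨e, he⟩ := h
  refine ⟨cokernel.π _ ≫ e.hom, ?_, ?_, ?_, ?_, ?_⟩
  · simp
  · rw [← Category.assoc]; exact he.κ
  · rw [← Category.assoc]; exact he.ι
  · rw [Category.assoc, he.σ]; simp [comp]
  · rw [Category.assoc, he.ρ]; simp [comp]

lemma comp_congr {P P' : Butterfly X Y} {Q Q' : Butterfly Y Z} (h : P ≈ P') (h' : Q ≈ Q') :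
    P.comp Q ≈ P'.comp Q' := by
  obtain ⟨e, he⟩ := h
  obtain ⟨e', he'⟩ := h'
  let m : pullback P.ρ Q.σ ⟶ pullback P'.ρ Q'.σ :=
    pullback.lift (pullback.fst _ _ ≫ e.hom) (pullback.snd _ _ ≫ e'.hom)
      (by simp [he.ρ, he'.σ, pullback.condition])
  apply comp_equiv (m ≫ cokernel.π _)
  · have : compι P Q ≫ m = compι P' Q' := by
      apply pullback.hom_ext
      · simp [m, he.ι]
      · simp [m, he'.κ]
    rw [← Category.assoc, this, cokernel.condition]
  · have : pullback.lift P.κ 0 (by simp) ≫ m = pullback.lift P'.κ 0 (by simp) := by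
      apply pullback.hom_ext
      · simp [m, he.κ]
      · simp [m]
    rw [← Category.assoc, this]
  · have : pullback.lift 0 Q.ι (by simp) ≫ m = pullback.lift 0 Q'.ι (by simp) := by
      apply pullback.hom_ext
      · simp [m]
      · simp [m, he'.ι]
    rw [← Category.assoc, this]
  · simp [comp, m, he.σ]
  · simp [comp, m, he'.ρ]

lemma comp_assoc (P : Butterfly X Y) (Q : Butterfly Y Z) (S : Butterfly Z W) :
    (P.comp Q).comp S ≈ P.comp (Q.comp S) := by
  obtain ⟨V, a, b, hab, hb, hV⟩ : ∃ (V : A) (a : V ⟶ pullback P.ρ Q.σ)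
      (b : V ⟶ pullback (P.comp Q).ρ S.σ),
      a ≫ cokernel.π (compι P Q) = b ≫ pullback.fst _ _ ∧ Epi b ∧
      ∀ {T : A} (l : T ⟶ pullback P.ρ Q.σ) (r : T ⟶ pullback (P.comp Q).ρ S.σ)
        (_ : l ≫ cokernel.π (compι P Q) = r ≫ pullback.fst _ _),
        ∃ x : T ⟶ V, x ≫ a = l ∧ x ≫ b = r :=
    ⟨pullback (cokernel.π (compι P Q)) (pullback.fst (P.comp Q).ρ S.σ), pullback.fst _ _,
      pullback.snd _ _, pullback.condition, inferInstance,
      fun l r h => ⟨pullback.lift l r h, pullback.lift_fst _ _ _, pullback.lift_snd _ _ _⟩⟩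
  have hFG : (a ≫ pullback.snd P.ρ Q.σ) ≫ Q.ρ = (b ≫ pullback.snd _ _) ≫ S.σ := by
    have h1 : (b ≫ pullback.fst _ _) ≫ (P.comp Q).ρ = (b ≫ pullback.snd _ _) ≫ S.σ := by
      rw [Category.assoc, pullback.condition, Category.assoc]
    rw [← h1, ← hab]
    simp
  obtain ⟨c, hc1, hc2⟩ : ∃ c : V ⟶ pullback Q.ρ S.σ,
      c ≫ pullback.fst _ _ = a ≫ pullback.snd P.ρ Q.σ ∧
      c ≫ pullback.snd _ _ = b ≫ pullback.snd _ _ :=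
    ⟨pullback.lift _ _ hFG, pullback.lift_fst _ _ _, pullback.lift_snd _ _ _⟩
  have hEM : (a ≫ pullback.fst _ _) ≫ P.ρ = (c ≫ cokernel.π (compι Q S)) ≫ (Q.comp S).σ := by
    simp only [Category.assoc, cokernel.π_desc]
    rw [← Category.assoc c, hc1, pullback.condition, Category.assoc]
  obtain ⟨d, hd1, hd2⟩ : ∃ d : V ⟶ pullback P.ρ (Q.comp S).σ,
      d ≫ pullback.fst _ _ = a ≫ pullback.fst _ _ ∧
      d ≫ pullback.snd _ _ = c ≫ cokernel.π (compι Q S) :=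
    ⟨pullback.lift _ _ hEM, pullback.lift_fst _ _ _, pullback.lift_snd _ _ _⟩
  obtain ⟨e, he⟩ : ∃ e : V ⟶ (P.comp (Q.comp S)).E, e = d ≫ cokernel.π _ := ⟨_, rfl⟩
  have key : ∀ {T : A} (x : T ⟶ V) (y : T ⟶ Y.left) (z : T ⟶ Z.left)
      (_ : x ≫ a = y ≫ compι P Q + z ≫ pullback.lift 0 Q.ι (by simp))
      (_ : x ≫ b ≫ pullback.snd _ _ = z ≫ S.κ), x ≫ e = 0 := by
    intro T x y z h1 h2
    have hc : x ≫ c = y ≫ pullback.lift Q.κ 0 (by simp) + z ≫ compι Q S := by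
      apply pullback.hom_ext
      · have := h1 =≫ pullback.snd _ _
        rw [Category.assoc, hc1, ← Category.assoc, h1]
        simp
      · rw [Category.assoc, hc2, h2]
        simp
    have : x ≫ d = y ≫ compι P (Q.comp S) := by
      apply pullback.hom_ext
      · rw [Category.assoc, hd1, ← Category.assoc, h1]
        simp
      · rw [Category.assoc, hd2, ← Category.assoc, hc]
        simp
    rw [he, ← Category.assoc, this, Category.assoc, cokernel.condition, Limits.comp_zero]
  have hker : kernel.ι b ≫ e = 0 := by
    have hx : (kernel.ι b ≫ a) ≫ cokernel.π (compι P Q) = 0 := by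
      rw [Category.assoc, hab, kernel.condition_assoc, Limits.zero_comp]
    obtain ⟨T', p, _, y, hy⟩ := comp_refine P Q _ hx
    rw [← cancel_epi p, Limits.comp_zero, ← Category.assoc]
    apply key _ y 0
    · simpa using hy
    · simp
  obtain ⟨t, hbt⟩ : ∃ t, b ≫ t = e := ⟨_, Abelian.comp_epiDesc b e hker⟩
  apply comp_equiv t
  · obtain ⟨x, hx1, hx2⟩ := hV (pullback.lift 0 Q.ι (by simp)) (compι (P.comp Q) S) (by simp)
    rw [← hx2, Category.assoc, hbt]
    apply key _ 0 (𝟙 _)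
    · simp [hx1]
    · rw [← Category.assoc, hx2]; simp
  · obtain ⟨x, hx1, hx2⟩ := hV (pullback.lift P.κ 0 (by simp))
      (pullback.lift (P.comp Q).κ 0 (by simp)) (by simp)
    rw [← hx2, Category.assoc, hbt, he, ← Category.assoc]
    have hxc : x ≫ c = 0 := by
      apply pullback.hom_ext
      · rw [Category.assoc, hc1, ← Category.assoc, hx1]; simp
      · rw [Category.assoc, hc2, ← Category.assoc, hx2]; simp
    have : x ≫ d = pullback.lift P.κ 0 (by simp) := by
      apply pullback.hom_ext
      · rw [Category.assoc, hd1, ← Category.assoc, hx1]; simp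
      · rw [Category.assoc, hd2, ← Category.assoc, hxc]; simp
    rw [this]
  · obtain ⟨x, hx1, hx2⟩ := hV (0 : W.left ⟶ _) (pullback.lift 0 S.ι (by simp)) (by simp)
    rw [← hx2, Category.assoc, hbt, he, ← Category.assoc]
    have hxc : x ≫ c = pullback.lift 0 S.ι (by simp) := by
      apply pullback.hom_ext
      · rw [Category.assoc, hc1, ← Category.assoc, hx1]; simp
      · rw [Category.assoc, hc2, ← Category.assoc, hx2]; simp
    have : x ≫ d = pullback.lift 0 (Q.comp S).ι (by simp) := by
      apply pullback.hom_ext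
      · rw [Category.assoc, hd1, ← Category.assoc, hx1]; simp
      · rw [Category.assoc, hd2, ← Category.assoc, hxc]; simp
    rw [this]
  · rw [← cancel_epi b, ← Category.assoc, hbt, ← Category.assoc b, ← hab, he]
    simp only [Category.assoc, cokernel.π_desc]
    rw [← Category.assoc d, hd1, Category.assoc]
  · rw [← cancel_epi b, ← Category.assoc, hbt, he]
    simp only [Category.assoc, cokernel.π_desc]
    rw [← Category.assoc d, hd2, Category.assoc, cokernel.π_desc, ← Category.assoc, hc2,
      Category.assoc]

lemma comp_strict_iff {P : Butterfly X Y} {g : Y ⟶ Z} {R : Butterfly X Z} :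
    P.comp (strict g) ≈ R ↔ ∃ t : P.E ⟶ R.E, P.κ ≫ t = R.κ ∧ P.ι ≫ t = g.left ≫ R.ι ∧
      t ≫ R.σ = P.σ ∧ t ≫ R.ρ = P.ρ ≫ g.right := by
  constructor
  · intro h
    obtain ⟨s, h0, hκ, hι, hσ, hρ⟩ := exists_of_comp_equiv h
    refine ⟨pullback.lift (𝟙 _) (P.ρ ≫ biprod.inl) (by simp [strict]) ≫ s, ?_, ?_, ?_, ?_⟩
    · rw [← hκ, ← Category.assoc]
      congr 1
      apply pullback.hom_ext <;> simp
    · rw [← hι, ← Category.assoc P.ι, ← Category.assoc g.left]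
      have : P.ι ≫ pullback.lift (𝟙 _) (P.ρ ≫ biprod.inl) (by simp [strict]) =
        compι P (strict g) + g.left ≫ pullback.lift 0 (strict g).ι (by simp) := by
        apply pullback.hom_ext
        · simp
        · apply biprod.hom_ext <;> simp [strict]
      rw [this, Preadditive.add_comp, h0, zero_add]
    · rw [Category.assoc, hσ]; simp
    · rw [Category.assoc, hρ]; simp [strict]
  · rintro ⟨t, hκ, hι, hσ, hρ⟩
    let u : pullback P.ρ (strict g).σ ⟶ Y.right ⊞ Z.left := pullback.snd _ _
    have hu : u ≫ biprod.fst = pullback.fst _ _ ≫ P.ρ := pullback.condition.symm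
    apply comp_equiv (pullback.fst _ _ ≫ t + u ≫ biprod.snd ≫ R.ι)
    · simp [u, hι, strict]
    · simp [u, hκ]
    · simp [u, strict]
    · simp [hσ]
    · have : pullback.snd _ _ ≫ (strict g).ρ = u ≫ (biprod.fst ≫ g.right + biprod.snd ≫ Z.hom) := by
        simp [u, strict, biprod.desc_eq]
      rw [this, Preadditive.comp_add, ← Category.assoc u biprod.fst, hu]
      simp [hρ]

lemma strict_comp_iff {f : X ⟶ Y} {P : Butterfly Y Z} {R : Butterfly X Z} :
    (strict f).comp P ≈ R ↔ ∃ t : R.E ⟶ P.E, R.κ ≫ t = f.left ≫ P.κ ∧ R.ι ≫ t = P.ι ∧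
      t ≫ P.σ = R.σ ≫ f.right ∧ t ≫ P.ρ = R.ρ := by
  constructor
  · rintro h
    obtain ⟨e, he⟩ := Setoid.symm h
    let u : pullback (strict f).ρ P.σ ⟶ X.right ⊞ Y.left := pullback.fst _ _
    have hu : u ≫ biprod.desc f.right Y.hom = pullback.snd _ _ ≫ P.σ := pullback.condition
    let s : pullback (strict f).ρ P.σ ⟶ P.E := pullback.snd _ _ - u ≫ biprod.snd ≫ P.κ
    have hs : compι (strict f) P ≫ s = 0 := by simp [s, u, strict]
    refine ⟨e.hom ≫ cokernel.desc _ s hs, ?_, ?_, ?_, ?_⟩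
    · rw [← Category.assoc, he.κ]
      simp [comp, s, u, strict]
    · rw [← Category.assoc, he.ι]
      simp [comp, s, u]
    · rw [← he.σ, Category.assoc, Category.assoc]
      congr 1
      ext
      simp only [cokernel.π_desc_assoc, comp, s, Preadditive.sub_comp, Category.assoc, κ_σ]
      rw [← hu]
      simp [biprod.desc_eq, u, strict]
    · rw [← he.ρ, Category.assoc]
      congr 1
      ext
      simp [comp, s]
  · rintro ⟨t, hκ, hι, hσ, hρ⟩
    apply Setoid.symm
    apply equiv_of_isHom
      (φ := pullback.lift (R.σ ≫ biprod.inl) t (by simp [strict, hσ]) ≫ cokernel.π _)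
    constructor
    · have : R.κ ≫ pullback.lift (R.σ ≫ biprod.inl) t (by simp [strict, hσ]) =
          pullback.lift (strict f).κ 0 (by simp) + f.left ≫ compι (strict f) P := by
        apply pullback.hom_ext
        · apply biprod.hom_ext <;> simp [strict]
        · simp [hκ]
      rw [← Category.assoc, this]
      simp [comp]
    · simp only [comp]
      rw [← Category.assoc]
      congr 1
      apply pullback.hom_ext <;> simp [hι]
    · simp [comp, strict]
    · simp [comp, hρ]

lemma strict_comp_strict (f : X ⟶ Y) (g : Y ⟶ Z) :
    (strict f).comp (strict g) ≈ strict (f ≫ g) := by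
  rw [comp_strict_iff]
  refine ⟨biprod.map (𝟙 _) g.left, ?_, ?_, ?_, ?_⟩
  · simp only [strict]
    apply biprod.hom_ext <;> simp
  · simp [strict]
  · simp [strict]
  · simp only [strict]
    apply biprod.hom_ext' <;> simp

lemma comp_id (P : Butterfly X Y) : P.comp (strict (𝟙 Y)) ≈ P := by
  rw [comp_strict_iff]
  exact ⟨𝟙 _, by simp⟩

lemma id_comp (P : Butterfly X Y) : (strict (𝟙 X)).comp P ≈ P := by
  rw [strict_comp_iff]
  exact ⟨𝟙 _, by simp⟩

lemma comp_zero (P : Butterfly X Y) (Z : Arrow A) :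
    P.comp (strict (Arrow.homMk 0 0 : Y ⟶ Z)) ≈ strict (Arrow.homMk 0 0) := by
  rw [comp_strict_iff]
  refine ⟨P.σ ≫ biprod.inl, ?_, ?_, ?_, ?_⟩
  · simp only [strict]
    apply biprod.hom_ext <;> simp
  · simp
  · simp [strict]
  · simp [strict]

lemma zero_comp (X : Arrow A) (P : Butterfly Y Z) :
    (strict (Arrow.homMk 0 0 : X ⟶ Y)).comp P ≈ strict (Arrow.homMk 0 0) := by
  rw [strict_comp_iff]
  refine ⟨biprod.snd ≫ P.ι, ?_, ?_, ?_, ?_⟩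
  · simp [strict]
  · simp [strict]
  · simp [strict]
  · simp only [strict]
    apply biprod.hom_ext' <;> simp

end Butterfly
/-- A torsion pair (torsion theory) `(T, F)` in an abelian category. -/
structure TorsionPair (A : Type u) [Category.{v} A] [Abelian A] where
  T : ObjectProperty A
  F : ObjectProperty A
  T_iso : ∀ {X Y : A}, (X ≅ Y) → T X → T Y
  F_iso : ∀ {X Y : A}, (X ≅ Y) → F X → F Y
  hom_eq_zero : ∀ {X Y : A}, T X → F Y → ∀ f : X ⟶ Y, f = 0
  exists_seq : ∀ X : A, ∃ (M N : A) (i : M ⟶ X) (p : X ⟶ N) (w : i ≫ p = 0),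
    (ShortComplex.mk i p w).ShortExact ∧ T M ∧ F N

namespace TorsionPair

variable (t : TorsionPair A)

lemma F_of_hom {X : A} (h : ∀ {M : A}, t.T M → ∀ f : M ⟶ X, f = 0) : t.F X := by
  obtain ⟨M, N, i, p, w, hS, hM, hN⟩ := t.exists_seq X
  have := hS.mono_f
  have := hS.epi_g
  have hp : Mono p := hS.exact.mono_g (h hM i)
  have : Epi p := hS.epi_g
  have : IsIso p := isIso_of_mono_of_epi p
  exact t.F_iso (asIso p).symm hN

lemma T_of_hom {X : A} (h : ∀ {N : A}, t.F N → ∀ f : X ⟶ N, f = 0) : t.T X := by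
  obtain ⟨M, N, i, p, w, hS, hM, hN⟩ := t.exists_seq X
  have hi : Epi i := hS.exact.epi_f (h hN p)
  have : Mono i := hS.mono_f
  have : IsIso i := isIso_of_mono_of_epi i
  exact t.T_iso (asIso i) hM

lemma F_of_mono {X Y : A} (m : X ⟶ Y) [Mono m] (hY : t.F Y) : t.F X :=
  t.F_of_hom fun hM f => by
    rw [← cancel_mono m, zero_comp]
    exact t.hom_eq_zero hM hY _

lemma T_of_epi {X Y : A} (p : X ⟶ Y) [Epi p] (hX : t.T X) : t.T Y :=
  t.T_of_hom fun hN f => by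
    rw [← cancel_epi p, comp_zero]
    exact t.hom_eq_zero hX hN _

lemma F_kernel_of_comp {X Y Z : A} (f : X ⟶ Y) (g : Y ⟶ Z) (h : X ⟶ Z) (e : f ≫ g = h)
    (hF : t.F (kernel h)) : t.F (kernel f) := by
  have w : kernel.ι f ≫ h = 0 := by rw [← e, ← Category.assoc, kernel.condition, zero_comp]
  have : Mono (kernel.lift h (kernel.ι f) w) := mono_of_mono_fac (kernel.lift_ι _ _ w)
  exact t.F_of_mono (kernel.lift h (kernel.ι f) w) hF

lemma T_cokernel_of_comp {X Y Z : A} (f : X ⟶ Y) (g : Y ⟶ Z) (h : X ⟶ Z) (e : f ≫ g = h)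
    (hT : t.T (cokernel h)) : t.T (cokernel g) := by
  have w : h ≫ cokernel.π g = 0 := by rw [← e, Category.assoc, cokernel.condition, comp_zero]
  have : Epi (cokernel.desc h (cokernel.π g) w) := epi_of_epi_fac (cokernel.π_desc _ _ w)
  exact t.T_of_epi (cokernel.desc h (cokernel.π g) w) hT

/-- For a complex `X ⟶ E ⟶ Y` with torsion part `M` of the middle cohomology, there is a
subobject `S` of `E` with `S / im κ ≅ M`. -/
lemma exists_factor {X E Y : A} (κ : X ⟶ E) (ρ : E ⟶ Y) (w : κ ≫ ρ = 0) :
    ∃ (S : A) (a : S ⟶ E) (k : X ⟶ S) (_ : Mono a) (ha : a ≫ ρ = 0), k ≫ a = κ ∧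
      t.T (cokernel k) ∧ t.F (kernel (cokernel.desc a ρ ha)) := by
  let q := cokernel.π (kernel.lift ρ κ w)
  obtain ⟨M, N, i, p, wip, hS, hM, hN⟩ := t.exists_seq (cokernel (kernel.lift ρ κ w))
  have hi : Mono i := hS.mono_f
  have hp : Epi p := hS.epi_g
  have hk0 : kernel.lift ρ κ w ≫ q ≫ p = 0 := by
    rw [← Category.assoc, cokernel.condition, zero_comp]
  refine ⟨kernel (q ≫ p), kernel.ι (q ≫ p) ≫ kernel.ι ρ, kernel.lift _ _ hk0, inferInstance,
    by simp, by simp, ?_, ?_⟩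
  · -- `S ⟶ M` is an epimorphism whose kernel is the image of `k`
    have h0 : (kernel.ι (q ≫ p) ≫ q) ≫ p = 0 := by
      rw [Category.assoc, kernel.condition]
    obtain ⟨f, hf⟩ : ∃ f : kernel (q ≫ p) ⟶ M, f ≫ i = kernel.ι (q ≫ p) ≫ q :=
      ⟨hS.exact.lift _ h0, hS.exact.lift_f _ h0⟩
    have hfe : Epi f := by
      rw [epi_iff_surjective_up_to_refinements]
      intro T x
      obtain ⟨T', π, hπ, y, hy⟩ := surjective_up_to_refinements_of_epi q (x ≫ i)
      refine ⟨T', π, hπ, kernel.lift _ y ?_, ?_⟩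
      · rw [← Category.assoc, ← hy]; simp [wip]
      · rw [← cancel_mono i, Category.assoc, Category.assoc]
        refine hy.trans ?_
        rw [hf, ← Category.assoc, kernel.lift_ι]
    have hker : kernel.ι f ≫ cokernel.π (kernel.lift _ _ hk0) = 0 := by
      have h1 : (kernel.ι f ≫ kernel.ι (q ≫ p)) ≫ q = 0 := by
        rw [Category.assoc, ← hf, ← Category.assoc, kernel.condition, zero_comp]
      obtain ⟨T', π, hπ, y, hy⟩ :=
        (CokernelCofork.IsColimit.comp_π_eq_zero_iff_up_to_refinements
          (cokernelIsCokernel (kernel.lift ρ κ w)) _).1 h1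
      rw [← cancel_epi π, comp_zero]
      have : π ≫ kernel.ι f = y ≫ kernel.lift _ _ hk0 := by
        rw [← cancel_mono (kernel.ι (q ≫ p))]
        simpa using hy
      rw [← Category.assoc, this, Category.assoc, cokernel.condition, comp_zero]
    have h2 := Abelian.comp_epiDesc f _ hker
    have : Epi (Abelian.epiDesc f _ hker) := by
      have : Epi (f ≫ Abelian.epiDesc f _ hker) := by rw [h2]; infer_instance
      exact epi_of_epi f _
    exact t.T_of_epi (Abelian.epiDesc f _ hker) hM
  · set a := kernel.ι (q ≫ p) ≫ kernel.ι ρ with ha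
    have haρ : a ≫ ρ = 0 := by simp [ha]
    obtain ⟨e, he⟩ : ∃ e : kernel ρ ⟶ kernel (cokernel.desc a ρ haρ),
        e ≫ kernel.ι _ = kernel.ι ρ ≫ cokernel.π a :=
      ⟨kernel.lift _ (kernel.ι ρ ≫ cokernel.π a) (by simp), by simp⟩
    have hee : Epi e := by
      rw [epi_iff_surjective_up_to_refinements]
      intro T x
      obtain ⟨T', π, hπ, y, hy⟩ := surjective_up_to_refinements_of_epi (cokernel.π a)
        (x ≫ kernel.ι _)
      refine ⟨T', π, hπ, kernel.lift _ y ?_, ?_⟩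
      · have := hy =≫ cokernel.desc a ρ haρ
        simpa using this.symm
      · rw [← cancel_mono (kernel.ι _), Category.assoc, Category.assoc]
        refine hy.trans ?_
        rw [he, ← Category.assoc, kernel.lift_ι]
    have hker : kernel.ι e ≫ q ≫ p = 0 := by
      have h1 : (kernel.ι e ≫ kernel.ι ρ) ≫ cokernel.π a = 0 := by
        rw [Category.assoc, ← he, ← Category.assoc, kernel.condition, zero_comp]
      have h2 := Abelian.monoLift_comp a _ h1
      have h3 : kernel.ι e = Abelian.monoLift a _ h1 ≫ kernel.ι (q ≫ p) := by
        rw [← cancel_mono (kernel.ι ρ), Category.assoc, ← ha, h2]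
      rw [h3, Category.assoc, kernel.condition, comp_zero]
    have hm := Abelian.comp_epiDesc e _ hker
    have : Mono (Abelian.epiDesc e _ hker) := by
      rw [Preadditive.mono_iff_cancel_zero]
      intro T x hx
      obtain ⟨T', π, hπ, y, hy⟩ := surjective_up_to_refinements_of_epi e x
      have h1 : y ≫ q ≫ p = 0 := by
        rw [← hm, ← Category.assoc, ← hy, Category.assoc, hx, comp_zero]
      have h2 : y ≫ e = 0 := by
        rw [← cancel_mono (kernel.ι _), Category.assoc, he, zero_comp,
          ← kernel.lift_ι (q ≫ p) y h1, Category.assoc, ← Category.assoc (kernel.ι (q ≫ p)), ← ha,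
          cokernel.condition, comp_zero]
      rw [← cancel_epi π, hy, h2, comp_zero]
    exact t.F_of_mono (Abelian.epiDesc e _ hker) hN

end TorsionPair

/-- The objects of the tilted category `B`: two-term complexes `d : X⁻¹ ⟶ X⁰` with
`ker d` in `F` and `coker d` in `T`. -/
structure Tilt (t : TorsionPair A) where
  arrow : Arrow A
  ker_mem : t.F (kernel arrow.hom)
  coker_mem : t.T (cokernel arrow.hom)

namespace Tilt

variable {t : TorsionPair A} {X Y Z W : Tilt t}

/-- Morphisms of `B` are isomorphism classes of butterflies. -/
instance : Category.{max u v} (Tilt t) where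
  Hom X Y := Quotient (Butterfly.setoid X.arrow Y.arrow)
  id X := ⟦Butterfly.strict (𝟙 X.arrow)⟧
  comp := Quotient.map₂ Butterfly.comp fun _ _ h _ _ h' => Butterfly.comp_congr h h'
  id_comp := by rintro _ _ ⟨P⟩; exact Quotient.sound (Butterfly.id_comp P)
  comp_id := by rintro _ _ ⟨P⟩; exact Quotient.sound (Butterfly.comp_id P)
  assoc := by
    rintro _ _ _ _ ⟨P⟩ ⟨Q⟩ ⟨R⟩
    exact Quotient.sound (Butterfly.comp_assoc P Q R)

/-- The class of a butterfly. -/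
def toHom (P : Butterfly X.arrow Y.arrow) : X ⟶ Y := Quotient.mk _ P

/-- A chosen butterfly representing a morphism of `B`. -/
def out (f : X ⟶ Y) : Butterfly X.arrow Y.arrow := Quotient.out f

/-- The strict morphism given by a morphism of two-term complexes. -/
def strictHom (f : X.arrow ⟶ Y.arrow) : X ⟶ Y := toHom (Butterfly.strict f)

@[simp] lemma toHom_out (f : X ⟶ Y) : toHom (out f) = f := Quotient.out_eq f

lemma toHom_eq_iff {P Q : Butterfly X.arrow Y.arrow} : toHom P = toHom Q ↔ P ≈ Q :=
  Quotient.eq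

lemma toHom_comp (P : Butterfly X.arrow Y.arrow) (Q : Butterfly Y.arrow Z.arrow) :
    toHom P ≫ toHom Q = toHom (P.comp Q) := rfl

lemma exists_rep (f : X ⟶ Y) : ∃ P, toHom P = f := ⟨out f, toHom_out f⟩

lemma strictHom_id (X : Tilt t) : strictHom (𝟙 X.arrow) = 𝟙 X := rfl

lemma strictHom_comp (f : X.arrow ⟶ Y.arrow) (g : Y.arrow ⟶ Z.arrow) :
    (strictHom f : X ⟶ Y) ≫ (strictHom g : Y ⟶ Z) = strictHom (f ≫ g) :=
  toHom_eq_iff.2 (Butterfly.strict_comp_strict f g)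

lemma comp_strictHom_eq {P : Butterfly X.arrow Y.arrow} {g : Y.arrow ⟶ Z.arrow}
    {R : Butterfly X.arrow Z.arrow} :
    toHom P ≫ strictHom g = toHom R ↔ ∃ t : P.E ⟶ R.E, P.κ ≫ t = R.κ ∧
      P.ι ≫ t = g.left ≫ R.ι ∧ t ≫ R.σ = P.σ ∧ t ≫ R.ρ = P.ρ ≫ g.right := by
  unfold strictHom
  rw [toHom_comp, toHom_eq_iff, Butterfly.comp_strict_iff]

lemma strictHom_comp_eq {f : X.arrow ⟶ Y.arrow} {P : Butterfly Y.arrow Z.arrow}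
    {R : Butterfly X.arrow Z.arrow} :
    strictHom f ≫ toHom P = toHom R ↔ ∃ t : R.E ⟶ P.E, R.κ ≫ t = f.left ≫ P.κ ∧
      R.ι ≫ t = P.ι ∧ t ≫ P.σ = R.σ ≫ f.right ∧ t ≫ P.ρ = R.ρ := by
  unfold strictHom
  rw [toHom_comp, toHom_eq_iff, Butterfly.strict_comp_iff]

/-- The zero butterfly. -/
abbrev zeroB (X Y : Tilt t) : Butterfly X.arrow Y.arrow := Butterfly.strict (Arrow.homMk 0 0)

instance (X Y : Tilt t) : Zero (X ⟶ Y) := ⟨toHom (zeroB X Y)⟩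

lemma zero_def (X Y : Tilt t) : (0 : X ⟶ Y) = toHom (zeroB X Y) := rfl

/-- The zero morphisms of `B`. -/
abbrev hasZeroMorphisms (t : TorsionPair A) : HasZeroMorphisms (Tilt t) where
  comp_zero := by
    intro X Y f Z
    obtain ⟨P, rfl⟩ := exists_rep f
    exact toHom_eq_iff.2 (Butterfly.comp_zero P Z.arrow)
  zero_comp := by
    intro X Y Z f
    obtain ⟨P, rfl⟩ := exists_rep f
    exact toHom_eq_iff.2 (Butterfly.zero_comp X.arrow P)

lemma factor_coker (P : Butterfly X.arrow Y.arrow) {V : A} (h : P.E ⟶ V) (hκ : P.κ ≫ h = 0)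
    (hι : P.ι ≫ h = 0) :
    ∃ g : cokernel X.arrow.hom ⟶ V, P.σ ≫ cokernel.π X.arrow.hom ≫ g = h := by
  obtain ⟨g, hg⟩ := P.exists_desc h hι
  have : X.arrow.hom ≫ g = 0 := by rw [← P.κ_σ, Category.assoc, hg, hκ]
  exact ⟨cokernel.desc _ g this, by rw [cokernel.π_desc, hg]⟩

lemma factor_ker (P : Butterfly X.arrow Y.arrow) {V : A} (h : V ⟶ P.E) (hσ : h ≫ P.σ = 0)
    (hρ : h ≫ P.ρ = 0) :
    ∃ g : V ⟶ kernel Y.arrow.hom, g ≫ kernel.ι Y.arrow.hom ≫ P.ι = h := by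
  obtain ⟨g, hg⟩ := P.exists_lift h hσ
  have : g ≫ Y.arrow.hom = 0 := by rw [← P.ι_ρ, ← Category.assoc, hg, hρ]
  exact ⟨kernel.lift _ g this, by rw [← Category.assoc, kernel.lift_ι, hg]⟩

lemma zero_of_torsion (P : Butterfly X.arrow Y.arrow) {V : A} (hV : t.T V) (h : V ⟶ P.E)
    (hσ : h ≫ P.σ = 0) (hρ : h ≫ P.ρ = 0) : h = 0 := by
  obtain ⟨g, rfl⟩ := factor_ker P h hσ hρ
  rw [t.hom_eq_zero hV Y.ker_mem g, zero_comp]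

lemma zero_of_free (P : Butterfly X.arrow Y.arrow) {V : A} (hV : t.F V) (h : P.E ⟶ V)
    (hκ : P.κ ≫ h = 0) (hι : P.ι ≫ h = 0) : h = 0 := by
  obtain ⟨g, rfl⟩ := factor_coker P h hκ hι
  rw [t.hom_eq_zero X.coker_mem hV g, comp_zero, comp_zero]

/-- A map between the centres of two butterflies that is killed by all four arrows vanishes. -/
lemma vanish (P : Butterfly X.arrow Y.arrow) (Q : Butterfly Z.arrow W.arrow) (h : P.E ⟶ Q.E)
    (hκ : P.κ ≫ h = 0) (hι : P.ι ≫ h = 0) (hσ : h ≫ Q.σ = 0) (hρ : h ≫ Q.ρ = 0) : h = 0 := by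
  obtain ⟨g, rfl⟩ := factor_coker P h hκ hι
  have : g = 0 := by
    apply zero_of_torsion Q X.coker_mem
    · rw [← cancel_epi (cokernel.π X.arrow.hom), ← cancel_epi P.σ]
      simpa using hσ
    · rw [← cancel_epi (cokernel.π X.arrow.hom), ← cancel_epi P.σ]
      simpa using hρ
  rw [this, comp_zero, comp_zero]

/-- `δ` is a link from `P` to `Q`. -/
structure IsLink (P : Butterfly X.arrow Y.arrow) (Q : Butterfly Y.arrow Z.arrow)
    (δ : P.E ⟶ Q.E) : Prop where
  κ_δ : P.κ ≫ δ = 0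
  ι_δ : P.ι ≫ δ = Q.κ
  δ_σ : δ ≫ Q.σ = P.ρ
  δ_ρ : δ ≫ Q.ρ = 0

lemma exists_link {P : Butterfly X.arrow Y.arrow} {Q : Butterfly Y.arrow Z.arrow}
    (h : toHom P ≫ toHom Q = 0) : ∃ δ, IsLink P Q δ := by
  rw [toHom_comp, zero_def, toHom_eq_iff] at h
  obtain ⟨s, h0, hκ, hι, hσ, hρ⟩ := Butterfly.exists_of_comp_equiv h
  obtain ⟨r, hr⟩ : ∃ r : pullback P.ρ Q.σ ⟶ Z.arrow.left, r = s ≫ biprod.snd := ⟨_, rfl⟩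
  have h0' : Butterfly.compι P Q ≫ r = 0 := by rw [hr, ← Category.assoc, h0, zero_comp]
  have hκ' : pullback.lift P.κ 0 (by simp) ≫ r = 0 := by
    rw [hr, ← Category.assoc, hκ]; simp
  have hι' : pullback.lift 0 Q.ι (by simp) ≫ r = 𝟙 _ := by
    rw [hr, ← Category.assoc, hι]; simp
  have hρ' : r ≫ Z.arrow.hom = pullback.snd _ _ ≫ Q.ρ := by
    rw [← hρ, hr]; simp [biprod.desc_eq]
  let m : pullback P.ρ Q.σ ⟶ Q.E := pullback.snd _ _ - r ≫ Q.ι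
  have hker : kernel.ι (pullback.fst P.ρ Q.σ) ≫ m = 0 := by
    obtain ⟨z, hz⟩ := Q.exists_lift (kernel.ι (pullback.fst P.ρ Q.σ) ≫ pullback.snd _ _) (by
      rw [Category.assoc, ← pullback.condition, ← Category.assoc, kernel.condition, zero_comp])
    have : kernel.ι (pullback.fst P.ρ Q.σ) = z ≫ pullback.lift 0 Q.ι (by simp) := by
      apply pullback.hom_ext
      · simp
      · simp [hz]
    simp only [m]
    rw [this, Category.assoc, Preadditive.comp_sub, ← Category.assoc _ r, hι']
    simp
  have hδ := Abelian.comp_epiDesc (pullback.fst P.ρ Q.σ) m hker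
  set δ := Abelian.epiDesc (pullback.fst P.ρ Q.σ) m hker
  refine ⟨δ, ?_, ?_, ?_, ?_⟩
  · have h1 : P.κ = pullback.lift P.κ 0 (by simp) ≫ pullback.fst P.ρ Q.σ := by simp
    rw [h1, Category.assoc, hδ]
    simp only [m, Preadditive.comp_sub]
    rw [← Category.assoc _ r, hκ']; simp
  · have h1 : P.ι = Butterfly.compι P Q ≫ pullback.fst P.ρ Q.σ := by simp
    rw [h1, Category.assoc, hδ]
    simp only [m, Preadditive.comp_sub]
    rw [← Category.assoc _ r, h0']; simp
  · rw [← cancel_epi (pullback.fst P.ρ Q.σ), ← Category.assoc, hδ]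
    simp [m, pullback.condition]
  · rw [← cancel_epi (pullback.fst P.ρ Q.σ), ← Category.assoc, hδ]
    simp [m, hρ']

lemma IsLink.unique {P : Butterfly X.arrow Y.arrow} {Q : Butterfly Y.arrow Z.arrow}
    {δ δ' : P.E ⟶ Q.E} (h : IsLink P Q δ) (h' : IsLink P Q δ') : δ = δ' := by
  rw [← sub_eq_zero]
  apply vanish P Q
  · simp [h.κ_δ, h'.κ_δ]
  · simp [h.ι_δ, h'.ι_δ]
  · simp [h.δ_σ, h'.δ_σ]
  · simp [h.δ_ρ, h'.δ_ρ]

lemma IsLink.comp {P : Butterfly X.arrow Y.arrow} {Q : Butterfly Y.arrow Z.arrow}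
    {R : Butterfly Z.arrow W.arrow}
    {δ : P.E ⟶ Q.E} {δ' : Q.E ⟶ R.E} (h : IsLink P Q δ) (h' : IsLink Q R δ') : δ ≫ δ' = 0 := by
  apply vanish P R
  · rw [← Category.assoc, h.κ_δ, zero_comp]
  · rw [← Category.assoc, h.ι_δ, h'.κ_δ]
  · rw [Category.assoc, h'.δ_σ, h.δ_ρ]
  · rw [Category.assoc, h'.δ_ρ, comp_zero]

section Kernels

variable (P : Butterfly X.arrow Y.arrow)

/-- The subobject `S` of the centre of a butterfly that lies between `im κ` and `ker ρ`, with
`S / im κ` torsion and `ker ρ / S` torsion-free. -/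
structure Factor where
  S : A
  a : S ⟶ P.E
  k : X.arrow.left ⟶ S
  mono : Mono a
  a_ρ : a ≫ P.ρ = 0
  k_a : k ≫ a = P.κ
  coker_mem : t.T (cokernel k)
  ker_mem : t.F (kernel (cokernel.desc a P.ρ a_ρ))

lemma Factor.nonempty : Nonempty (Factor P) := by
  obtain ⟨S, a, k, h1, h2, h3, h4, h5⟩ := t.exists_factor P.κ P.ρ P.κ_ρ
  exact ⟨⟨S, a, k, h1, h2, h3, h4, h5⟩⟩

variable {P} (τ : Factor P)

namespace Factor

attribute [instance] Factor.mono
attribute [simp] a_ρ k_a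

/-- The map `E / S ⟶ Y⁰` induced by `ρ`. -/
abbrev b : cokernel τ.a ⟶ Y.arrow.right := cokernel.desc τ.a P.ρ τ.a_ρ

lemma κ_π : P.κ ≫ cokernel.π τ.a = 0 := by
  rw [← τ.k_a, Category.assoc, cokernel.condition, comp_zero]

@[simp] lemma k_a_σ : τ.k ≫ τ.a ≫ P.σ = X.arrow.hom := by
  rw [← Category.assoc, τ.k_a, P.κ_σ]

lemma ι_π_b : (P.ι ≫ cokernel.π τ.a) ≫ τ.b = Y.arrow.hom := by simp

/-- The kernel `[X⁻¹ ⟶ S]`. -/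
abbrev ker : Tilt t where
  arrow := Arrow.mk τ.k
  ker_mem := t.F_kernel_of_comp _ _ _ τ.k_a_σ X.ker_mem
  coker_mem := τ.coker_mem

/-- The cokernel `[E / S ⟶ Y⁰]`. -/
abbrev coker : Tilt t where
  arrow := Arrow.mk τ.b
  ker_mem := τ.ker_mem
  coker_mem := t.T_cokernel_of_comp _ _ _ τ.ι_π_b Y.coker_mem

/-- The image `[Y⁻¹ ⟶ E / S]`. -/
abbrev im : Tilt t where
  arrow := Arrow.mk (P.ι ≫ cokernel.π τ.a)
  ker_mem := t.F_kernel_of_comp _ _ _ τ.ι_π_b Y.ker_mem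
  coker_mem := by
    obtain ⟨g, hg⟩ := factor_coker P (cokernel.π τ.a ≫ cokernel.π (P.ι ≫ cokernel.π τ.a))
      (by rw [← Category.assoc, τ.κ_π, zero_comp])
      (by rw [← Category.assoc, cokernel.condition])
    have : Epi g := by
      rw [← Category.assoc] at hg
      exact epi_of_epi_fac hg
    exact t.T_of_epi g X.coker_mem

/-- The coimage `[S ⟶ X⁰]`. -/
abbrev coim : Tilt t where
  arrow := Arrow.mk (τ.a ≫ P.σ)
  ker_mem := by
    obtain ⟨g, hg⟩ := factor_ker P (kernel.ι (τ.a ≫ P.σ) ≫ τ.a)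
      (by rw [Category.assoc, kernel.condition])
      (by rw [Category.assoc, τ.a_ρ, comp_zero])
    have : Mono g := mono_of_mono_fac hg
    exact t.F_of_mono g Y.ker_mem
  coker_mem := t.T_cokernel_of_comp _ _ _ τ.k_a_σ X.coker_mem

/-- The map `ker ⟶ X`. -/
abbrev incl : τ.ker.arrow ⟶ X.arrow :=
  Arrow.homMk (𝟙 X.arrow.left) (τ.a ≫ P.σ) ((Category.id_comp _).trans τ.k_a_σ.symm)

/-- The map `Y ⟶ coker`. -/
abbrev proj : Y.arrow ⟶ τ.coker.arrow :=
  Arrow.homMk (P.ι ≫ cokernel.π τ.a) (𝟙 Y.arrow.right) (τ.ι_π_b.trans (Category.comp_id _).symm)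

/-- The map `im ⟶ Y`. -/
abbrev imι : τ.im.arrow ⟶ Y.arrow :=
  Arrow.homMk (𝟙 Y.arrow.left) τ.b ((Category.id_comp _).trans τ.ι_π_b.symm)

/-- The map `X ⟶ coim`. -/
abbrev coimπ : X.arrow ⟶ τ.coim.arrow :=
  Arrow.homMk τ.k (𝟙 X.arrow.right) (τ.k_a_σ.trans (Category.comp_id _).symm)

lemma incl_comp : strictHom (X := τ.ker) (Y := X) τ.incl ≫ toHom P = 0 := by
  rw [zero_def, strictHom_comp_eq]
  refine ⟨biprod.desc τ.a P.ι, ?_, ?_, ?_, ?_⟩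
  · simp [biprod.lift_desc]
  · simp
  · apply biprod.hom_ext' <;> simp
  · apply biprod.hom_ext' <;> simp

lemma comp_proj : toHom P ≫ strictHom (X := Y) (Y := τ.coker) τ.proj = 0 := by
  rw [zero_def, comp_strictHom_eq]
  refine ⟨biprod.lift P.σ (cokernel.π τ.a), ?_, ?_, ?_, ?_⟩
  · apply biprod.hom_ext <;> simp [τ.κ_π]
  · apply biprod.hom_ext <;> simp
  · simp
  · simp [biprod.lift_desc]

lemma imι_proj : strictHom (X := τ.im) (Y := Y) τ.imι ≫
    strictHom (X := Y) (Y := τ.coker) τ.proj = 0 := by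
  rw [zero_def, show strictHom (X := Y) (Y := τ.coker) τ.proj = toHom _ from rfl,
    strictHom_comp_eq]
  refine ⟨biprod.desc (biprod.lift τ.b (-𝟙 _)) biprod.inr, ?_, ?_, ?_, ?_⟩
  · apply biprod.hom_ext <;> simp [biprod.lift_desc]
  · simp
  · apply biprod.hom_ext' <;> simp
  · apply biprod.hom_ext' <;> simp [biprod.lift_desc]

lemma incl_coimπ : strictHom (X := τ.ker) (Y := X) τ.incl ≫
    strictHom (X := X) (Y := τ.coim) τ.coimπ = 0 := by
  rw [zero_def, show strictHom (X := τ.ker) (Y := X) τ.incl = toHom _ from rfl,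
    comp_strictHom_eq]
  refine ⟨biprod.desc (biprod.lift (𝟙 _) (𝟙 _)) (τ.k ≫ biprod.inr), ?_, ?_, ?_, ?_⟩
  · apply biprod.hom_ext <;> simp [biprod.lift_desc]
  · simp
  · apply biprod.hom_ext' <;> simp
  · apply biprod.hom_ext'
    · simp [biprod.lift_desc]
    · simp


/-- A map to `ker` is determined by its composition with `incl`. -/
lemma incl_cancel {u v : Z ⟶ τ.ker}
    (h : u ≫ strictHom (X := τ.ker) (Y := X) τ.incl =
      v ≫ strictHom (X := τ.ker) (Y := X) τ.incl) : u = v := by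
  obtain ⟨F, rfl⟩ := exists_rep u
  obtain ⟨G, rfl⟩ := exists_rep v
  let R : Butterfly Z.arrow X.arrow :=
    { G with
      ρ := G.ρ ≫ τ.a ≫ P.σ
      ι_ρ := by rw [← Category.assoc, G.ι_ρ]; exact τ.k_a_σ
      κ_ρ := by simp }
  have hR : toHom G ≫ strictHom (X := τ.ker) (Y := X) τ.incl = toHom R :=
    comp_strictHom_eq.2 ⟨𝟙 _, by simp [R], by simp [R], by simp [R], by simp [R]⟩
  rw [hR, comp_strictHom_eq] at h
  obtain ⟨s, h1, h2, h3, h4⟩ := h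
  have h1 : F.κ ≫ s = G.κ := h1
  have h2 : F.ι ≫ s = G.ι := h2.trans (Category.id_comp _)
  have h3 : s ≫ G.σ = F.σ := h3
  have h4 : s ≫ G.ρ ≫ τ.a ≫ P.σ = F.ρ ≫ τ.a ≫ P.σ := h4
  have h0 : (s ≫ G.ρ - F.ρ) ≫ τ.a = 0 := by
    apply vanish F P
    · rw [← Category.assoc, Preadditive.comp_sub, ← Category.assoc, h1]; simp
    · rw [← Category.assoc, Preadditive.comp_sub, ← Category.assoc, h2]; simp
    · simp [h4]
    · simp
  refine toHom_eq_iff.2 (Butterfly.equiv_of_isHom (φ := s) ⟨h1, h2, h3, ?_⟩)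
  rw [← sub_eq_zero, ← cancel_mono τ.a, h0, zero_comp]

lemma exists_lift {q : Z ⟶ X} (h : q ≫ toHom P = 0) :
    ∃ l : Z ⟶ τ.ker, l ≫ strictHom (X := τ.ker) (Y := X) τ.incl = q := by
  obtain ⟨F, rfl⟩ := exists_rep q
  obtain ⟨δ, hδ⟩ := exists_link h
  have h0 : δ ≫ cokernel.π τ.a = 0 := by
    have hb : (δ ≫ cokernel.π τ.a) ≫ τ.b = 0 := by simp [hδ.δ_ρ]
    have : kernel.lift τ.b _ hb = 0 := by
      apply zero_of_free F τ.ker_mem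
      · rw [← cancel_mono (kernel.ι _), Category.assoc, kernel.lift_ι, ← Category.assoc, hδ.κ_δ]
        simp
      · rw [← cancel_mono (kernel.ι _), Category.assoc, kernel.lift_ι, ← Category.assoc, hδ.ι_δ,
          τ.κ_π, zero_comp]
    rw [← kernel.lift_ι τ.b _ hb, this, zero_comp]
  have hl := Abelian.monoLift_comp τ.a δ h0
  let L : Butterfly Z.arrow τ.ker.arrow :=
    { E := F.E
      κ := F.κ
      ι := F.ι
      σ := F.σ
      ρ := Abelian.monoLift τ.a δ h0
      κ_σ := F.κ_σ
      ι_ρ := by rw [← cancel_mono τ.a, Category.assoc, hl, hδ.ι_δ]; exact τ.k_a.symm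
      κ_ρ := by rw [← cancel_mono τ.a, Category.assoc, hl, hδ.κ_δ, zero_comp]
      ι_σ := F.ι_σ
      shortExact := F.shortExact }
  refine ⟨toHom L, comp_strictHom_eq.2 ⟨𝟙 _, by simp [L], by simp [L], by simp [L], ?_⟩⟩
  rw [Category.id_comp]
  change _ = Abelian.monoLift τ.a δ h0 ≫ τ.a ≫ P.σ
  rw [← Category.assoc, hl, hδ.δ_σ]

/-- A map out of `coker` is determined by its composition with `proj`. -/
lemma proj_cancel {u v : τ.coker ⟶ Z}
    (h : strictHom (X := Y) (Y := τ.coker) τ.proj ≫ u =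
      strictHom (X := Y) (Y := τ.coker) τ.proj ≫ v) : u = v := by
  obtain ⟨F, rfl⟩ := exists_rep u
  obtain ⟨G, rfl⟩ := exists_rep v
  let R : Butterfly Y.arrow Z.arrow :=
    { G with
      κ := (P.ι ≫ cokernel.π τ.a) ≫ G.κ
      κ_σ := by rw [Category.assoc, G.κ_σ]; exact τ.ι_π_b
      κ_ρ := by simp }
  have hR : strictHom (X := Y) (Y := τ.coker) τ.proj ≫ toHom G = toHom R :=
    strictHom_comp_eq.2 ⟨𝟙 _, by simp [R], by simp [R], by simp [R], by simp [R]⟩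
  rw [hR, strictHom_comp_eq] at h
  obtain ⟨s, h1, h2, h3, h4⟩ := h
  have h1 : ((P.ι ≫ cokernel.π τ.a) ≫ G.κ) ≫ s = (P.ι ≫ cokernel.π τ.a) ≫ F.κ := h1
  have h2 : G.ι ≫ s = F.ι := h2
  have h3 : s ≫ F.σ = G.σ := h3.trans (Category.comp_id _)
  have h4 : s ≫ F.ρ = G.ρ := h4
  have h0 : cokernel.π τ.a ≫ (G.κ ≫ s - F.κ) = 0 := by
    apply vanish P F
    · rw [← Category.assoc, τ.κ_π, zero_comp]
    · simp only [Preadditive.comp_sub]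
      rw [sub_eq_zero]
      simpa using h1
    · simp [h3]
    · simp [h4]
  refine toHom_eq_iff.2 (Setoid.symm (Butterfly.equiv_of_isHom (φ := s) ⟨?_, h2, h3, h4⟩))
  rw [← sub_eq_zero, ← cancel_epi (cokernel.π τ.a), h0, comp_zero]

lemma exists_desc {q : Y ⟶ Z} (h : toHom P ≫ q = 0) :
    ∃ l : τ.coker ⟶ Z, strictHom (X := Y) (Y := τ.coker) τ.proj ≫ l = q := by
  obtain ⟨F, rfl⟩ := exists_rep q
  obtain ⟨δ, hδ⟩ := exists_link h
  have h0 : τ.a ≫ δ = 0 := by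
    have hk : τ.k ≫ τ.a ≫ δ = 0 := by rw [← Category.assoc, τ.k_a, hδ.κ_δ]
    have : cokernel.desc τ.k _ hk = 0 := by
      apply zero_of_torsion F τ.coker_mem
      · rw [← cancel_epi (cokernel.π _), ← Category.assoc, cokernel.π_desc, Category.assoc, hδ.δ_σ]
        simp
      · rw [← cancel_epi (cokernel.π _), ← Category.assoc, cokernel.π_desc, Category.assoc, hδ.δ_ρ]
        simp
    rw [← cokernel.π_desc τ.k _ hk, this, comp_zero]
  let L : Butterfly τ.coker.arrow Z.arrow :=
    { E := F.E
      κ := cokernel.desc τ.a δ h0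
      ι := F.ι
      σ := F.σ
      ρ := F.ρ
      κ_σ := by
        rw [← cancel_epi (cokernel.π τ.a), ← Category.assoc, cokernel.π_desc, hδ.δ_σ]
        exact (cokernel.π_desc _ _ _).symm
      ι_ρ := F.ι_ρ
      κ_ρ := by
        rw [← cancel_epi (cokernel.π τ.a), ← Category.assoc, cokernel.π_desc, hδ.δ_ρ, comp_zero]
      ι_σ := F.ι_σ
      shortExact := F.shortExact }
  refine ⟨toHom L, strictHom_comp_eq.2 ⟨𝟙 _, ?_, by simp [L], by simp [L], by simp [L]⟩⟩
  rw [Category.comp_id]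
  change F.κ = (P.ι ≫ cokernel.π τ.a) ≫ cokernel.desc τ.a δ h0
  rw [Category.assoc, cokernel.π_desc, hδ.ι_δ]

lemma imι_cancel {u v : Z ⟶ τ.im}
    (h : u ≫ strictHom (X := τ.im) (Y := Y) τ.imι =
      v ≫ strictHom (X := τ.im) (Y := Y) τ.imι) : u = v := by
  obtain ⟨F, rfl⟩ := exists_rep u
  obtain ⟨G, rfl⟩ := exists_rep v
  let R : Butterfly Z.arrow Y.arrow :=
    { G with
      ρ := G.ρ ≫ τ.b
      ι_ρ := by rw [← Category.assoc, G.ι_ρ]; exact τ.ι_π_b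
      κ_ρ := by simp }
  have hR : toHom G ≫ strictHom (X := τ.im) (Y := Y) τ.imι = toHom R :=
    comp_strictHom_eq.2 ⟨𝟙 _, by simp [R], by simp [R], by simp [R], by simp [R]⟩
  rw [hR, comp_strictHom_eq] at h
  obtain ⟨s, h1, h2, h3, h4⟩ := h
  have h1 : F.κ ≫ s = G.κ := h1
  have h2 : F.ι ≫ s = G.ι := h2.trans (Category.id_comp _)
  have h3 : s ≫ G.σ = F.σ := h3
  have h4 : s ≫ G.ρ ≫ τ.b = F.ρ ≫ τ.b := h4
  refine toHom_eq_iff.2 (Butterfly.equiv_of_isHom (φ := s) ⟨h1, h2, h3, ?_⟩)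
  have hb : (s ≫ G.ρ - F.ρ) ≫ τ.b = 0 := by
    rw [Preadditive.sub_comp, Category.assoc, h4, sub_self]
  have h0 : kernel.lift τ.b _ hb = 0 := by
    apply zero_of_free F τ.ker_mem
    · rw [← cancel_mono (kernel.ι _), Category.assoc, kernel.lift_ι, Preadditive.comp_sub,
        ← Category.assoc, h1]; simp
    · rw [← cancel_mono (kernel.ι _), Category.assoc, kernel.lift_ι, Preadditive.comp_sub,
        ← Category.assoc, h2]; simp
  rw [← sub_eq_zero, ← kernel.lift_ι τ.b _ hb, h0, zero_comp]

lemma exists_lift_im {q : Z ⟶ Y} (h : q ≫ strictHom (X := Y) (Y := τ.coker) τ.proj = 0) :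
    ∃ l : Z ⟶ τ.im, l ≫ strictHom (X := τ.im) (Y := Y) τ.imι = q := by
  obtain ⟨F, rfl⟩ := exists_rep q
  rw [zero_def, comp_strictHom_eq] at h
  obtain ⟨s, h1, h2, h3, h4⟩ := h
  have h1 : F.κ ≫ s = biprod.lift Z.arrow.hom (-0) := h1
  have h2 : F.ι ≫ s = (P.ι ≫ cokernel.π τ.a) ≫ biprod.inr := h2
  have h4 : s ≫ biprod.desc 0 τ.b = F.ρ := h4.trans (Category.comp_id _)
  let L : Butterfly Z.arrow τ.im.arrow :=
    { E := F.E
      κ := F.κ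
      ι := F.ι
      σ := F.σ
      ρ := s ≫ biprod.snd
      κ_σ := F.κ_σ
      ι_ρ := by rw [← Category.assoc, h2]; simp
      κ_ρ := by rw [← Category.assoc, h1]; simp
      ι_σ := F.ι_σ
      shortExact := F.shortExact }
  refine ⟨toHom L, comp_strictHom_eq.2 ⟨𝟙 _, by simp [L], by simp [L], by simp [L], ?_⟩⟩
  rw [Category.id_comp, ← h4]
  simp [L, biprod.desc_eq]

lemma coimπ_cancel {u v : τ.coim ⟶ Z}
    (h : strictHom (X := X) (Y := τ.coim) τ.coimπ ≫ u =
      strictHom (X := X) (Y := τ.coim) τ.coimπ ≫ v) : u = v := by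
  obtain ⟨F, rfl⟩ := exists_rep u
  obtain ⟨G, rfl⟩ := exists_rep v
  let R : Butterfly X.arrow Z.arrow :=
    { G with
      κ := τ.k ≫ G.κ
      κ_σ := by rw [Category.assoc, G.κ_σ]; exact τ.k_a_σ
      κ_ρ := by simp }
  have hR : strictHom (X := X) (Y := τ.coim) τ.coimπ ≫ toHom G = toHom R :=
    strictHom_comp_eq.2 ⟨𝟙 _, by simp [R], by simp [R], by simp [R], by simp [R]⟩
  rw [hR, strictHom_comp_eq] at h
  obtain ⟨s, h1, h2, h3, h4⟩ := h
  have h1 : (τ.k ≫ G.κ) ≫ s = τ.k ≫ F.κ := h1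
  have h2 : G.ι ≫ s = F.ι := h2
  have h3 : s ≫ F.σ = G.σ := h3.trans (Category.comp_id _)
  have h4 : s ≫ F.ρ = G.ρ := h4
  have hk : τ.k ≫ (G.κ ≫ s - F.κ) = 0 := by
    rw [Preadditive.comp_sub, ← Category.assoc, h1, sub_self]
  have h0 : cokernel.desc τ.k _ hk = 0 := by
    apply zero_of_torsion F τ.coker_mem
    · rw [← cancel_epi (cokernel.π _), ← Category.assoc, cokernel.π_desc]; simp [h3]
    · rw [← cancel_epi (cokernel.π _), ← Category.assoc, cokernel.π_desc]; simp [h4]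
  refine toHom_eq_iff.2 (Setoid.symm (Butterfly.equiv_of_isHom (φ := s) ⟨?_, h2, h3, h4⟩))
  rw [← sub_eq_zero, ← cokernel.π_desc τ.k _ hk, h0, comp_zero]

lemma exists_desc_coim {q : X ⟶ Z} (h : strictHom (X := τ.ker) (Y := X) τ.incl ≫ q = 0) :
    ∃ l : τ.coim ⟶ Z, strictHom (X := X) (Y := τ.coim) τ.coimπ ≫ l = q := by
  obtain ⟨F, rfl⟩ := exists_rep q
  rw [zero_def, strictHom_comp_eq] at h
  obtain ⟨s, h1, h2, h3, h4⟩ := h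
  have h1 : biprod.lift τ.k (-0) ≫ s = F.κ := h1.trans (Category.id_comp _)
  have h3 : s ≫ F.σ = biprod.fst ≫ τ.a ≫ P.σ := h3
  have h4 : s ≫ F.ρ = biprod.desc 0 Z.arrow.hom := h4
  let L : Butterfly τ.coim.arrow Z.arrow :=
    { E := F.E
      κ := biprod.inl ≫ s
      ι := F.ι
      σ := F.σ
      ρ := F.ρ
      κ_σ := by rw [Category.assoc, h3]; simp
      ι_ρ := F.ι_ρ
      κ_ρ := by rw [Category.assoc, h4]; simp
      ι_σ := F.ι_σ
      shortExact := F.shortExact }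
  refine ⟨toHom L, strictHom_comp_eq.2 ⟨𝟙 _, ?_, by simp [L], by simp [L], by simp [L]⟩⟩
  rw [Category.comp_id, ← h1]
  have : biprod.lift τ.k (-0) = τ.k ≫ (biprod.inl : _ ⟶ τ.S ⊞ Z.arrow.left) := by
    apply biprod.hom_ext <;> simp
  rw [this]
  simp [L]

end Factor

end Kernels

/-- A butterfly whose NW-SE sequence is short exact is an isomorphism. -/
lemma flip_comp (P : Butterfly X.arrow Y.arrow) (Q : Butterfly Y.arrow X.arrow) (e : P.E ≅ Q.E)
    (h1 : P.κ ≫ e.hom = Q.ι) (h2 : P.ι ≫ e.hom = Q.κ) (h3 : e.hom ≫ Q.σ = P.ρ)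
    (h4 : e.hom ≫ Q.ρ = P.σ) : toHom P ≫ toHom Q = 𝟙 X := by
  rw [toHom_comp, ← strictHom_id]
  refine toHom_eq_iff.2 ?_
  obtain ⟨s, hs⟩ := Q.exists_lift (pullback.snd P.ρ Q.σ - pullback.fst _ _ ≫ e.hom) (by
    simp [h3, pullback.condition])
  apply Butterfly.comp_equiv (biprod.lift (pullback.fst _ _ ≫ P.σ) s)
  · apply biprod.hom_ext
    · simp
    · rw [← cancel_mono Q.ι]
      simp [hs, h2]
  · apply biprod.hom_ext
    · simp
    · rw [← cancel_mono Q.ι]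
      simp [hs, h1]
  · apply biprod.hom_ext
    · simp
    · rw [← cancel_mono Q.ι]
      simp [hs]
  · simp
  · have : s ≫ X.arrow.hom = pullback.snd _ _ ≫ Q.ρ - pullback.fst _ _ ≫ P.σ := by
      rw [← Q.ι_ρ, ← Category.assoc, hs, Preadditive.sub_comp, Category.assoc, h4]
    simp [biprod.lift_desc, this]

lemma isIso_toHom (P : Butterfly X.arrow Y.arrow)
    (h : (ShortComplex.mk P.κ P.ρ P.κ_ρ).ShortExact) : IsIso (toHom P) := by
  let Q : Butterfly Y.arrow X.arrow :=
    { E := P.E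
      κ := P.ι
      ι := P.κ
      σ := P.ρ
      ρ := P.σ
      κ_σ := P.ι_ρ
      ι_ρ := P.κ_σ
      κ_ρ := P.ι_σ
      ι_σ := P.κ_ρ
      shortExact := h }
  exact ⟨toHom Q, flip_comp P Q (Iso.refl _) (by simp [Q]) (by simp [Q]) (by simp [Q])
    (by simp [Q]), flip_comp Q P (Iso.refl _) (by simp [Q]) (by simp [Q]) (by simp [Q])
    (by simp [Q])⟩

/-- An object of `B` with zero identity has an invertible differential. -/
lemma isIso_of_id_eq_zero (h : 𝟙 X = 0) : IsIso X.arrow.hom := by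
  rw [← strictHom_id, zero_def] at h
  obtain ⟨e, h1, h2, h3, h4⟩ := toHom_eq_iff.1 h
  have h1 : biprod.lift X.arrow.hom (-𝟙 _) ≫ e.hom = biprod.lift X.arrow.hom (-0) := h1
  have h2 : biprod.inr ≫ e.hom = biprod.inr := h2
  have h3 : e.hom ≫ biprod.fst = biprod.fst := h3
  have h4 : e.hom ≫ biprod.desc 0 X.arrow.hom = biprod.desc (𝟙 _) X.arrow.hom := h4
  refine ⟨biprod.inl ≫ e.hom ≫ biprod.snd, ?_, ?_⟩
  · have := h1 =≫ biprod.snd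
    rw [biprod.lift_eq] at this
    simp only [Preadditive.add_comp, Category.assoc, Preadditive.neg_comp] at this
    rw [← Category.assoc biprod.inr, h2] at this
    simp at this
    rw [add_neg_eq_zero] at this
    exact this
  · have := biprod.inl ≫= h4
    simpa [biprod.desc_eq] using this

section Abelian

lemma ker_biprod_map {X X' Y Y' : A} (f : X ⟶ Y) (g : X' ⟶ Y') (h1 : t.F (kernel f))
    (h2 : t.F (kernel g)) : t.F (kernel (biprod.map f g)) := t.F_of_hom fun {M} hM z => by
  have h0 : z ≫ kernel.ι _ ≫ biprod.map f g = 0 := by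
    rw [kernel.condition, comp_zero]
  have hf : (z ≫ kernel.ι (biprod.map f g) ≫ biprod.fst) ≫ f = 0 := by
    rw [Category.assoc, Category.assoc, ← biprod.map_fst f g, ← Category.assoc _ _ biprod.fst,
      kernel.condition, zero_comp, comp_zero]
  have hs : (z ≫ kernel.ι (biprod.map f g) ≫ biprod.snd) ≫ g = 0 := by
    rw [Category.assoc, Category.assoc, ← biprod.map_snd f g, ← Category.assoc _ _ biprod.snd,
      kernel.condition, zero_comp, comp_zero]
  rw [← cancel_mono (kernel.ι _), zero_comp]
  apply biprod.hom_ext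
  · rw [Category.assoc, ← kernel.lift_ι _ _ hf, t.hom_eq_zero hM h1 (kernel.lift _ _ hf),
      zero_comp, zero_comp]
  · rw [Category.assoc, ← kernel.lift_ι _ _ hs, t.hom_eq_zero hM h2 (kernel.lift _ _ hs),
      zero_comp, zero_comp]

lemma coker_biprod_map {X X' Y Y' : A} (f : X ⟶ Y) (g : X' ⟶ Y') (h1 : t.T (cokernel f))
    (h2 : t.T (cokernel g)) : t.T (cokernel (biprod.map f g)) := t.T_of_hom fun {N} hN z => by
  have hf : f ≫ (biprod.inl ≫ cokernel.π (biprod.map f g) ≫ z) = 0 := by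
    rw [← Category.assoc, ← biprod.inl_map f g, Category.assoc,
      ← Category.assoc (biprod.map f g), cokernel.condition, zero_comp, comp_zero]
  have hs : g ≫ (biprod.inr ≫ cokernel.π (biprod.map f g) ≫ z) = 0 := by
    rw [← Category.assoc, ← biprod.inr_map f g, Category.assoc,
      ← Category.assoc (biprod.map f g), cokernel.condition, zero_comp, comp_zero]
  rw [← cancel_epi (cokernel.π _), comp_zero]
  apply biprod.hom_ext'
  · rw [← cokernel.π_desc _ _ hf, t.hom_eq_zero h1 hN (cokernel.desc _ _ hf),
      comp_zero, comp_zero]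
  · rw [← cokernel.π_desc _ _ hs, t.hom_eq_zero h2 hN (cokernel.desc _ _ hs),
      comp_zero, comp_zero]

/-- The direct sum of two objects of `B`. -/
abbrev sum (X Y : Tilt t) : Tilt t where
  arrow := Arrow.mk (biprod.map X.arrow.hom Y.arrow.hom)
  ker_mem := ker_biprod_map _ _ X.ker_mem Y.ker_mem
  coker_mem := coker_biprod_map _ _ X.coker_mem Y.coker_mem

/-- The projections and injections of the direct sum. -/
abbrev sumFst (X Y : Tilt t) : (sum X Y).arrow ⟶ X.arrow :=
  Arrow.homMk biprod.fst biprod.fst (by simp)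
/-- See `sumFst`. -/
abbrev sumSnd (X Y : Tilt t) : (sum X Y).arrow ⟶ Y.arrow :=
  Arrow.homMk biprod.snd biprod.snd (by simp)
/-- See `sumFst`. -/
abbrev sumInl (X Y : Tilt t) : X.arrow ⟶ (sum X Y).arrow :=
  Arrow.homMk biprod.inl biprod.inl (by simp)
/-- See `sumFst`. -/
abbrev sumInr (X Y : Tilt t) : Y.arrow ⟶ (sum X Y).arrow :=
  Arrow.homMk biprod.inr biprod.inr (by simp)

lemma existsUnique_prod_lift (f : Z ⟶ X) (g : Z ⟶ Y) :
    ∃! l : Z ⟶ sum X Y, l ≫ strictHom (X := sum X Y) (Y := X) (sumFst X Y) = f ∧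
      l ≫ strictHom (X := sum X Y) (Y := Y) (sumSnd X Y) = g := by
  obtain ⟨P, rfl⟩ := exists_rep f
  obtain ⟨Q, rfl⟩ := exists_rep g
  have hι : pullback.lift (biprod.fst ≫ P.ι) (biprod.snd ≫ Q.ι) (by simp) ≫
      pullback.fst P.σ Q.σ ≫ P.σ = 0 := by simp
  let L : Butterfly Z.arrow (sum X Y).arrow :=
    { E := pullback P.σ Q.σ
      κ := pullback.lift P.κ Q.κ (by simp)
      ι := pullback.lift (biprod.fst ≫ P.ι) (biprod.snd ≫ Q.ι) (by simp)
      σ := pullback.fst _ _ ≫ P.σ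
      ρ := biprod.lift (pullback.fst _ _ ≫ P.ρ) (pullback.snd _ _ ≫ Q.ρ)
      κ_σ := by simp
      ι_ρ := by apply biprod.hom_ext <;> simp
      κ_ρ := by apply biprod.hom_ext <;> simp
      ι_σ := hι
      shortExact := by
        have : Mono (pullback.lift (biprod.fst ≫ P.ι) (biprod.snd ≫ Q.ι) (by simp) :
            X.arrow.left ⊞ Y.arrow.left ⟶ pullback P.σ Q.σ) := by
          rw [Preadditive.mono_iff_cancel_zero]
          intro T z hz
          have h1 := hz =≫ pullback.fst _ _
          have h2 := hz =≫ pullback.snd _ _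
          simp only [Category.assoc, pullback.lift_fst, pullback.lift_snd, zero_comp] at h1 h2
          rw [← Category.assoc] at h1 h2
          apply biprod.hom_ext
          · rw [← cancel_mono P.ι, h1]; simp
          · rw [← cancel_mono Q.ι, h2]; simp
        refine ShortComplex.ShortExact.mk' ?_ this
          (inferInstanceAs (Epi (pullback.fst P.σ Q.σ ≫ P.σ)))
        rw [ShortComplex.exact_iff_exact_up_to_refinements]
        intro T x hx
        have hx : x ≫ pullback.fst P.σ Q.σ ≫ P.σ = 0 := hx
        obtain ⟨u, hu⟩ := P.exists_lift (x ≫ pullback.fst P.σ Q.σ) (by simpa using hx)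
        obtain ⟨v, hv⟩ := Q.exists_lift (x ≫ pullback.snd P.σ Q.σ)
          (by rw [Category.assoc, ← pullback.condition, hx])
        refine ⟨T, 𝟙 _, inferInstance, biprod.lift u v, ?_⟩
        rw [Category.id_comp]
        change x = biprod.lift u v ≫ pullback.lift _ _ _
        apply pullback.hom_ext
        · simp [hu]
        · simp [hv] }
  refine ⟨toHom L, ⟨?_, ?_⟩, ?_⟩
  · exact comp_strictHom_eq.2 ⟨pullback.fst _ _, by simp [L], by simp [L], by simp [L], by simp [L]⟩
  · exact comp_strictHom_eq.2 ⟨pullback.snd _ _, by simp [L], by simp [L],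
      by simp [L, pullback.condition], by simp [L]⟩
  · rintro l ⟨h1, h2⟩
    obtain ⟨G, rfl⟩ := exists_rep l
    rw [comp_strictHom_eq] at h1 h2
    obtain ⟨r, h11, h12, h13, h14⟩ := h1
    obtain ⟨s, h21, h22, h23, h24⟩ := h2
    refine toHom_eq_iff.2 (Butterfly.equiv_of_isHom (φ := pullback.lift r s (by rw [h13, h23])) ?_)
    constructor
    · apply pullback.hom_ext <;> simp [L, h11, h21]
    · apply pullback.hom_ext
      · simpa [L] using h12
      · simpa [L] using h22
    · simp [L, h13]
    · apply biprod.hom_ext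
      · simpa [L] using h14
      · simpa [L] using h24

lemma existsUnique_coprod_desc (f : X ⟶ Z) (g : Y ⟶ Z) :
    ∃! l : sum X Y ⟶ Z, strictHom (X := X) (Y := sum X Y) (sumInl X Y) ≫ l = f ∧
      strictHom (X := Y) (Y := sum X Y) (sumInr X Y) ≫ l = g := by
  obtain ⟨P, rfl⟩ := exists_rep f
  obtain ⟨Q, rfl⟩ := exists_rep g
  have h0 : P.ι ≫ P.σ ≫ (biprod.inl : _ ⟶ X.arrow.right ⊞ Y.arrow.right) =
    Q.ι ≫ Q.σ ≫ biprod.inr := by simp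
  have hι : (P.ι ≫ pushout.inl P.ι Q.ι) ≫
      pushout.desc (P.σ ≫ biprod.inl) (Q.σ ≫ biprod.inr) h0 = 0 := by simp
  let L : Butterfly (sum X Y).arrow Z.arrow :=
    { E := pushout P.ι Q.ι
      κ := biprod.desc (P.κ ≫ pushout.inl _ _) (Q.κ ≫ pushout.inr _ _)
      ι := P.ι ≫ pushout.inl _ _
      σ := pushout.desc (P.σ ≫ biprod.inl) (Q.σ ≫ biprod.inr) h0
      ρ := pushout.desc P.ρ Q.ρ (by simp)
      κ_σ := by apply biprod.hom_ext' <;> simp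
      ι_ρ := by simp
      κ_ρ := by apply biprod.hom_ext' <;> simp
      ι_σ := hι
      shortExact := by
        have he : Epi (pushout.desc (P.σ ≫ biprod.inl) (Q.σ ≫ biprod.inr) h0) := by
          rw [Preadditive.epi_iff_cancel_zero]
          intro T z hz
          have h1 := pushout.inl _ _ ≫= hz
          have h2 := pushout.inr _ _ ≫= hz
          rw [← Category.assoc, pushout.inl_desc, comp_zero, Category.assoc] at h1
          rw [← Category.assoc, pushout.inr_desc, comp_zero, Category.assoc] at h2
          apply biprod.hom_ext'
          · rw [← cancel_epi P.σ, h1]; simp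
          · rw [← cancel_epi Q.σ, h2]; simp
        have hm : Mono (P.ι ≫ pushout.inl P.ι Q.ι) := inferInstance
        refine ShortComplex.ShortExact.mk' ?_ hm he
        apply ShortComplex.exact_of_g_is_cokernel
        refine CokernelCofork.IsColimit.ofπ _ _
          (fun {T} z hz => biprod.desc
            (P.shortExact.exact.desc (pushout.inl _ _ ≫ z) ?_)
            (Q.shortExact.exact.desc (pushout.inr _ _ ≫ z) ?_)) ?_ ?_
        · simpa using hz
        · have : (P.ι ≫ pushout.inl P.ι Q.ι) ≫ z = 0 := hz
          rw [pushout.condition] at this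
          simpa using this
        · intro T z hz
          apply pushout.hom_ext
          · simpa using P.shortExact.exact.g_desc _ _
          · simpa using Q.shortExact.exact.g_desc _ _
        · intro T z hz m hm
          have hm : pushout.desc (P.σ ≫ biprod.inl) (Q.σ ≫ biprod.inr) h0 ≫ m = z := hm
          apply biprod.hom_ext'
          · rw [← cancel_epi P.σ, biprod.inl_desc]
            refine Eq.trans ?_ (P.shortExact.exact.g_desc _ _).symm
            rw [← hm]; simp
          · rw [← cancel_epi Q.σ, biprod.inr_desc]
            refine Eq.trans ?_ (Q.shortExact.exact.g_desc _ _).symm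
            rw [← hm]; simp }
  refine ⟨toHom L, ⟨?_, ?_⟩, ?_⟩
  · exact strictHom_comp_eq.2 ⟨pushout.inl _ _, by simp [L], by simp [L], by simp [L], by simp [L]⟩
  · exact strictHom_comp_eq.2 ⟨pushout.inr _ _, by simp [L],
      by simp [L, pushout.condition], by simp [L], by simp [L]⟩
  · rintro l ⟨h1, h2⟩
    obtain ⟨G, rfl⟩ := exists_rep l
    rw [strictHom_comp_eq] at h1 h2
    obtain ⟨r, h11, h12, h13, h14⟩ := h1
    obtain ⟨s, h21, h22, h23, h24⟩ := h2
    refine toHom_eq_iff.2 (Setoid.symm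
      (Butterfly.equiv_of_isHom (φ := pushout.desc r s (by rw [h12, h22])) ?_))
    constructor
    · apply biprod.hom_ext'
      · simpa [L] using h11
      · simpa [L] using h21
    · simp [L, h12]
    · apply pushout.hom_ext
      · simpa [L] using h13
      · simpa [L] using h23
    · apply pushout.hom_ext <;> simp [L, h14, h24]

lemma F_kernel_id (t : TorsionPair A) (X : A) : t.F (kernel (𝟙 X)) := t.F_of_hom fun _ f => by
  rw [← cancel_mono (kernel.ι _), zero_comp, kernel.ι_of_mono, comp_zero]

lemma T_cokernel_id (t : TorsionPair A) (X : A) : t.T (cokernel (𝟙 X)) := t.T_of_hom fun _ f => by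
  rw [← cancel_epi (cokernel.π _), comp_zero, cokernel.π_of_epi, zero_comp]

open scoped ZeroObject in
/-- The zero object `[0 ⟶ 0]`. -/
abbrev zeroObj (t : TorsionPair A) : Tilt t where
  arrow := Arrow.mk (𝟙 (0 : A))
  ker_mem := F_kernel_id t 0
  coker_mem := T_cokernel_id t 0

attribute [local instance] hasZeroMorphisms

lemma hasZeroObject (t : TorsionPair A) : HasZeroObject (Tilt t) := by
  refine ⟨zeroObj t, ?_⟩
  rw [IsZero.iff_id_eq_zero, ← strictHom_id]
  have : 𝟙 (zeroObj t).arrow = Arrow.homMk 0 0 := by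
    apply Arrow.hom_ext
    · exact (isZero_zero A).eq_of_src _ _
    · exact (isZero_zero A).eq_of_src _ _
  rw [this]
  rfl

lemma hasKernels (t : TorsionPair A) : HasKernels (Tilt t) where
  has_limit := by
    intro X Y f
    obtain ⟨P, rfl⟩ := exists_rep f
    obtain ⟨τ⟩ := Factor.nonempty P
    refine HasLimit.mk ⟨KernelFork.ofι _ τ.incl_comp, Fork.IsLimit.ofExistsUnique fun s => ?_⟩
    obtain ⟨l, hl⟩ := τ.exists_lift (q := s.ι) (KernelFork.condition s)
    exact ⟨l, hl, fun m hm => τ.incl_cancel (Eq.trans hm hl.symm)⟩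

lemma hasCokernels (t : TorsionPair A) : HasCokernels (Tilt t) where
  has_colimit := by
    intro X Y f
    obtain ⟨P, rfl⟩ := exists_rep f
    obtain ⟨τ⟩ := Factor.nonempty P
    refine HasColimit.mk ⟨CokernelCofork.ofπ _ τ.comp_proj,
      Cofork.IsColimit.ofExistsUnique fun s => ?_⟩
    obtain ⟨l, hl⟩ := τ.exists_desc (q := s.π) (CokernelCofork.condition s)
    exact ⟨l, hl, fun m hm => τ.proj_cancel (Eq.trans hm hl.symm)⟩

lemma hasBinaryProducts (t : TorsionPair A) : HasBinaryProducts (Tilt t) := by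
  have : ∀ {X Y : Tilt t}, HasLimit (pair X Y) := fun {X Y} =>
    HasLimit.mk ⟨BinaryFan.mk (strictHom (X := sum X Y) (Y := X) (sumFst X Y))
      (strictHom (X := sum X Y) (Y := Y) (sumSnd X Y)),
      BinaryFan.IsLimit.mk _ (fun f g => (existsUnique_prod_lift f g).choose)
        (fun f g => (existsUnique_prod_lift f g).choose_spec.1.1)
        (fun f g => (existsUnique_prod_lift f g).choose_spec.1.2)
        (fun f g m h1 h2 => (existsUnique_prod_lift f g).choose_spec.2 m ⟨h1, h2⟩)⟩
  exact hasBinaryProducts_of_hasLimit_pair _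

lemma hasBinaryCoproducts (t : TorsionPair A) : HasBinaryCoproducts (Tilt t) := by
  have : ∀ {X Y : Tilt t}, HasColimit (pair X Y) := fun {X Y} =>
    HasColimit.mk ⟨BinaryCofan.mk (strictHom (X := X) (Y := sum X Y) (sumInl X Y))
      (strictHom (X := Y) (Y := sum X Y) (sumInr X Y)),
      BinaryCofan.IsColimit.mk _ (fun f g => (existsUnique_coprod_desc f g).choose)
        (fun f g => (existsUnique_coprod_desc f g).choose_spec.1.1)
        (fun f g => (existsUnique_coprod_desc f g).choose_spec.1.2)
        (fun f g m h1 h2 => (existsUnique_coprod_desc f g).choose_spec.2 m ⟨h1, h2⟩)⟩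
  exact hasBinaryCoproducts_of_hasColimit_pair _

lemma isNormalMonoCategory (t : TorsionPair A) : IsNormalMonoCategory (Tilt t) where
  normalMonoOfMono := by
    intro X Y f hf
    obtain ⟨P, rfl⟩ := exists_rep f
    obtain ⟨τ⟩ := Factor.nonempty P
    have hi : strictHom (X := τ.ker) (Y := X) τ.incl = 0 := by
      rw [← cancel_mono (toHom P), τ.incl_comp, zero_comp]
    have hK : 𝟙 τ.ker = 0 := τ.incl_cancel (by rw [hi, comp_zero, comp_zero])
    have hk : IsIso τ.k := isIso_of_id_eq_zero hK
    let Q : Butterfly X.arrow τ.im.arrow :=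
      { E := P.E
        κ := P.κ
        ι := P.ι
        σ := P.σ
        ρ := cokernel.π τ.a
        κ_σ := P.κ_σ
        ι_ρ := rfl
        κ_ρ := τ.κ_π
        ι_σ := P.ι_σ
        shortExact := P.shortExact }
    have hQ : IsIso (toHom Q) := by
      apply isIso_toHom
      have h1 : (ShortComplex.mk τ.a (cokernel.π τ.a) (cokernel.condition _)).ShortExact :=
        { exact := ShortComplex.exact_cokernel τ.a
          mono_f := τ.mono
          epi_g := inferInstanceAs (Epi (cokernel.π τ.a)) }
      have e : ShortComplex.mk τ.a (cokernel.π τ.a) (cokernel.condition _) ≅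
          ShortComplex.mk Q.κ Q.ρ Q.κ_ρ :=
        ShortComplex.isoMk (asIso τ.k).symm (Iso.refl _) (Iso.refl _)
          (by
            change inv τ.k ≫ P.κ = τ.a ≫ 𝟙 _
            rw [Category.comp_id, IsIso.inv_comp_eq, τ.k_a])
          (by
            change 𝟙 _ ≫ cokernel.π τ.a = cokernel.π τ.a ≫ 𝟙 _
            rw [Category.comp_id, Category.id_comp])
      exact ShortComplex.shortExact_of_iso e h1
    have hfac : toHom Q ≫ strictHom (X := τ.im) (Y := Y) τ.imι = toHom P :=
      comp_strictHom_eq.2 ⟨𝟙 _, by simp [Q], by simp [Q], by simp [Q], by simp [Q]⟩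
    refine ⟨⟨τ.coker, strictHom (X := Y) (Y := τ.coker) τ.proj, τ.comp_proj,
      Fork.IsLimit.ofExistsUnique fun s => ?_⟩⟩
    obtain ⟨l, hl⟩ := τ.exists_lift_im (q := s.ι) (KernelFork.condition s)
    have h2 : (l ≫ inv (toHom Q)) ≫ toHom P = s.ι := by
      rw [← hfac]; simp [hl]
    refine ⟨l ≫ inv (toHom Q), h2, fun m hm => ?_⟩
    rw [← cancel_mono (toHom P), h2]
    exact hm

lemma isNormalEpiCategory (t : TorsionPair A) : IsNormalEpiCategory (Tilt t) where
  normalEpiOfEpi := by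
    intro X Y f hf
    obtain ⟨P, rfl⟩ := exists_rep f
    obtain ⟨τ⟩ := Factor.nonempty P
    have hp : strictHom (X := Y) (Y := τ.coker) τ.proj = 0 := by
      rw [← cancel_epi (toHom P), τ.comp_proj, comp_zero]
    have hC : 𝟙 τ.coker = 0 := τ.proj_cancel (by rw [hp, zero_comp, zero_comp])
    have hb : IsIso τ.b := isIso_of_id_eq_zero hC
    let Q : Butterfly τ.coim.arrow Y.arrow :=
      { E := P.E
        κ := τ.a
        ι := P.ι
        σ := P.σ
        ρ := P.ρ
        κ_σ := rfl
        ι_ρ := P.ι_ρ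
        κ_ρ := τ.a_ρ
        ι_σ := P.ι_σ
        shortExact := P.shortExact }
    have hQ : IsIso (toHom Q) := by
      apply isIso_toHom
      have h1 : (ShortComplex.mk τ.a (cokernel.π τ.a) (cokernel.condition _)).ShortExact :=
        { exact := ShortComplex.exact_cokernel τ.a
          mono_f := τ.mono
          epi_g := inferInstanceAs (Epi (cokernel.π τ.a)) }
      have e : ShortComplex.mk τ.a (cokernel.π τ.a) (cokernel.condition _) ≅
          ShortComplex.mk Q.κ Q.ρ Q.κ_ρ :=
        ShortComplex.isoMk (Iso.refl _) (Iso.refl _) (asIso τ.b)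
          (by
            change 𝟙 _ ≫ τ.a = τ.a ≫ 𝟙 _
            rw [Category.comp_id, Category.id_comp])
          (by
            change 𝟙 _ ≫ P.ρ = cokernel.π τ.a ≫ τ.b
            rw [Category.id_comp, cokernel.π_desc])
      exact ShortComplex.shortExact_of_iso e h1
    have hfac : strictHom (X := X) (Y := τ.coim) τ.coimπ ≫ toHom Q = toHom P :=
      strictHom_comp_eq.2 ⟨𝟙 _, by simp [Q], by simp [Q], by simp [Q], by simp [Q]⟩
    refine ⟨⟨τ.ker, strictHom (X := τ.ker) (Y := X) τ.incl, τ.incl_comp,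
      Cofork.IsColimit.ofExistsUnique fun s => ?_⟩⟩
    obtain ⟨l, hl⟩ := τ.exists_desc_coim (q := s.π) (CokernelCofork.condition s)
    have h2 : toHom P ≫ inv (toHom Q) ≫ l = s.π := by
      rw [← hfac]; simp [hl]
    refine ⟨inv (toHom Q) ≫ l, h2, fun m hm => ?_⟩
    rw [← cancel_epi (toHom P), h2]
    exact hm

/-- `B` has kernels, cokernels and direct sums, and its monomorphisms and epimorphisms are
normal. -/
abbrev nonPreadditiveAbelian (t : TorsionPair A) : NonPreadditiveAbelian (Tilt t) := by
  have := hasZeroObject t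
  have := hasKernels t
  have := hasCokernels t
  have := hasBinaryProducts t
  have := hasBinaryCoproducts t
  have := isNormalMonoCategory t
  have := isNormalEpiCategory t
  have : HasFiniteProducts (Tilt t) := hasFiniteProducts_of_has_binary_and_terminal
  have : HasFiniteCoproducts (Tilt t) := hasFiniteCoproducts_of_has_binary_and_initial
  exact { hasZeroMorphisms t, isNormalMonoCategory t, isNormalEpiCategory t with }

/-- `B` is abelian. Its addition of morphisms is the one determined by its direct sums (there is
only one addition of morphisms making a category with direct sums preadditive). -/
instance (t : TorsionPair A) : Abelian (Tilt t) :=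
  @NonPreadditiveAbelian.abelian (Tilt t) _ (nonPreadditiveAbelian t)

end Abelian

/-- The zero morphisms of the abelian category `B` are the classes of the zero butterflies. -/
lemma zero_eq (X Y : Tilt t) :
    @OfNat.ofNat (X ⟶ Y) 0 (@Zero.toOfNat0 _ (HasZeroMorphisms.zero X Y)) =
      toHom (zeroB X Y) := rfl

end Tilt

/-- `s` is a map between the centres of the butterflies `P` and `Q` that lies over the morphisms
of two-term complexes `f` and `g`. -/
structure Tilt.IsMap {t : TorsionPair A} {X Y X' Y' : Tilt t} (P : Butterfly X.arrow Y.arrow)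
    (Q : Butterfly X'.arrow Y'.arrow) (f : X.arrow ⟶ X'.arrow) (g : Y.arrow ⟶ Y'.arrow)
    (s : P.E ⟶ Q.E) : Prop where
  κ_s : P.κ ≫ s = f.left ≫ Q.κ
  ι_s : P.ι ≫ s = g.left ≫ Q.ι
  s_σ : s ≫ Q.σ = P.σ ≫ f.right
  s_ρ : s ≫ Q.ρ = P.ρ ≫ g.right

namespace Tilt

variable {t : TorsionPair A} {X Y Z X' Y' Z' X'' Y'' : Tilt t}

lemma exists_isMap {P : Butterfly X.arrow Y.arrow} {Q : Butterfly X'.arrow Y'.arrow}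
    {f : X.arrow ⟶ X'.arrow} {g : Y.arrow ⟶ Y'.arrow}
    (h : (strictHom f : X ⟶ X') ≫ toHom Q = toHom P ≫ (strictHom g : Y ⟶ Y')) :
    ∃ s, IsMap P Q f g s := by
  obtain ⟨R, hR⟩ := exists_rep (toHom P ≫ (strictHom g : Y ⟶ Y'))
  obtain ⟨r, r1, r2, r3, r4⟩ := comp_strictHom_eq.1 hR.symm
  obtain ⟨q, q1, q2, q3, q4⟩ := strictHom_comp_eq.1 (h.trans hR.symm)
  refine ⟨r ≫ q, ?_, ?_, ?_, ?_⟩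
  · rw [← Category.assoc, r1, q1]
  · rw [← Category.assoc, r2, Category.assoc, q2]
  · rw [Category.assoc, q3, ← Category.assoc, r3]
  · rw [Category.assoc, q4, r4]

lemma IsMap.unique {P : Butterfly X.arrow Y.arrow} {Q : Butterfly X'.arrow Y'.arrow}
    {f : X.arrow ⟶ X'.arrow} {g : Y.arrow ⟶ Y'.arrow} {s s' : P.E ⟶ Q.E}
    (h : IsMap P Q f g s) (h' : IsMap P Q f g s') : s = s' := by
  rw [← sub_eq_zero]
  apply vanish P Q
  · rw [Preadditive.comp_sub, h.κ_s, h'.κ_s, sub_self]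
  · rw [Preadditive.comp_sub, h.ι_s, h'.ι_s, sub_self]
  · rw [Preadditive.sub_comp, h.s_σ, h'.s_σ, sub_self]
  · rw [Preadditive.sub_comp, h.s_ρ, h'.s_ρ, sub_self]

lemma IsMap.id (P : Butterfly X.arrow Y.arrow) : IsMap P P (𝟙 _) (𝟙 _) (𝟙 _) := by
  constructor <;> simp

lemma IsMap.comp {P : Butterfly X.arrow Y.arrow} {Q : Butterfly X'.arrow Y'.arrow}
    {R : Butterfly X''.arrow Y''.arrow}
    {f : X.arrow ⟶ X'.arrow} {g : Y.arrow ⟶ Y'.arrow} {s : P.E ⟶ Q.E}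
    {f' : X'.arrow ⟶ X''.arrow} {g' : Y'.arrow ⟶ Y''.arrow} {s' : Q.E ⟶ R.E}
    (h : IsMap P Q f g s) (h' : IsMap Q R f' g' s') :
    IsMap P R (f ≫ f') (g ≫ g') (s ≫ s') where
  κ_s := by rw [← Category.assoc, h.κ_s, Category.assoc, h'.κ_s, ← Category.assoc]; rfl
  ι_s := by rw [← Category.assoc, h.ι_s, Category.assoc, h'.ι_s, ← Category.assoc]; rfl
  s_σ := by rw [Category.assoc, h'.s_σ, ← Category.assoc, h.s_σ, Category.assoc]; rfl
  s_ρ := by rw [Category.assoc, h'.s_ρ, ← Category.assoc, h.s_ρ, Category.assoc]; rfl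

lemma IsMap.link_comm {P : Butterfly X.arrow Y.arrow} {Q : Butterfly Y.arrow Z.arrow}
    {P' : Butterfly X'.arrow Y'.arrow} {Q' : Butterfly Y'.arrow Z'.arrow}
    {f : X.arrow ⟶ X'.arrow} {g : Y.arrow ⟶ Y'.arrow} {h : Z.arrow ⟶ Z'.arrow}
    {s : P.E ⟶ P'.E} {s' : Q.E ⟶ Q'.E} {δ : P.E ⟶ Q.E} {δ' : P'.E ⟶ Q'.E}
    (hs : IsMap P P' f g s) (hs' : IsMap Q Q' g h s') (hδ : IsLink P Q δ)
    (hδ' : IsLink P' Q' δ') : s ≫ δ' = δ ≫ s' := by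
  rw [← sub_eq_zero]
  apply vanish P Q'
  · rw [Preadditive.comp_sub, ← Category.assoc, hs.κ_s, Category.assoc, hδ'.κ_δ,
      ← Category.assoc P.κ, hδ.κ_δ, comp_zero, zero_comp, sub_self]
  · rw [Preadditive.comp_sub, ← Category.assoc, hs.ι_s, Category.assoc, hδ'.ι_δ,
      ← Category.assoc P.ι, hδ.ι_δ, hs'.κ_s, sub_self]
  · rw [Preadditive.sub_comp, Category.assoc, hδ'.δ_σ, hs.s_ρ, Category.assoc, hs'.s_σ,
      ← Category.assoc, hδ.δ_σ, sub_self]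
  · rw [Preadditive.sub_comp, Category.assoc, hδ'.δ_ρ, Category.assoc, hs'.s_ρ,
      ← Category.assoc, hδ.δ_ρ, comp_zero, zero_comp, sub_self]

end Tilt

/-- The objects of `Chˢᵗ(B)`: the complexes in `B`. -/
structure StrictComplex (t : TorsionPair A) where
  cx : CochainComplex (Tilt t) ℤ

namespace StrictComplex

/-- The morphisms of `Chˢᵗ(B)`: families of morphisms of two-term complexes whose classes in `B`
commute with the differentials. -/
@[ext]
structure Hom {t : TorsionPair A} (X Y : StrictComplex t) where
  f : ∀ n : ℤ, (X.cx.X n).arrow ⟶ (Y.cx.X n).arrow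
  comm : ∀ i j : ℤ, Tilt.strictHom (f i) ≫ Y.cx.d i j = X.cx.d i j ≫ Tilt.strictHom (f j)

instance (t : TorsionPair A) : Category (StrictComplex t) where
  Hom := Hom
  id X := ⟨fun n => 𝟙 _, fun i j => by
    rw [Tilt.strictHom_id, Tilt.strictHom_id, Category.id_comp, Category.comp_id]⟩
  comp {X Y Z} φ ψ := ⟨fun n => φ.f n ≫ ψ.f n, fun i j => by
    rw [← Tilt.strictHom_comp (φ.f i) (ψ.f i), ← Tilt.strictHom_comp (φ.f j) (ψ.f j),
      Category.assoc, ψ.comm, ← Category.assoc, φ.comm, Category.assoc]⟩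
  id_comp φ := Hom.ext (funext fun n => Category.id_comp (φ.f n))
  comp_id φ := Hom.ext (funext fun n => Category.comp_id (φ.f n))
  assoc φ ψ χ := Hom.ext (funext fun n => Category.assoc (φ.f n) (ψ.f n) (χ.f n))

/-- The functor `Chˢᵗ(B) ⥤ Ch(B)`, the identity on objects. -/
def incl (t : TorsionPair A) : StrictComplex t ⥤ CochainComplex (Tilt t) ℤ where
  obj X := X.cx
  map φ := { f := fun n => Tilt.strictHom (φ.f n), comm' := fun i j _ => φ.comm i j }
  map_id X := by
    apply HomologicalComplex.hom_ext
    intro n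
    exact Tilt.strictHom_id _
  map_comp φ ψ := by
    apply HomologicalComplex.hom_ext
    intro n
    exact (Tilt.strictHom_comp (φ.f n) (ψ.f n)).symm

end StrictComplex

/-- A decorated complex in `A`: a complex together with a subobject of each of its terms. -/
structure Decorated (A : Type u) [Category.{v} A] [Abelian A] where
  cx : CochainComplex A ℤ
  sub : ∀ n : ℤ, Subobject (cx.X n)

namespace Decorated

/-- A morphism of decorated complexes: a chain map that carries the subobjects into each other. -/
@[ext]
structure Hom (E F : Decorated A) where
  map : E.cx ⟶ F.cx
  factors : ∀ n : ℤ, (F.sub n).Factors ((E.sub n).arrow ≫ map.f n)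

instance : Category (Decorated A) where
  Hom := Hom
  id E := ⟨𝟙 _, fun n => by
    rw [HomologicalComplex.id_f, Category.comp_id]
    exact Subobject.factors_self _⟩
  comp {E F G} φ ψ := ⟨φ.map ≫ ψ.map, fun n => by
    rw [HomologicalComplex.comp_f, ← Category.assoc, ← Subobject.factorThru_arrow _ _ (φ.factors n),
      Category.assoc]
    exact Subobject.factors_of_factors_right _ (ψ.factors n)⟩
  id_comp φ := Hom.ext (Category.id_comp φ.map)
  comp_id φ := Hom.ext (Category.comp_id φ.map)
  assoc φ ψ χ := Hom.ext (Category.assoc φ.map ψ.map χ.map)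

/-- The morphism `Mⁿ ⟶ Eⁿ⁺¹ / Mⁿ⁺¹` induced by the differential of a decorated complex. Its kernel
and its cokernel are the cohomologies `H^{-1,n}` and `H^{0,n}`. -/
def two (E : Decorated A) (n : ℤ) : (E.sub n : A) ⟶ cokernel (E.sub (n + 1)).arrow :=
  (E.sub n).arrow ≫ E.cx.d n (n + 1) ≫ cokernel.π (E.sub (n + 1)).arrow

variable {E F : Decorated A}

/-- The map on `Mⁿ` induced by a morphism of decorated complexes. -/
def subMap (φ : E ⟶ F) (n : ℤ) : (E.sub n : A) ⟶ (F.sub n : A) :=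
  (F.sub n).factorThru ((E.sub n).arrow ≫ φ.map.f n) (φ.factors n)

lemma subMap_arrow (φ : E ⟶ F) (n : ℤ) :
    subMap φ n ≫ (F.sub n).arrow = (E.sub n).arrow ≫ φ.map.f n :=
  Subobject.factorThru_arrow _ _ _

/-- The map on `Eⁿ / Mⁿ` induced by a morphism of decorated complexes. -/
def quotMap (φ : E ⟶ F) (n : ℤ) :
    cokernel (E.sub n).arrow ⟶ cokernel (F.sub n).arrow :=
  cokernel.map _ _ (subMap φ n) (φ.map.f n) (subMap_arrow φ n).symm

lemma two_comm (φ : E ⟶ F) (n : ℤ) :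
    E.two n ≫ quotMap φ (n + 1) = subMap φ n ≫ F.two n := by
  simp only [two, quotMap, Category.assoc, cokernel.π_desc]
  rw [← Category.assoc (subMap φ n), subMap_arrow, Category.assoc,
    ← Category.assoc _ _ (cokernel.π _), ← φ.map.comm, Category.assoc]

/-- The map induced on `H^{-1,n}`. -/
def kerMap (φ : E ⟶ F) (n : ℤ) : kernel (E.two n) ⟶ kernel (F.two n) :=
  kernel.map _ _ (subMap φ n) (quotMap φ (n + 1)) (two_comm φ n)

/-- The map induced on `H^{0,n}`. -/
def cokerMap (φ : E ⟶ F) (n : ℤ) : cokernel (E.two n) ⟶ cokernel (F.two n) :=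
  cokernel.map _ _ (subMap φ n) (quotMap φ (n + 1)) (two_comm φ n)

end Decorated

/-- The decorated complexes whose decoration is compatible with the torsion pair. -/
def compatible (t : TorsionPair A) : ObjectProperty (Decorated A) := fun E =>
  ∀ n : ℤ, t.F (kernel (E.two n)) ∧ t.T (cokernel (E.two n))

/-- The category `Ch(A, T, F)` of complexes decorated compatibly with the torsion pair, a full
subcategory of the category of decorated complexes. -/
abbrev CompatibleComplex (t : TorsionPair A) := (compatible t).FullSubcategory

/-- The morphisms of `Ch(A, T, F)` that induce isomorphisms on all `H^{-1,n}` and `H^{0,n}`. -/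
def sis (t : TorsionPair A) : MorphismProperty (CompatibleComplex t) := fun _ _ φ =>
  ∀ n : ℤ, IsIso (Decorated.kerMap φ.hom n) ∧ IsIso (Decorated.cokerMap φ.hom n)

/-- The morphisms of `Ch(A, T, F)` that are quasi-isomorphisms of complexes in `A`. -/
def qis (t : TorsionPair A) : MorphismProperty (CompatibleComplex t) := fun _ _ φ =>
  QuasiIso φ.hom.map

namespace Tot

variable {t : TorsionPair A} (X : StrictComplex t)

/-- A butterfly representing the differential `ᵏX ⟶ ᵏ⁺¹X`. -/
abbrev wing (k : ℤ) : Butterfly (X.cx.X k).arrow (X.cx.X (k + 1)).arrow :=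
  Tilt.out (X.cx.d k (k + 1))

lemma exists_link (k : ℤ) : ∃ δ, Tilt.IsLink (wing X k) (wing X (k + 1)) δ :=
  Tilt.exists_link (by
    rw [Tilt.toHom_out, Tilt.toHom_out]
    exact X.cx.d_comp_d _ _ _)

/-- The link between the butterflies of two successive differentials; it is unique. -/
def δ (k : ℤ) : (wing X k).E ⟶ (wing X (k + 1)).E := (exists_link X k).choose

lemma isLink (k : ℤ) : Tilt.IsLink (wing X k) (wing X (k + 1)) (δ X k) :=
  (exists_link X k).choose_spec

/-- The complex of the centres of the butterflies, the one of `ᵏX ⟶ ᵏ⁺¹X` being in degree `k`. -/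
abbrev aux : CochainComplex A ℤ :=
  CochainComplex.of (fun k => (wing X k).E) (δ X) fun k => (isLink X k).comp (isLink X (k + 1))

lemma aux_d (k : ℤ) : (aux X).d k (k + 1) = δ X k :=
  CochainComplex.of_d (fun k => (wing X k).E) (δ X) k

/-- The decorated complex `(E, M)` of a complex `X` in `B`: `Eⁿ` is the centre of the butterfly
of the differential `ⁿ⁻¹X ⟶ ⁿX`, and `Mⁿ` is the image of `(ⁿX)⁻¹` in it. -/
abbrev decorated : Decorated A where
  cx :=
    { X := fun n => (aux X).X (n - 1)
      d := fun i j => (aux X).d (i - 1) (j - 1)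
      shape := fun i j h => (aux X).shape _ _ (by
        intro h'
        apply h
        have h' : i - 1 + 1 = j - 1 := h'
        change i + 1 = j
        omega)
      d_comp_d' := fun i j k _ _ => (aux X).d_comp_d _ _ _ }
  sub := fun n => Subobject.mk (wing X (n - 1)).ι

lemma F_kernel_conj {X' Y' Z' W' : A} (a : X' ⟶ Y') (d : Y' ⟶ Z') (b : Z' ⟶ W') [Mono a] [Mono b]
    (h : t.F (kernel d)) : t.F (kernel (a ≫ d ≫ b)) := by
  have w : (kernel.ι (a ≫ d ≫ b) ≫ a) ≫ d = 0 := by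
    rw [← cancel_mono b, zero_comp, Category.assoc, Category.assoc, kernel.condition]
  have : Mono (kernel.lift d _ w) := mono_of_mono_fac (kernel.lift_ι _ _ w)
  exact t.F_of_mono (kernel.lift d _ w) h

lemma T_cokernel_conj {X' Y' Z' W' : A} (a : X' ⟶ Y') (d : Y' ⟶ Z') (b : Z' ⟶ W') [Epi a] [Epi b]
    (h : t.T (cokernel d)) : t.T (cokernel (a ≫ d ≫ b)) := by
  have w : d ≫ b ≫ cokernel.π (a ≫ d ≫ b) = 0 := by
    rw [← cancel_epi a, comp_zero]
    simpa only [Category.assoc] using cokernel.condition (a ≫ d ≫ b)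
  have : Epi (cokernel.desc d _ w) := epi_of_epi_fac (cokernel.π_desc _ _ w)
  exact t.T_of_epi (cokernel.desc d _ w) h

lemma compat_aux (k l : ℤ) (h : k + 1 = l) :
    t.F (kernel ((Subobject.mk (wing X k).ι).arrow ≫ (aux X).d k l ≫
      cokernel.π (Subobject.mk (wing X l).ι).arrow)) ∧
    t.T (cokernel ((Subobject.mk (wing X k).ι).arrow ≫ (aux X).d k l ≫
      cokernel.π (Subobject.mk (wing X l).ι).arrow)) := by
  subst h
  rw [aux_d]
  obtain ⟨b, hb⟩ := (wing X (k + 1)).exists_desc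
    (cokernel.π (Subobject.mk (wing X (k + 1)).ι).arrow) (by
      rw [← cancel_epi (Subobject.underlyingIso (wing X (k + 1)).ι).hom, ← Category.assoc,
        Subobject.underlyingIso_hom_comp_eq_mk, cokernel.condition, comp_zero])
  have : Epi b := by
    have : Epi ((wing X (k + 1)).σ ≫ b) := by rw [hb]; infer_instance
    exact epi_of_epi (wing X (k + 1)).σ b
  have w : (Subobject.mk (wing X (k + 1)).ι).arrow ≫ (wing X (k + 1)).σ = 0 := by
    rw [← Subobject.underlyingIso_hom_comp_eq_mk, Category.assoc, Butterfly.ι_σ, comp_zero]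
  have hm : b ≫ cokernel.desc _ _ w = 𝟙 _ := by
    rw [← cancel_epi (wing X (k + 1)).σ, ← Category.assoc, hb, cokernel.π_desc, Category.comp_id]
  have : Mono b := by
    have : Mono (b ≫ cokernel.desc _ _ w) := by rw [hm]; infer_instance
    exact mono_of_mono b (cokernel.desc _ _ w)
  have key : (Subobject.mk (wing X k).ι).arrow ≫ δ X k ≫
      cokernel.π (Subobject.mk (wing X (k + 1)).ι).arrow =
      (Subobject.underlyingIso (wing X k).ι).hom ≫ (X.cx.X (k + 1)).arrow.hom ≫ b := by
    rw [← Subobject.underlyingIso_hom_comp_eq_mk (wing X k).ι, ← hb, Category.assoc,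
      ← Category.assoc (wing X k).ι, (isLink X k).ι_δ, ← Category.assoc (wing X (k + 1)).κ,
      Butterfly.κ_σ]
  rw [key]
  exact ⟨F_kernel_conj _ _ _ (X.cx.X (k + 1)).ker_mem,
    T_cokernel_conj _ _ _ (X.cx.X (k + 1)).coker_mem⟩

lemma compatible_decorated : compatible t (decorated X) := fun n =>
  compat_aux X (n - 1) (n + 1 - 1) (by omega)

variable {X} {Y Z : StrictComplex t}

lemma exists_map (φ : X ⟶ Y) (k : ℤ) :
    ∃ s, Tilt.IsMap (wing X k) (wing Y k) (φ.f k) (φ.f (k + 1)) s :=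
  Tilt.exists_isMap (by
    rw [Tilt.toHom_out, Tilt.toHom_out]
    exact φ.comm k (k + 1))

/-- The map between the centres of the butterflies that is given by a strict morphism; it is
the only one compatible with the four arrows of the butterflies. -/
def mapE (φ : X ⟶ Y) (k : ℤ) : (wing X k).E ⟶ (wing Y k).E := (exists_map φ k).choose

lemma isMap (φ : X ⟶ Y) (k : ℤ) :
    Tilt.IsMap (wing X k) (wing Y k) (φ.f k) (φ.f (k + 1)) (mapE φ k) :=
  (exists_map φ k).choose_spec

lemma mapE_id (k : ℤ) : mapE (𝟙 X) k = 𝟙 _ := (isMap (𝟙 X) k).unique (Tilt.IsMap.id _)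

lemma mapE_comp (φ : X ⟶ Y) (ψ : Y ⟶ Z) (k : ℤ) : mapE (φ ≫ ψ) k = mapE φ k ≫ mapE ψ k :=
  (isMap (φ ≫ ψ) k).unique ((isMap φ k).comp (isMap ψ k))

lemma mapE_comm (φ : X ⟶ Y) (k l : ℤ) (h : k + 1 = l) :
    mapE φ k ≫ (aux Y).d k l = (aux X).d k l ≫ mapE φ l := by
  subst h
  rw [aux_d, aux_d]
  exact (isMap φ k).link_comm (isMap φ (k + 1)) (isLink X k) (isLink Y k)

/-- The morphism of decorated complexes given by a strict morphism. -/
def decoratedMap (φ : X ⟶ Y) : decorated X ⟶ decorated Y where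
  map :=
    { f := fun n => mapE φ (n - 1)
      comm' := fun i j h => mapE_comm φ (i - 1) (j - 1) (by
        have h : i + 1 = j := h
        omega) }
  factors n := by
    change (Subobject.mk (wing Y (n - 1)).ι).Factors
      ((Subobject.mk (wing X (n - 1)).ι).arrow ≫ mapE φ (n - 1))
    rw [← Subobject.underlyingIso_hom_comp_eq_mk, Category.assoc, (isMap φ (n - 1)).ι_s,
      ← Category.assoc]
    exact Subobject.factors_of_factors_right _ ⟨𝟙 _, Category.id_comp _⟩

lemma decoratedMap_id (X : StrictComplex t) : decoratedMap (𝟙 X) = 𝟙 (decorated X) := by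
  apply Decorated.Hom.ext
  apply HomologicalComplex.hom_ext
  intro n
  exact mapE_id (n - 1)

lemma decoratedMap_comp (φ : X ⟶ Y) (ψ : Y ⟶ Z) :
    decoratedMap (φ ≫ ψ) = decoratedMap φ ≫ decoratedMap ψ := by
  apply Decorated.Hom.ext
  apply HomologicalComplex.hom_ext
  intro n
  exact mapE_comp φ ψ (n - 1)

end Tot

/-- The functor `Tot` from `Chˢᵗ(B)` to `Ch(A, T, F)`. -/
def Tot (t : TorsionPair A) : StrictComplex t ⥤ CompatibleComplex t where
  obj X := ⟨Tot.decorated X, Tot.compatible_decorated X⟩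
  map φ := ObjectProperty.homMk (Tot.decoratedMap φ)
  map_id X := by rw [Tot.decoratedMap_id]; rfl
  map_comp φ ψ := by rw [Tot.decoratedMap_comp]; rfl

end
end HRS

/-! `Tot` is already an equivalence from `Chˢᵗ(B)` to `Ch(A, T, F)`, before anything is inverted. It
remains to present `Ch(B)` and `D(B)` as localizations of `Chˢᵗ(B)` and to match the inverted
classes along `Tot`; uniqueness of localizations then gives both functors.

`Tot` loses nothing: the centre of the butterfly of a differential contains the degree `-1` part of
the target through `ι` and has the degree `0` part of the source as a quotient through `σ`, while
`κ` and `ρ` are read off from the links. Conversely, a decorated complex gives the two-term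
complexes `[Mⁿ ⟶ Eⁿ⁺¹ / Mⁿ⁺¹]`, with `Eⁿ⁺¹` as centre of the butterfly from this one to the next and
the differential of `E` as link. Uniqueness of links and of maps of centres rests on `Tilt.vanish`,
a consequence of `Hom(T, F) = 0`.

`Ch(B)` is a localization of `Chˢᵗ(B)` for two reasons. A butterfly with centre `E` is a roof `X ⟵
[X⁻¹ ⊞ Y⁻¹ ⟶ E] ⟶ Y` of strict morphisms whose left leg is a quasi-isomorphism, and strict morphisms
with equal classes are homotopic, hence factor through a path object. Roofs and paths may be chosen
degree by degree, because differentials live in `B` and can be transported along isomorphisms of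
`B`. These two facts suffice by `isLocalization_of_hasRoofs`. A strict morphism is invertible in `B`
exactly when it is a quasi-isomorphism of two-term complexes, and the `n`-th two-term complex of
`Tot X` is the `n`-th term of `X`; so the morphisms inverted in `Ch(B)` correspond to `sis`.

For `qis`, let `S` be the subobject of the centre `E` with `S / im κ` the torsion part of `ker ρ /
im κ`. The kernel of the butterfly is `[X⁻¹ ⟶ S]`, its cokernel `[E / S ⟶ Y⁰]`, and the homology of
two consecutive butterflies is `[E / S ⟶ S']`. Hence `Hⁿ` of the complex of `Tot X` is an extension
of the torsion-free object `H⁻¹` of the `n`-th homology in `B` by the torsion object `H⁰` of the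
`(n-1)`-st. As `Hom(T, F) = 0`, a map of such extensions is invertible if and only if it is so at
both ends (`TorsionPair.isIso_iff`). Over all degrees, quasi-isomorphisms in `A` and in `B`
therefore coincide. -/

namespace HRS

/-! ### Recognizing a localization by roofs and path objects -/

section Localization

variable {C D : Type*} [Category C] [Category D] (L : C ⥤ D)

/-- The morphisms that become invertible under `L`. -/
abbrev invertedBy : MorphismProperty C := (MorphismProperty.isomorphisms D).inverseImage L

/-- Every morphism between objects in the image of `L` is a right fraction. -/
def HasRoofs : Prop :=
  ∀ ⦃X Y : C⦄ (φ : L.obj X ⟶ L.obj Y), ∃ (R : C) (s : R ⟶ X) (f : R ⟶ Y),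
    IsIso (L.map s) ∧ L.map s ≫ φ = L.map f

/-- Two morphisms with the same image under `L` are the two ends of a map to a path object. -/
def HasPaths : Prop :=
  ∀ ⦃X Y : C⦄ (f g : X ⟶ Y), L.map f = L.map g → ∃ (P : C) (p q : P ⟶ Y) (c : Y ⟶ P) (h : X ⟶ P),
    c ≫ p = 𝟙 Y ∧ c ≫ q = 𝟙 Y ∧ h ≫ p = f ∧ h ≫ q = g ∧ IsIso (L.map c)

variable {L}

/-- The common section `c` of `p` and `q` becomes invertible under `G`, so `p` and `q` both become
its inverse. Thus `G` identifies every pair of morphisms that `L` identifies. -/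
lemma HasPaths.map_eq (hp : HasPaths L) {E : Type*} [Category E] {G : C ⥤ E}
    (hG : (invertedBy L).IsInvertedBy G) {X Y : C} {f g : X ⟶ Y} (e : L.map f = L.map g) :
    G.map f = G.map g := by
  obtain ⟨P, p, q, c, h, hcp, hcq, rfl, rfl, hc⟩ := hp f g e
  have : IsIso (G.map c) := hG c hc
  have : G.map p = G.map q := by
    rw [← cancel_epi (G.map c), ← G.map_comp, ← G.map_comp, hcp, hcq]
  rw [G.map_comp, G.map_comp, this]

section

variable {W : MorphismProperty C} {G : W.Localization ⥤ D}

lemma Q_obj_surjective (X : W.Localization) : ∃ X₀, W.Q.obj X₀ = X :=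
  (Localization.Construction.objEquiv W).surjective X

/-- The morphisms of the localized category that are right fractions of morphisms of `C` whose
denominator becomes invertible under `G`. -/
def isFraction (G : W.Localization ⥤ D) : MorphismProperty W.Localization := fun X Y α =>
  ∃ (X₀ Y₀ R : C) (hX : W.Q.obj X₀ = X) (hY : W.Q.obj Y₀ = Y) (s : R ⟶ X₀) (f : R ⟶ Y₀),
    IsIso (G.map (W.Q.map s)) ∧ W.Q.map s ≫ eqToHom hX ≫ α = W.Q.map f ≫ eqToHom hY

/-- The generators of the localized category, images of morphisms and formal inverses, are
fractions. For closure under composition, the square needed is found in `D` by `hr`; it commutes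
already in the localized category because of `hp`. -/
lemma isFraction_eq_top (hW : invertedBy (W.Q ⋙ G) = W) (hr : HasRoofs (W.Q ⋙ G))
    (hp : HasPaths (W.Q ⋙ G)) : isFraction G = ⊤ := by
  have hQ : (invertedBy (W.Q ⋙ G)).IsInvertedBy W.Q := by
    rw [hW]; exact MorphismProperty.Q_inverts W
  have : (isFraction G).IsStableUnderComposition := ⟨by
    rintro _ _ _ α β ⟨X, Y, R, rfl, rfl, s, f, hs, e⟩ ⟨Y', Z, R', hY, rfl, s', f', hs', e'⟩
    obtain rfl : Y' = Y := (Localization.Construction.objEquiv W).injective hY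
    simp only [eqToHom_refl, Category.id_comp, Category.comp_id] at e e'
    obtain ⟨U, u, g, hu, eu⟩ := hr (G.map (W.Q.map f) ≫ inv (G.map (W.Q.map s')))
    have h1 : (W.Q ⋙ G).map (u ≫ f) = (W.Q ⋙ G).map (g ≫ s') := by
      rw [Functor.map_comp, Functor.map_comp, ← eu]; simp
    have h2 := hp.map_eq hQ h1
    refine ⟨X, Z, U, rfl, rfl, u ≫ s, g ≫ f', ?_, ?_⟩
    · have : IsIso (G.map (W.Q.map u)) := hu
      rw [Functor.map_comp, Functor.map_comp]; infer_instance
    · rw [eqToHom_refl, eqToHom_refl, Category.id_comp, Category.comp_id, Functor.map_comp,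
        Functor.map_comp, Category.assoc, ← Category.assoc _ α, e, ← Category.assoc,
        ← Functor.map_comp, h2, Functor.map_comp, Category.assoc, e']⟩
  refine Localization.Construction.morphismProperty_eq_top _ (fun X Y f => ?_) fun X Y w hw => ?_
  · exact ⟨X, Y, X, rfl, rfl, 𝟙 _, f, by rw [W.Q.map_id]; infer_instance, by simp⟩
  · refine ⟨Y, X, X, rfl, rfl, w, 𝟙 X, ?_, ?_⟩
    · have := MorphismProperty.Q_inverts W w hw
      infer_instance
    · rw [eqToHom_refl, eqToHom_refl, Category.id_comp, Category.comp_id, W.Q.map_id]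
      exact (Localization.Construction.wIso w hw).hom_inv_id

lemma exists_fraction (hW : invertedBy (W.Q ⋙ G) = W) (hr : HasRoofs (W.Q ⋙ G))
    (hp : HasPaths (W.Q ⋙ G)) {X Y : C} (α : W.Q.obj X ⟶ W.Q.obj Y) :
    ∃ (R : C) (s : R ⟶ X) (f : R ⟶ Y), W s ∧ W.Q.map s ≫ α = W.Q.map f := by
  have hα : isFraction G α := by rw [isFraction_eq_top hW hr hp]; trivial
  obtain ⟨X₀, Y₀, R, hX, hY, s, f, hs, e⟩ := hα
  obtain rfl : X₀ = X := (Localization.Construction.objEquiv W).injective hX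
  obtain rfl : Y₀ = Y := (Localization.Construction.objEquiv W).injective hY
  exact ⟨R, s, f, by rw [← hW]; exact hs, by simpa using e⟩

/-- Fullness is the existence of roofs. For faithfulness, two parallel morphisms are written as
fractions with a common denominator; their numerators agree in `D`, hence, by paths, in the
localized category. -/
lemma isEquivalence_of_hasRoofs [G.EssSurj] (hW : invertedBy (W.Q ⋙ G) = W)
    (hr : HasRoofs (W.Q ⋙ G)) (hp : HasPaths (W.Q ⋙ G)) : G.IsEquivalence := by
  have hQ : (invertedBy (W.Q ⋙ G)).IsInvertedBy W.Q := by
    rw [hW]; exact MorphismProperty.Q_inverts W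
  have hfull : G.Full := ⟨fun {X Y} φ => by
    obtain ⟨X, rfl⟩ := Q_obj_surjective X
    obtain ⟨Y, rfl⟩ := Q_obj_surjective Y
    obtain ⟨R, s, f, hs, e⟩ := hr (X := X) (Y := Y) φ
    have : IsIso (W.Q.map s) := hQ s hs
    refine ⟨inv (W.Q.map s) ≫ W.Q.map f, ?_⟩
    rw [G.map_comp, G.map_inv, IsIso.inv_comp_eq]
    exact e.symm⟩
  have hfaith : G.Faithful := ⟨fun {X Y} α β h => by
    obtain ⟨X, rfl⟩ := Q_obj_surjective X
    obtain ⟨Y, rfl⟩ := Q_obj_surjective Y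
    obtain ⟨R, s, f, hs, e⟩ := exists_fraction hW hr hp α
    obtain ⟨R', s', f', hs', e'⟩ := exists_fraction hW hr hp β
    have := MorphismProperty.Q_inverts W s hs
    have := MorphismProperty.Q_inverts W s' hs'
    -- A roof for `s` followed by the inverse of `s'` provides the common denominator `u ≫ s`, equal
    -- to `g ≫ s'` after localization.
    obtain ⟨U, u, g, hu, eu⟩ := hr (G.map (W.Q.map s) ≫ inv (G.map (W.Q.map s')))
    have := hQ u hu
    have h1 : (W.Q ⋙ G).map (u ≫ s) = (W.Q ⋙ G).map (g ≫ s') := by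
      rw [Functor.map_comp, Functor.map_comp, ← eu]; simp
    have k1 := hp.map_eq hQ h1
    have h2 : (W.Q ⋙ G).map (u ≫ f) = (W.Q ⋙ G).map (g ≫ f') := by
      simp only [Functor.comp_map] at h1 ⊢
      rw [W.Q.map_comp, W.Q.map_comp, ← e, ← e', ← Category.assoc, ← Category.assoc,
        ← W.Q.map_comp, ← W.Q.map_comp, G.map_comp, G.map_comp, h1, h]
    have k2 := hp.map_eq hQ h2
    rw [← cancel_epi (W.Q.map u ≫ W.Q.map s)]
    calc (W.Q.map u ≫ W.Q.map s) ≫ α = W.Q.map (u ≫ f) := by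
          rw [Category.assoc, e, Functor.map_comp]
      _ = (W.Q.map u ≫ W.Q.map s) ≫ β := by
          rw [k2, ← Functor.map_comp, k1, Functor.map_comp, Functor.map_comp, Category.assoc, e']⟩
  exact { faithful := hfaith, full := hfull, essSurj := inferInstance }

end

/-- No calculus of fractions in `C` is required: squares have to commute only after applying `L`.
The saturation hypothesis `hW` of `isEquivalence_of_hasRoofs` holds because the class consists of
all morphisms inverted by `L`. -/
theorem isLocalization_of_hasRoofs (L : C ⥤ D) [L.EssSurj] (hr : HasRoofs L) (hp : HasPaths L) :
    L.IsLocalization (invertedBy L) := by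
  have hL : (invertedBy L).IsInvertedBy L := fun _ _ _ h => h
  let G := Localization.Construction.lift L hL
  have hG : (invertedBy L).Q ⋙ G = L := Localization.Construction.fac L hL
  have : G.EssSurj := ⟨fun Y => ⟨(invertedBy L).Q.obj (L.objPreimage Y),
    ⟨L.objObjPreimageIso Y⟩⟩⟩
  exact { inverts := hL
          isEquivalence := isEquivalence_of_hasRoofs (by rw [hG]) (by rw [hG]; exact hr)
            (by rw [hG]; exact hp) }

/-- A property of morphisms of the target is, up to isomorphism, the image of its inverse image. -/
lemma HasRoofs.le_map [L.EssSurj] (hr : HasRoofs L) (W : MorphismProperty D) [W.RespectsIso] :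
    W ≤ (W.inverseImage L).map L := by
  intro X Y φ hφ
  obtain ⟨R, s, f, hs, e⟩ :=
    hr ((L.objObjPreimageIso X).hom ≫ φ ≫ (L.objObjPreimageIso Y).inv)
  let a : Arrow.mk (L.map f) ≅ Arrow.mk φ :=
    Arrow.isoMk (asIso (L.map s) ≪≫ L.objObjPreimageIso X) (L.objObjPreimageIso Y) (by
      simp [← e])
  exact ⟨_, _, f, (W.arrow_mk_iso_iff a).2 hφ, ⟨a⟩⟩

end Localization

end HRS

/-! ### Strict morphisms in `B`: invertibility, links and homotopies -/

namespace HRS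

noncomputable section

variable {A : Type u} [Category.{v} A] [Abelian A]

attribute [local simp] pullback.lift_fst pullback.lift_snd pullback.lift_fst_assoc
  pullback.lift_snd_assoc pushout.inl_desc pushout.inr_desc pushout.inl_desc_assoc
  pushout.inr_desc_assoc

/-- The map on kernels induced by a morphism of two-term complexes. -/
def arrowKer {X Y : Arrow A} (f : X ⟶ Y) : kernel X.hom ⟶ kernel Y.hom :=
  kernel.map _ _ f.left f.right (Arrow.w f).symm

/-- The map on cokernels induced by a morphism of two-term complexes. -/
def arrowCoker {X Y : Arrow A} (f : X ⟶ Y) : cokernel X.hom ⟶ cokernel Y.hom :=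
  cokernel.map _ _ f.left f.right (Arrow.w f).symm

/-- The quasi-isomorphisms of two-term complexes. -/
def arrowQis : MorphismProperty (Arrow A) := fun _ _ f => IsIso (arrowKer f) ∧ IsIso (arrowCoker f)

instance : (arrowQis (A := A)).RespectsIso :=
  MorphismProperty.RespectsIso.of_respects_arrow_iso _ fun _ _ e h =>
    ⟨((MorphismProperty.isomorphisms A).arrow_mk_iso_iff ((ker A).mapArrow.mapIso e)).1 h.1,
      ((MorphismProperty.isomorphisms A).arrow_mk_iso_iff ((coker A).mapArrow.mapIso e)).1 h.2⟩

lemma arrowKer_ι {X Y : Arrow A} (f : X ⟶ Y) :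
    arrowKer f ≫ kernel.ι Y.hom = kernel.ι X.hom ≫ f.left := kernel.lift_ι _ _ _

lemma π_arrowCoker {X Y : Arrow A} (f : X ⟶ Y) :
    cokernel.π X.hom ≫ arrowCoker f = f.right ≫ cokernel.π Y.hom := cokernel.π_desc _ _ _

section

variable {X Y : Arrow A}

/-- The sequence is the mapping cone of `f`. For `y` in `ker d_Y` the element `(0, y)` is killed by
`ρ`, so it comes from some `x` with `d x = 0`, which inverts the map on kernels. Dually, `(π, 0)`
kills `κ` and descends to `Y⁰`, which inverts the map on cokernels. -/
lemma arrowQis_of_shortExact {f : X ⟶ Y}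
    (h : (ShortComplex.mk (Butterfly.strict f).κ (Butterfly.strict f).ρ (Butterfly.strict f).κ_ρ).ShortExact) :
    arrowQis f := by
  have hm : Mono (biprod.lift X.hom (-f.left)) := h.mono_f
  have he : Epi (biprod.desc f.right Y.hom) := h.epi_g
  constructor
  · have hz : (kernel.ι Y.hom ≫ biprod.inr) ≫ biprod.desc f.right Y.hom = 0 := by simp
    obtain ⟨x, hx⟩ : ∃ x, x ≫ biprod.lift X.hom (-f.left) = kernel.ι Y.hom ≫ biprod.inr :=
      ⟨h.exact.lift _ hz, h.exact.lift_f _ hz⟩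
    have h1 := hx =≫ biprod.fst
    have h2 := hx =≫ biprod.snd
    simp only [Category.assoc, biprod.lift_fst, biprod.lift_snd, biprod.inr_fst, biprod.inr_snd,
      Category.comp_id, comp_zero, Preadditive.comp_neg] at h1 h2
    -- The sign undoes the one in `κ = (d, -f⁻¹)`.
    refine ⟨kernel.lift X.hom (-x) (by simp [h1]), ?_, ?_⟩
    · refine (cancel_mono (kernel.ι X.hom)).1 ((cancel_mono (biprod.lift X.hom (-f.left))).1 ?_)
      rw [Category.assoc (arrowKer f), kernel.lift_ι, Category.id_comp, Preadditive.comp_neg,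
        Preadditive.neg_comp, Category.assoc, hx, ← Category.assoc, arrowKer_ι]
      apply biprod.hom_ext <;> simp
    · refine (cancel_mono (kernel.ι Y.hom)).1 ?_
      rw [Category.assoc, arrowKer_ι, ← Category.assoc, kernel.lift_ι, Category.id_comp,
        Preadditive.neg_comp, h2]
  · have hz : biprod.lift X.hom (-f.left) ≫ biprod.desc (cokernel.π X.hom) 0 = 0 := by
      simp [biprod.lift_desc]
    obtain ⟨g, hg⟩ : ∃ g, biprod.desc f.right Y.hom ≫ g = biprod.desc (cokernel.π X.hom) 0 :=
      ⟨h.exact.desc _ hz, h.exact.g_desc _ hz⟩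
    have h1 := biprod.inl ≫= hg
    have h2 := biprod.inr ≫= hg
    simp only [biprod.inl_desc_assoc, biprod.inr_desc_assoc, biprod.inl_desc, biprod.inr_desc]
      at h1 h2
    refine ⟨cokernel.desc Y.hom g h2, ?_, ?_⟩
    · refine (cancel_epi (cokernel.π X.hom)).1 ?_
      rw [← Category.assoc, π_arrowCoker, Category.assoc, cokernel.π_desc, h1, Category.comp_id]
    · refine (cancel_epi (cokernel.π Y.hom)).1 ((cancel_epi (biprod.desc f.right Y.hom)).1 ?_)
      rw [← Category.assoc (cokernel.π Y.hom), cokernel.π_desc, ← Category.assoc, hg]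
      apply biprod.hom_ext' <;> simp [π_arrowCoker]

/-- If `f⁰ a + d b = 0`, injectivity on cokernels gives `a = d x` locally; then `b + f⁻¹ x` lies in
`ker d_Y`, and surjectivity on kernels allows `x` to be corrected. Injectivity on kernels and
surjectivity on cokernels give the two ends. -/
lemma shortExact_of_arrowQis {f : X ⟶ Y} (h : arrowQis f) :
    (ShortComplex.mk (Butterfly.strict f).κ (Butterfly.strict f).ρ (Butterfly.strict f).κ_ρ).ShortExact := by
  obtain ⟨hk, hc⟩ := h
  refine ShortComplex.ShortExact.mk' ?_ ?_ ?_
  · rw [ShortComplex.exact_iff_exact_up_to_refinements]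
    intro T z hz
    have hz : z ≫ biprod.desc f.right Y.hom = 0 := hz
    obtain ⟨a, b, rfl⟩ : ∃ a b, z = biprod.lift a b :=
      ⟨z ≫ biprod.fst, z ≫ biprod.snd, by apply biprod.hom_ext <;> simp⟩
    rw [biprod.lift_desc] at hz
    have ha : a ≫ cokernel.π X.hom = 0 := by
      refine (cancel_mono (arrowCoker f)).1 ?_
      rw [zero_comp, Category.assoc, π_arrowCoker, ← Category.assoc, eq_neg_of_add_eq_zero_left hz]
      simp
    obtain ⟨T', p, hp, x, hx⟩ := (CokernelCofork.IsColimit.comp_π_eq_zero_iff_up_to_refinements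
      (cokernelIsCokernel X.hom) a).1 ha
    have hb : (p ≫ b + x ≫ f.left) ≫ Y.hom = 0 := by
      rw [Preadditive.add_comp, Category.assoc, Category.assoc, Arrow.w, ← Category.assoc x, ← hx,
        Category.assoc, ← Preadditive.comp_add, add_comm, hz, comp_zero]
    have hl : kernel.lift Y.hom _ hb ≫ inv (arrowKer f) ≫ kernel.ι X.hom ≫ f.left =
        p ≫ b + x ≫ f.left := by
      rw [← arrowKer_ι, IsIso.inv_hom_id_assoc, kernel.lift_ι]
    refine ⟨T', p, hp, x - kernel.lift Y.hom _ hb ≫ inv (arrowKer f) ≫ kernel.ι X.hom, ?_⟩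
    change p ≫ biprod.lift a b = _ ≫ biprod.lift X.hom (-f.left)
    apply biprod.hom_ext
    · simp [hx]
    · simp only [Category.assoc, biprod.lift_snd, Preadditive.comp_neg, Preadditive.sub_comp, hl]
      abel
  · change Mono (biprod.lift X.hom (-f.left))
    rw [Preadditive.mono_iff_cancel_zero]
    intro T x hx
    have h1 := hx =≫ biprod.fst
    have h2 := hx =≫ biprod.snd
    simp only [Category.assoc, biprod.lift_fst, biprod.lift_snd, zero_comp,
      Preadditive.comp_neg, neg_eq_zero] at h1 h2
    rw [← kernel.lift_ι X.hom x h1]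
    have : kernel.lift X.hom x h1 = 0 := by
      refine (cancel_mono (arrowKer f)).1 ((cancel_mono (kernel.ι Y.hom)).1 ?_)
      rw [Category.assoc, arrowKer_ι, ← Category.assoc, kernel.lift_ι, h2, zero_comp, zero_comp]
    rw [this, zero_comp]
  · change Epi (biprod.desc f.right Y.hom)
    rw [Preadditive.epi_iff_cancel_zero]
    intro T x hx
    have h1 := biprod.inl ≫= hx
    have h2 := biprod.inr ≫= hx
    simp only [biprod.inl_desc_assoc, biprod.inr_desc_assoc, comp_zero] at h1 h2
    rw [← cokernel.π_desc Y.hom x h2]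
    have : cokernel.desc Y.hom x h2 = 0 := by
      refine (cancel_epi (arrowCoker f)).1 ((cancel_epi (cokernel.π X.hom)).1 ?_)
      rw [← Category.assoc, π_arrowCoker, Category.assoc, cokernel.π_desc, h1, comp_zero, comp_zero]
    rw [this, comp_zero]

end

namespace Tilt

variable {t : TorsionPair A} {X Y Z X' Y' : Tilt t}

/-- An isomorphism has zero kernel `[X⁻¹ ⟶ S]` and zero cokernel `[E / S ⟶ Y⁰]`, so both
differentials are invertible. This identifies the sequence of `κ` and `ρ` with `S ⟶ E ⟶ E / S`. -/
lemma shortExact_of_isIso (P : Butterfly X.arrow Y.arrow) [IsIso (toHom P)] :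
    (ShortComplex.mk P.κ P.ρ P.κ_ρ).ShortExact := by
  obtain ⟨τ⟩ := Factor.nonempty P
  have hK : 𝟙 τ.ker = 0 := τ.incl_cancel (by
    refine (cancel_mono (toHom P)).1 ?_
    rw [Category.id_comp]
    refine τ.incl_comp.trans ?_
    erw [zero_comp, zero_comp])
  have hk : IsIso τ.k := isIso_of_id_eq_zero hK
  have hC : 𝟙 τ.coker = 0 := τ.proj_cancel (by
    refine (cancel_epi (toHom P)).1 ?_
    rw [Category.comp_id]
    refine τ.comp_proj.trans ?_
    erw [comp_zero, comp_zero])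
  have hb : IsIso τ.b := isIso_of_id_eq_zero hC
  have h1 : (ShortComplex.mk τ.a (cokernel.π τ.a) (cokernel.condition _)).ShortExact :=
    { exact := ShortComplex.exact_cokernel τ.a
      mono_f := τ.mono
      epi_g := inferInstanceAs (Epi (cokernel.π τ.a)) }
  have e : ShortComplex.mk τ.a (cokernel.π τ.a) (cokernel.condition _) ≅
      ShortComplex.mk P.κ P.ρ P.κ_ρ :=
    ShortComplex.isoMk (asIso τ.k).symm (Iso.refl _) (asIso τ.b)
      (by
        change inv τ.k ≫ P.κ = τ.a ≫ 𝟙 _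
        rw [Category.comp_id, IsIso.inv_comp_eq, τ.k_a])
      (by
        change 𝟙 _ ≫ P.ρ = cokernel.π τ.a ≫ τ.b
        rw [Category.id_comp, cokernel.π_desc])
  exact ShortComplex.shortExact_of_iso e h1

/-- Both conditions say that the cone sequence of `f`, the diagonal `κ`, `ρ` of its strict
butterfly, is short exact. -/
lemma isIso_strictHom_iff (f : X.arrow ⟶ Y.arrow) :
    IsIso (strictHom f : X ⟶ Y) ↔ arrowQis f :=
  ⟨fun h => arrowQis_of_shortExact
      (@shortExact_of_isIso _ _ _ _ X Y (Butterfly.strict f) h),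
    fun h => isIso_toHom _ (shortExact_of_arrowQis h)⟩

/-- Converse of `exists_link`. On the fibre product of the centres, `(e, e') ↦ e' - δ e` is killed
by `σ` of `Q`, so it takes values in `Z⁻¹`. Together with `σ` of `P` it maps the composite to `X⁰ ⊞
Z⁻¹`, the centre of the zero butterfly. -/
lemma IsLink.comp_eq_zero {P : Butterfly X.arrow Y.arrow} {Q : Butterfly Y.arrow Z.arrow}
    {δ : P.E ⟶ Q.E} (h : IsLink P Q δ) : toHom P ≫ toHom Q = 0 := by
  refine (toHom_comp P Q).trans (toHom_eq_iff.2 ?_)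
  obtain ⟨r, hr⟩ := Q.exists_lift (pullback.snd P.ρ Q.σ - pullback.fst _ _ ≫ δ) (by
    rw [Preadditive.sub_comp, Category.assoc, h.δ_σ, pullback.condition, sub_self])
  apply Butterfly.comp_equiv (biprod.lift (pullback.fst _ _ ≫ P.σ) r)
  · apply biprod.hom_ext
    · simp
    · rw [← cancel_mono Q.ι]
      simp [hr, h.ι_δ]
  · apply biprod.hom_ext
    · simp
    · rw [← cancel_mono Q.ι]
      simp [hr, h.κ_δ]
  · apply biprod.hom_ext
    · simp
    · rw [← cancel_mono Q.ι]
      simp [hr]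
  · simp
  · have : r ≫ Z.arrow.hom = pullback.snd _ _ ≫ Q.ρ := by
      rw [← Q.ι_ρ, ← Category.assoc, hr, Preadditive.sub_comp, Category.assoc,
        h.δ_ρ, comp_zero, sub_zero]
    simp [biprod.lift_desc, this]

/-- Converse of `exists_isMap`: the map `e ↦ ((σ e, 0), s e)` into the fibre product that defines
`strict f` followed by `Q` is the comparison that `comp_strictHom_eq` asks for. -/
lemma IsMap.comm {P : Butterfly X.arrow Y.arrow} {Q : Butterfly X'.arrow Y'.arrow}
    {f : X.arrow ⟶ X'.arrow} {g : Y.arrow ⟶ Y'.arrow} {s : P.E ⟶ Q.E} (h : IsMap P Q f g s) :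
    (strictHom f : X ⟶ X') ≫ toHom Q = toHom P ≫ (strictHom g : Y ⟶ Y') := by
  symm
  have hw : (P.σ ≫ biprod.inl) ≫ (Butterfly.strict f).ρ = s ≫ Q.σ := by simp [h.s_σ]
  refine (comp_strictHom_eq (R := (Butterfly.strict f).comp Q)).2
    ⟨pullback.lift (P.σ ≫ biprod.inl) s hw ≫ cokernel.π _, ?_, ?_, ?_, ?_⟩
  · have : P.κ ≫ pullback.lift (P.σ ≫ biprod.inl) s hw =
        pullback.lift (Butterfly.strict f).κ 0 (by simp) +
          f.left ≫ Butterfly.compι (Butterfly.strict f) Q := by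
      apply pullback.hom_ext
      · apply biprod.hom_ext <;> simp
      · simp [h.κ_s]
    rw [← Category.assoc, this]
    simp
  · simp only [← Category.assoc]
    congr 1
    apply pullback.hom_ext <;> simp [h.ι_s]
  · simp
  · simp [h.s_ρ]

/-- Two morphisms of two-term complexes with the same class in `B` are homotopic. -/
lemma exists_homotopy {f g : X.arrow ⟶ Y.arrow}
    (h : (strictHom f : X ⟶ Y) = strictHom g) :
    ∃ k : X.arrow.right ⟶ Y.arrow.left, X.arrow.hom ≫ k = g.left - f.left ∧
      k ≫ Y.arrow.hom = g.right - f.right := by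
  obtain ⟨e, h1, h2, h3, h4⟩ := toHom_eq_iff.1 h.symm
  have h1 : biprod.lift X.arrow.hom (-g.left) ≫ e.hom = biprod.lift X.arrow.hom (-f.left) := h1
  have h2 : biprod.inr ≫ e.hom = biprod.inr := h2
  have h3 : e.hom ≫ biprod.fst = biprod.fst := h3
  have h4 : e.hom ≫ biprod.desc f.right Y.arrow.hom = biprod.desc g.right Y.arrow.hom := h4
  -- Both strict butterflies have centre `X⁰ ⊞ Y⁻¹`. An isomorphism compatible with `ι` and `σ` is
  -- unitriangular, and its off-diagonal entry is the homotopy.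
  refine ⟨biprod.inl ≫ e.hom ≫ biprod.snd, ?_, ?_⟩
  · have := h1 =≫ biprod.snd
    rw [biprod.lift_eq] at this
    simp only [Preadditive.add_comp, Category.assoc, Preadditive.neg_comp] at this
    rw [← Category.assoc biprod.inr, h2] at this
    simp only [biprod.inr_snd, Category.comp_id, biprod.lift_snd] at this
    rw [← sub_eq_add_neg, sub_eq_iff_eq_add] at this
    rw [this, sub_eq_add_neg, add_comm]
  · have := biprod.inl ≫= h4
    rw [biprod.desc_eq, Preadditive.comp_add, ← Category.assoc e.hom, h3] at this
    simp only [Preadditive.comp_add, biprod.inl_fst_assoc, biprod.inl_desc] at this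
    rw [Category.assoc, Category.assoc, ← this, add_sub_cancel_left]

end Tilt

end
end HRS

/-! ### Roofs and path objects: `Ch(B)` as a localization of `Chˢᵗ(B)` -/

namespace HRS

noncomputable section

variable {A : Type u} [Category.{v} A] [Abelian A] {t : TorsionPair A}

namespace Tilt

variable {X Y Z : Tilt t}

/-- The two-term complex `X⁻¹ ⊞ Y⁻¹ ⟶ E` of a butterfly from `X` to `Y` with centre `E`. -/
abbrev roof (P : Butterfly X.arrow Y.arrow) : Tilt t where
  arrow := Arrow.mk (biprod.desc P.κ P.ι)
  ker_mem := by
    have h0 : (kernel.ι (biprod.desc P.κ P.ι) ≫ biprod.fst) ≫ P.κ +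
        (kernel.ι (biprod.desc P.κ P.ι) ≫ biprod.snd) ≫ P.ι = 0 := by
      simpa [biprod.desc_eq] using kernel.condition (biprod.desc P.κ P.ι)
    have h1 : (kernel.ι (biprod.desc P.κ P.ι) ≫ biprod.fst) ≫ X.arrow.hom = 0 := by
      simpa using h0 =≫ P.σ
    -- If `κ x + ι y = 0` then `d x = 0`, and `x = 0` forces `y = 0` because `ι` is a monomorphism.
    -- So this kernel embeds in `ker d_X`.
    have : Mono (kernel.lift X.arrow.hom _ h1) := by
      rw [Preadditive.mono_iff_cancel_zero]
      intro T z hz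
      have h2 := hz =≫ kernel.ι X.arrow.hom
      rw [zero_comp, Category.assoc, kernel.lift_ι] at h2
      have h3 := z ≫= h0
      rw [Preadditive.comp_add, ← Category.assoc, h2, zero_comp, zero_add, comp_zero,
        ← Category.assoc] at h3
      have h4 := Preadditive.mono_iff_cancel_zero P.ι |>.1 inferInstance _ _ h3
      rw [← cancel_mono (kernel.ι _), zero_comp]
      apply biprod.hom_ext
      · simpa using h2
      · simpa using h4
    exact t.F_of_mono (kernel.lift X.arrow.hom _ h1) X.ker_mem
  coker_mem := by
    obtain ⟨g, hg⟩ := factor_coker P (cokernel.π (biprod.desc P.κ P.ι))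
      (by
        have := biprod.inl ≫= cokernel.condition (biprod.desc P.κ P.ι)
        rwa [comp_zero, ← Category.assoc, biprod.inl_desc] at this)
      (by
        have := biprod.inr ≫= cokernel.condition (biprod.desc P.κ P.ι)
        rwa [comp_zero, ← Category.assoc, biprod.inr_desc] at this)
    have : Epi g := by
      rw [← Category.assoc] at hg
      exact epi_of_epi_fac hg
    exact t.T_of_epi g X.coker_mem

/-- The first leg of the roof of a butterfly, a quasi-isomorphism. -/
abbrev roofFst (P : Butterfly X.arrow Y.arrow) : (roof P).arrow ⟶ X.arrow :=
  Arrow.homMk biprod.fst P.σ (by apply biprod.hom_ext' <;> simp)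

/-- The second leg of the roof of a butterfly. -/
abbrev roofSnd (P : Butterfly X.arrow Y.arrow) : (roof P).arrow ⟶ Y.arrow :=
  Arrow.homMk biprod.snd P.ρ (by apply biprod.hom_ext' <;> simp)

/-- With the invertibility of the first leg, this makes every morphism of `B` a right fraction of
strict morphisms. -/
lemma roofFst_comp (P : Butterfly X.arrow Y.arrow) :
    strictHom (X := roof P) (Y := X) (roofFst P) ≫ toHom P =
      strictHom (X := roof P) (Y := Y) (roofSnd P) := by
  refine strictHom_comp_eq.2 ⟨biprod.desc (𝟙 _) P.ι, ?_, ?_, ?_, ?_⟩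
  · apply biprod.hom_ext' <;> simp [biprod.lift_desc]
  · simp
  · apply biprod.hom_ext' <;> simp
  · apply biprod.hom_ext' <;> simp

instance isIso_roofFst (P : Butterfly X.arrow Y.arrow) :
    IsIso (strictHom (X := roof P) (Y := X) (roofFst P)) := by
  apply isIso_toHom
  refine ShortComplex.ShortExact.mk' ?_ ?_ ?_
  · rw [ShortComplex.exact_iff_exact_up_to_refinements]
    intro T z hz
    have hz : z ≫ biprod.desc P.σ X.arrow.hom = 0 := hz
    obtain ⟨a, b, rfl⟩ : ∃ (a : T ⟶ P.E) (b : T ⟶ X.arrow.left), z = biprod.lift a b :=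
      ⟨z ≫ biprod.fst, z ≫ biprod.snd, by apply biprod.hom_ext <;> simp⟩
    rw [biprod.lift_desc] at hz
    obtain ⟨y, hy⟩ := P.exists_lift (a + b ≫ P.κ) (by simpa using hz)
    -- From `σ a + d b = 0` one gets `a + κ b = ι y`, so `(a, b)` is the image of `(-b, y)`.
    refine ⟨T, 𝟙 _, inferInstance, biprod.lift (-b) y, ?_⟩
    rw [Category.id_comp]
    change _ = _ ≫ biprod.lift (biprod.desc P.κ P.ι) (-biprod.fst)
    apply biprod.hom_ext
    · simp [biprod.lift_desc, hy]
    · simp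
  · change Mono (biprod.lift (biprod.desc P.κ P.ι) (-biprod.fst))
    rw [Preadditive.mono_iff_cancel_zero]
    intro T x hx
    have h1 := hx =≫ biprod.fst
    have h2 := hx =≫ biprod.snd
    simp only [Category.assoc, biprod.lift_fst, biprod.lift_snd, zero_comp, Preadditive.comp_neg,
      neg_eq_zero, biprod.desc_eq, Preadditive.comp_add] at h1 h2
    rw [← Category.assoc, h2, zero_comp, zero_add, ← Category.assoc] at h1
    have h3 := Preadditive.mono_iff_cancel_zero P.ι |>.1 inferInstance _ _ h1
    apply biprod.hom_ext
    · simpa using h2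
    · simpa using h3
  · change Epi (biprod.desc P.σ X.arrow.hom)
    have : Epi (biprod.inl ≫ biprod.desc P.σ X.arrow.hom) := by
      rw [biprod.inl_desc]; infer_instance
    exact epi_of_epi biprod.inl _

/-- The differential of the path object. -/
abbrev pathD (Y : Arrow A) : Y.left ⊞ Y.left ⟶ Y.right ⊞ Y.left :=
  biprod.lift (biprod.fst ≫ Y.hom) (biprod.snd - biprod.fst)

/-- The path object `Y⁻¹ ⊞ Y⁻¹ ⟶ Y⁰ ⊞ Y⁻¹` of `Y`. -/
abbrev path (Y : Tilt t) : Tilt t where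
  arrow := Arrow.mk (pathD Y.arrow)
  ker_mem := by
    have h := kernel.condition (pathD Y.arrow)
    have h1 : (kernel.ι (pathD Y.arrow) ≫ biprod.fst) ≫ Y.arrow.hom = 0 := by
      have := h =≫ biprod.fst
      rwa [Category.assoc, biprod.lift_fst, zero_comp, ← Category.assoc] at this
    -- The second component of `pathD` is the difference of the end points, so a path in the kernel
    -- is constant, and the kernel embeds in `ker d_Y`.
    have h2 : kernel.ι (pathD Y.arrow) ≫ biprod.snd = kernel.ι (pathD Y.arrow) ≫ biprod.fst := by
      have := h =≫ biprod.snd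
      rwa [Category.assoc, biprod.lift_snd, zero_comp, Preadditive.comp_sub, sub_eq_zero] at this
    have : Mono (kernel.lift Y.arrow.hom _ h1) := by
      rw [Preadditive.mono_iff_cancel_zero]
      intro T z hz
      have h3 := hz =≫ kernel.ι Y.arrow.hom
      rw [zero_comp, Category.assoc, kernel.lift_ι] at h3
      rw [← cancel_mono (kernel.ι _), zero_comp]
      apply biprod.hom_ext
      · simpa using h3
      · rw [Category.assoc, h2, h3, zero_comp]
    exact t.F_of_mono (kernel.lift Y.arrow.hom _ h1) Y.ker_mem
  coker_mem := by
    have h := cokernel.condition (pathD Y.arrow)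
    -- Modulo the image of `pathD`, both the summand `Y⁻¹` and the image of `d_Y` in `Y⁰` vanish,
    -- which leaves a quotient of `coker d_Y`.
    have h1 : Y.arrow.hom ≫ biprod.inl ≫ cokernel.π (pathD Y.arrow) = 0 := by
      have e : Y.arrow.hom ≫ biprod.inl = biprod.lift (𝟙 _) (𝟙 _) ≫ pathD Y.arrow := by
        apply biprod.hom_ext <;> simp
      rw [← Category.assoc, e, Category.assoc, h, comp_zero]
    have h2 : biprod.inr ≫ cokernel.π (pathD Y.arrow) = 0 := by
      have e : biprod.inr = biprod.inr ≫ pathD Y.arrow := by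
        apply biprod.hom_ext <;> simp
      rw [e, Category.assoc, h, comp_zero]
    have : Epi (cokernel.desc Y.arrow.hom _ h1) := by
      rw [Preadditive.epi_iff_cancel_zero]
      intro T z hz
      have h3 := cokernel.π _ ≫= hz
      rw [comp_zero, ← Category.assoc, cokernel.π_desc, Category.assoc] at h3
      rw [← cancel_epi (cokernel.π _), comp_zero]
      apply biprod.hom_ext'
      · rw [h3, comp_zero]
      · rw [← Category.assoc, h2, zero_comp, comp_zero]
    exact t.T_of_epi (cokernel.desc Y.arrow.hom _ h1) Y.coker_mem

/-- The inclusion of the constant paths. -/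
abbrev pathConst (Y : Tilt t) : Y.arrow ⟶ (path Y).arrow :=
  Arrow.homMk (biprod.lift (𝟙 _) (𝟙 _)) biprod.inl (by apply biprod.hom_ext <;> simp)

/-- The starting point of a path. -/
abbrev pathFst (Y : Tilt t) : (path Y).arrow ⟶ Y.arrow :=
  Arrow.homMk biprod.fst biprod.fst (by simp)

/-- The end point of a path. -/
abbrev pathSnd (Y : Tilt t) : (path Y).arrow ⟶ Y.arrow :=
  Arrow.homMk biprod.snd (biprod.desc (𝟙 _) Y.arrow.hom) (by simp [biprod.lift_desc])

lemma pathConst_fst (Y : Tilt t) : pathConst Y ≫ pathFst Y = 𝟙 _ := by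
  apply Arrow.hom_ext <;> simp

lemma pathConst_snd (Y : Tilt t) : pathConst Y ≫ pathSnd Y = 𝟙 _ := by
  apply Arrow.hom_ext <;> simp

/-- The cone sequence splits: `(a, (y₀, y₁)) ↦ -y₀` is a retraction of `κ` and `(a, z) ↦ (a, (0,
z))` a section of `ρ`. -/
instance isIso_pathConst (Y : Tilt t) :
    IsIso (strictHom (X := Y) (Y := path Y) (pathConst Y)) := by
  apply isIso_toHom
  refine ShortComplex.Splitting.shortExact
    (ShortComplex.Splitting.mk (-(biprod.snd ≫ biprod.fst))
      (biprod.desc biprod.inl (biprod.inr ≫ biprod.inr)) ?_ ?_ ?_)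
  · simp
  · apply biprod.hom_ext' <;> apply biprod.hom_ext <;> simp
  · change (-(biprod.snd ≫ biprod.fst)) ≫
      biprod.lift Y.arrow.hom (-biprod.lift (𝟙 Y.arrow.left) (𝟙 Y.arrow.left)) +
      biprod.desc biprod.inl (pathD Y.arrow) ≫
        biprod.desc biprod.inl (biprod.inr ≫ biprod.inr) = 𝟙 _
    apply biprod.hom_ext'
    · apply biprod.hom_ext <;> simp
    · apply biprod.hom_ext'
      · apply biprod.hom_ext
        · simp
        · apply biprod.hom_ext <;> simp
      · apply biprod.hom_ext
        · simp
        · apply biprod.hom_ext <;> simp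

/-- The map to the path object given by a homotopy. -/
abbrev pathMap {f g : X.arrow ⟶ Y.arrow} (k : X.arrow.right ⟶ Y.arrow.left)
    (h : X.arrow.hom ≫ k = g.left - f.left) : X.arrow ⟶ (path Y).arrow :=
  Arrow.homMk (biprod.lift f.left g.left) (biprod.lift f.right k) (by
    apply biprod.hom_ext <;> simp [h])

lemma pathMap_fst {f g : X.arrow ⟶ Y.arrow} (k : X.arrow.right ⟶ Y.arrow.left)
    (h : X.arrow.hom ≫ k = g.left - f.left) : pathMap k h ≫ pathFst Y = f := by
  apply Arrow.hom_ext <;> simp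

lemma pathMap_snd {f g : X.arrow ⟶ Y.arrow} (k : X.arrow.right ⟶ Y.arrow.left)
    (h : X.arrow.hom ≫ k = g.left - f.left) (h' : k ≫ Y.arrow.hom = g.right - f.right) :
    pathMap k h ≫ pathSnd Y = g := by
  apply Arrow.hom_ext <;> simp [biprod.lift_desc, h']

end Tilt

/-- The complex structure transported along isomorphisms to the terms of a complex. -/
abbrev transport {C : Type*} [Category C] [HasZeroMorphisms C] {ι : Type*} {c : ComplexShape ι}
    (K : HomologicalComplex C c) (Z : ι → C) (e : ∀ n, Z n ≅ K.X n) : HomologicalComplex C c where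
  X := Z
  d i j := (e i).hom ≫ K.d i j ≫ (e j).inv
  shape i j h := by rw [K.shape i j h, zero_comp, comp_zero]
  d_comp_d' i j k _ _ := by simp

namespace StrictComplex

open _root_.HRS.Tilt

variable {X Y : StrictComplex t}

lemma isIso_incl_map (f : X ⟶ Y)
    (h : ∀ n, IsIso (strictHom (f.f n) : X.cx.X n ⟶ Y.cx.X n)) : IsIso ((incl t).map f) := by
  have : ∀ n, IsIso (((incl t).map f).f n) := h
  exact HomologicalComplex.Hom.isIso_of_components _

instance : (incl t).EssSurj := ⟨fun K => ⟨⟨K⟩, ⟨Iso.refl _⟩⟩⟩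

/-- The butterflies chosen in different degrees need not be compatible. The differentials of the
roof are carried over from `X` along the invertible first legs, and both legs then commute with them
as morphisms of `B`. -/
lemma hasRoofs_incl (t : TorsionPair A) : HasRoofs (incl t) := by
  intro X Y φ
  change X.cx ⟶ Y.cx at φ
  let P : ∀ n, Butterfly (X.cx.X n).arrow (Y.cx.X n).arrow := fun n => out (φ.f n)
  have hP : ∀ n, strictHom (X := roof (P n)) (Y := X.cx.X n) (roofFst (P n)) ≫ φ.f n =
      strictHom (X := roof (P n)) (Y := Y.cx.X n) (roofSnd (P n)) := fun n => by
    rw [← roofFst_comp, toHom_out]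
  let e : ∀ n, roof (P n) ≅ X.cx.X n := fun n =>
    asIso (strictHom (X := roof (P n)) (Y := X.cx.X n) (roofFst (P n)))
  let R : StrictComplex t := ⟨transport X.cx (fun n => roof (P n)) e⟩
  let s : R ⟶ X := Hom.mk (fun n => roofFst (P n)) fun i j => by
    change (e i).hom ≫ _ = ((e i).hom ≫ X.cx.d i j ≫ (e j).inv) ≫ (e j).hom
    simp
  let f : R ⟶ Y := Hom.mk (fun n => roofSnd (P n)) fun i j => by
    change strictHom (X := roof (P i)) (Y := Y.cx.X i) (roofSnd (P i)) ≫ _ =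
      ((e i).hom ≫ X.cx.d i j ≫ (e j).inv) ≫
        strictHom (X := roof (P j)) (Y := Y.cx.X j) (roofSnd (P j))
    rw [← hP, ← hP]
    change ((e i).hom ≫ φ.f i) ≫ _ =
      ((e i).hom ≫ X.cx.d i j ≫ (e j).inv) ≫ (e j).hom ≫ φ.f j
    simp
  refine ⟨R, s, f, isIso_incl_map s fun n => isIso_roofFst (P n), ?_⟩
  apply HomologicalComplex.hom_ext
  intro n
  exact hP n

/-- Homotopies are chosen in each degree separately. The differentials of the path complex are
carried over from `Y` along the constant paths, so no compatibility between the homotopies is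
needed. -/
lemma hasPaths_incl (t : TorsionPair A) : HasPaths (incl t) := by
  intro X Y f g hfg
  have hfg' : ∀ n, (strictHom (f.f n) : X.cx.X n ⟶ Y.cx.X n) = strictHom (g.f n) := fun n =>
    HomologicalComplex.congr_hom hfg n
  choose k hk hk' using fun n => exists_homotopy (hfg' n)
  let e : ∀ n, Y.cx.X n ≅ path (Y.cx.X n) := fun n =>
    asIso (strictHom (X := Y.cx.X n) (Y := path (Y.cx.X n)) (pathConst (Y.cx.X n)))
  let P : StrictComplex t := ⟨transport Y.cx (fun n => path (Y.cx.X n)) fun n => (e n).symm⟩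
  -- Every retraction of the constant paths represents the inverse of their class. In particular the
  -- two end point maps have the same class in `B`.
  have hinv : ∀ n (q : (path (Y.cx.X n)).arrow ⟶ (Y.cx.X n).arrow),
      pathConst (Y.cx.X n) ≫ q = 𝟙 _ →
      strictHom (X := path (Y.cx.X n)) (Y := Y.cx.X n) q = (e n).inv := fun n q hq => by
    rw [← cancel_epi (e n).hom, Iso.hom_inv_id, ← strictHom_id, ← hq]
    exact strictHom_comp _ _
  have hcomm : ∀ q : ∀ n, (path (Y.cx.X n)).arrow ⟶ (Y.cx.X n).arrow,
      (∀ n, pathConst (Y.cx.X n) ≫ q n = 𝟙 _) → ∀ i j : ℤ,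
      strictHom (X := P.cx.X i) (Y := Y.cx.X i) (q i) ≫ Y.cx.d i j =
        P.cx.d i j ≫ strictHom (X := P.cx.X j) (Y := Y.cx.X j) (q j) := fun q hq i j => by
    refine (congrArg (· ≫ Y.cx.d i j) (hinv i (q i) (hq i))).trans (Eq.trans ?_
      (congrArg (P.cx.d i j ≫ ·) (hinv j (q j) (hq j))).symm)
    change (e i).inv ≫ Y.cx.d i j = ((e i).inv ≫ Y.cx.d i j ≫ (e j).hom) ≫ (e j).inv
    simp
  let p : P ⟶ Y := Hom.mk (fun n => pathFst (Y.cx.X n)) (hcomm _ fun n => pathConst_fst _)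
  let q : P ⟶ Y := Hom.mk (fun n => pathSnd (Y.cx.X n)) (hcomm _ fun n => pathConst_snd _)
  let c : Y ⟶ P := Hom.mk (fun n => pathConst (Y.cx.X n)) fun i j => by
    change (e i).hom ≫ (e i).inv ≫ Y.cx.d i j ≫ (e j).hom = Y.cx.d i j ≫ (e j).hom
    simp
  -- The starting point map being invertible in `B`, the class of the map to the path object is
  -- determined by its starting point `f`; it commutes with the differentials because `f` does.
  have hh : ∀ n, strictHom (X := X.cx.X n) (Y := path (Y.cx.X n)) (pathMap (k n) (hk n)) =
      strictHom (f.f n) ≫ (e n).hom := fun n => by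
    rw [← Iso.comp_inv_eq, ← hinv n _ (pathConst_fst _)]
    refine (strictHom_comp _ _).trans ?_
    rw [pathMap_fst]
  let h : X ⟶ P := Hom.mk (fun n => pathMap (k n) (hk n)) fun i j => by
    refine (congrArg (· ≫ P.cx.d i j) (hh i)).trans (Eq.trans ?_
      (congrArg (X.cx.d i j ≫ ·) (hh j)).symm)
    change (strictHom (f.f i) ≫ (e i).hom) ≫ (e i).inv ≫ Y.cx.d i j ≫ (e j).hom =
      X.cx.d i j ≫ strictHom (f.f j) ≫ (e j).hom
    rw [Category.assoc, Iso.hom_inv_id_assoc, ← Category.assoc, f.comm, Category.assoc]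
  exact ⟨P, p, q, c, h, Hom.ext (funext fun n => pathConst_fst _),
    Hom.ext (funext fun n => pathConst_snd _), Hom.ext (funext fun n => pathMap_fst _ (hk n)),
    Hom.ext (funext fun n => pathMap_snd _ (hk n) (hk' n)),
    isIso_incl_map c fun n => isIso_pathConst _⟩

instance isLocalization_incl (t : TorsionPair A) :
    (incl t).IsLocalization (invertedBy (incl t)) :=
  isLocalization_of_hasRoofs _ (hasRoofs_incl t) (hasPaths_incl t)

end StrictComplex

end
end HRS

/-! ### `Tot` is an equivalence before localization -/

namespace HRS

noncomputable section

variable {A : Type u} [Category.{v} A] [Abelian A] {t : TorsionPair A}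

/-- The centre with index `n - 1` sits in degree `n` of the decorated complex, and `(n - 1) + 1` is
not definitionally `n`. This and `exists_unshift` reindex dependent families accordingly. -/
lemma exists_shift {F : ℤ → Type*} (g : ∀ n, F (n - 1)) : ∃ s : ∀ k, F k, ∀ n, s (n - 1) = g n :=
  ⟨fun k => cast (by rw [add_sub_cancel_right]) (g (k + 1)), fun n =>
    eq_of_heq ((cast_heq _ _).trans (by rw [sub_add_cancel]))⟩

lemma exists_unshift {F : ℤ → Type*} (g : ∀ k, F (k + 1)) :
    ∃ s : ∀ n, F n, ∀ k, s (k + 1) = g k :=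
  ⟨fun n => cast (by rw [sub_add_cancel]) (g (n - 1)), fun k =>
    eq_of_heq ((cast_heq _ _).trans (by rw [add_sub_cancel_right]))⟩

lemma exists_eq_add_one (n : ℤ) : ∃ k, n = k + 1 := ⟨n - 1, (sub_add_cancel n 1).symm⟩

lemma exists_eq_sub_one (k : ℤ) : ∃ n, k = n - 1 := ⟨k + 1, (add_sub_cancel_right k 1).symm⟩

section

variable {C : Type*} [Category C] {U V M N : C} {i : U ⟶ M} {j : V ⟶ N} [Mono i] [Mono j] {g : M ⟶ N}

lemma exists_lift_of_factors (h : (Subobject.mk j).Factors ((Subobject.mk i).arrow ≫ g)) :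
    ∃ l, i ≫ g = l ≫ j := by
  refine ⟨(Subobject.underlyingIso i).inv ≫ (Subobject.mk j).factorThru _ h ≫
    (Subobject.underlyingIso j).hom, ?_⟩
  rw [Category.assoc, Category.assoc, Subobject.underlyingIso_hom_comp_eq_mk,
    Subobject.factorThru_arrow, ← Category.assoc, Subobject.underlyingIso_arrow]

lemma mk_factors_of_fac {f : U ⟶ N} (l : U ⟶ V) (h : l ≫ j = f) : (Subobject.mk j).Factors f :=
  (Subobject.mk_factors_iff _ _).2 ⟨l, h⟩

end

namespace Tot

section

variable {X Y : StrictComplex t}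

/-- The monomorphism `ι` of the `k`-th butterfly detects the degree `-1` component of index `k + 1`,
and the epimorphism `σ` of the `n`-th detects the degree `0` component of index `n`. -/
instance : (Tot t).Faithful where
  map_injective {X Y φ ψ} h := by
    have h' : ∀ k, mapE φ k = mapE ψ k := fun k => by
      obtain ⟨n, rfl⟩ := exists_eq_sub_one k
      exact HomologicalComplex.congr_hom
        (congrArg (fun f => f.hom.map) h) n
    refine StrictComplex.Hom.ext (funext fun n => Arrow.hom_ext _ _ ?_ ?_)
    · obtain ⟨k, rfl⟩ := exists_eq_add_one n
      rw [← cancel_mono (wing Y k).ι, ← (isMap φ k).ι_s, ← (isMap ψ k).ι_s, h']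
    · rw [← cancel_epi (wing X n).σ, ← (isMap φ n).s_σ, ← (isMap ψ n).s_σ, h']

/-- A family of maps between the centres of the butterflies that is compatible with the links and
with the decorations comes from a strict morphism. -/
lemma exists_strict (s : ∀ k, (wing X k).E ⟶ (wing Y k).E)
    (hδ : ∀ k, s k ≫ δ Y k = δ X k ≫ s (k + 1))
    (hι : ∀ k, ∃ l, (wing X k).ι ≫ s k = l ≫ (wing Y k).ι) :
    ∃ φ : X ⟶ Y, ∀ k, mapE φ k = s k := by
  choose l hl using hι
  have hr : ∀ k, ∃ r, (wing X k).σ ≫ r = s k ≫ (wing Y k).σ := fun k =>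
    (wing X k).exists_desc _ (by
      rw [← Category.assoc, hl, Category.assoc, Butterfly.ι_σ, comp_zero])
  choose r hr using hr
  obtain ⟨L, hL⟩ := exists_unshift
    (F := fun n => (X.cx.X n).arrow.left ⟶ (Y.cx.X n).arrow.left) l
  -- Since `κ` of a butterfly is the previous `ι` followed by the link, compatibility with `ι` and
  -- the links implies compatibility with `κ`. In the same way `ρ` below is the link followed by the
  -- next `σ`.
  have hκ : ∀ k, (wing X k).κ ≫ s k = L k ≫ (wing Y k).κ := fun k => by
    obtain ⟨m, rfl⟩ := exists_eq_add_one k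
    rw [← (isLink X m).ι_δ, ← (isLink Y m).ι_δ, Category.assoc, ← hδ, ← Category.assoc, hl, hL,
      Category.assoc]
  have hw : ∀ n, L n ≫ (Y.cx.X n).arrow.hom = (X.cx.X n).arrow.hom ≫ r n := fun n => by
    rw [← (wing Y n).κ_σ, ← Category.assoc, ← hκ, Category.assoc, ← hr, ← Category.assoc,
      Butterfly.κ_σ]
  let f : ∀ n, (X.cx.X n).arrow ⟶ (Y.cx.X n).arrow := fun n => Arrow.homMk (L n) (r n) (hw n)
  have hmap : ∀ k, Tilt.IsMap (wing X k) (wing Y k) (f k) (f (k + 1)) (s k) := fun k =>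
    { κ_s := hκ k
      ι_s := by
        change _ = L (k + 1) ≫ _
        rw [hL, hl]
      s_σ := (hr k).symm
      s_ρ := by
        change _ = _ ≫ r (k + 1)
        rw [← (isLink X k).δ_σ, ← (isLink Y k).δ_σ, Category.assoc, hr, ← Category.assoc, hδ,
          Category.assoc] }
  let φ : X ⟶ Y := StrictComplex.Hom.mk f fun i j => by
    by_cases h : i + 1 = j
    · subst h
      have := (hmap i).comm
      rwa [Tilt.toHom_out, Tilt.toHom_out] at this
    · rw [X.cx.shape i j h, Y.cx.shape i j h, zero_comp, comp_zero]
  exact ⟨φ, fun k => (isMap φ k).unique (hmap k)⟩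

/-- A morphism of decorated complexes is exactly the input of `exists_strict`: chain maps respect
the links, and preservation of `M` is a lift through `ι`. -/
instance : (Tot t).Full where
  map_surjective {X Y} g := by
    obtain ⟨s, hs⟩ := exists_shift (F := fun k => (wing X k).E ⟶ (wing Y k).E)
      fun n => g.hom.map.f n
    have hδ : ∀ k l, k + 1 = l → s k ≫ (aux Y).d k l = (aux X).d k l ≫ s l := fun k l h => by
      obtain ⟨n, rfl⟩ := exists_eq_sub_one k
      obtain ⟨m, rfl⟩ := exists_eq_sub_one l
      rw [hs, hs]
      exact g.hom.map.comm n m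
    have hι : ∀ k, ∃ l, (wing X k).ι ≫ s k = l ≫ (wing Y k).ι := fun k => by
      obtain ⟨n, rfl⟩ := exists_eq_sub_one k
      rw [hs]
      exact exists_lift_of_factors (g.hom.factors n)
    obtain ⟨φ, hφ⟩ := exists_strict s (fun k => by
      have := hδ k (k + 1) rfl
      rwa [aux_d, aux_d] at this) hι
    refine ⟨φ, ?_⟩
    apply ObjectProperty.hom_ext
    apply Decorated.Hom.ext
    apply HomologicalComplex.hom_ext
    intro n
    exact (hφ (n - 1)).trans (hs n)

end

section

variable (E : CompatibleComplex t)

/-- The two-term complex `Mᵏ ⟶ Eᵏ⁺¹ / Mᵏ⁺¹` of a compatibly decorated complex. -/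
abbrev term (k : ℤ) : Tilt t where
  arrow := Arrow.mk (E.obj.two k)
  ker_mem := (E.property k).1
  coker_mem := (E.property k).2

/-- The butterfly with centre `Eᵏ⁺¹` of a compatibly decorated complex. -/
abbrev termWing (k : ℤ) : Butterfly (term E k).arrow (term E (k + 1)).arrow where
  E := E.obj.cx.X (k + 1)
  κ := (E.obj.sub k).arrow ≫ E.obj.cx.d k (k + 1)
  ι := (E.obj.sub (k + 1)).arrow
  σ := cokernel.π (E.obj.sub (k + 1)).arrow
  ρ := E.obj.cx.d (k + 1) (k + 1 + 1) ≫ cokernel.π (E.obj.sub (k + 1 + 1)).arrow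
  κ_σ := Category.assoc _ _ _
  ι_ρ := rfl
  κ_ρ := by simp
  ι_σ := cokernel.condition _
  shortExact :=
    { exact := ShortComplex.exact_cokernel _
      mono_f := inferInstanceAs (Mono (E.obj.sub (k + 1)).arrow)
      epi_g := inferInstanceAs (Epi (cokernel.π _)) }

lemma termWing_isLink (k : ℤ) :
    Tilt.IsLink (termWing E k) (termWing E (k + 1)) (E.obj.cx.d (k + 1) (k + 1 + 1)) where
  κ_δ := by simp
  ι_δ := rfl
  δ_σ := rfl
  δ_ρ := by simp

/-- The complex in `B` of a compatibly decorated complex. -/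
abbrev ofDecorated : StrictComplex t where
  cx := CochainComplex.of (term E) (fun k => Tilt.toHom (termWing E k))
    fun k => (termWing_isLink E k).comp_eq_zero

/-- `Tot` uses its own representative of each differential, so the centres are recovered only up to
an isomorphism of butterflies. -/
lemma wing_equiv (k : ℤ) : wing (ofDecorated E) k ≈ termWing E k :=
  Tilt.toHom_eq_iff.1 ((Tilt.toHom_out _).trans
    (CochainComplex.of_d (term E) (fun k => Tilt.toHom (termWing E k)) k))

/-- The centre of the butterfly of `ofDecorated E` in degree `k` is `Eᵏ⁺¹`. -/
def centreIso (k : ℤ) : (wing (ofDecorated E) k).E ≅ E.obj.cx.X (k + 1) :=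
  (wing_equiv E k).choose

lemma centreIso_isHom (k : ℤ) :
    Butterfly.IsHom (wing (ofDecorated E) k) (termWing E k) (centreIso E k).hom :=
  (wing_equiv E k).choose_spec

/-- Both composites agree on the four arrows of the butterflies, so their difference vanishes by
`Tilt.vanish`. -/
lemma centreIso_comm (k : ℤ) :
    (centreIso E k).hom ≫ E.obj.cx.d (k + 1) (k + 1 + 1) =
      δ (ofDecorated E) k ≫ (centreIso E (k + 1)).hom := by
  have h := isLink (ofDecorated E) k
  have h' := termWing_isLink E k
  have e := centreIso_isHom E k
  have e' := centreIso_isHom E (k + 1)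
  rw [← sub_eq_zero]
  apply Tilt.vanish (wing (ofDecorated E) k) (termWing E (k + 1))
  · rw [Preadditive.comp_sub, ← Category.assoc, e.κ, h'.κ_δ, ← Category.assoc, h.κ_δ, zero_comp,
      sub_self]
  · rw [Preadditive.comp_sub, ← Category.assoc, e.ι, h'.ι_δ, ← Category.assoc, h.ι_δ, e'.κ,
      sub_self]
  · rw [Preadditive.sub_comp, Category.assoc, h'.δ_σ, e.ρ, Category.assoc, e'.σ, h.δ_σ, sub_self]
  · rw [Preadditive.sub_comp, Category.assoc, h'.δ_ρ, comp_zero, Category.assoc, e'.ρ, h.δ_ρ,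
      sub_self]

/-- `centreIso` with the degree shifted. -/
def centreIso' (k l : ℤ) (h : k + 1 = l) : (wing (ofDecorated E) k).E ≅ E.obj.cx.X l :=
  centreIso E k ≪≫ E.obj.cx.XIsoOfEq h

/-- The degrees are independent variables tied by equations, so that the lemma applies to the
butterflies `n - 1` and `m - 1` that `Tot` places in degrees `n` and `m`. -/
lemma centreIso'_comm (k k' l m : ℤ) (h : k + 1 = l) (h' : k' + 1 = m) (hk : k + 1 = k') :
    (centreIso' E k l h).hom ≫ E.obj.cx.d l m =
      (aux (ofDecorated E)).d k k' ≫ (centreIso' E k' m h').hom := by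
  subst h' hk h
  rw [aux_d]
  simpa [centreIso'] using centreIso_comm E k

lemma centreIso'_factors (k l : ℤ) (h : k + 1 = l) :
    (E.obj.sub l).Factors ((Subobject.mk (wing (ofDecorated E) k).ι).arrow ≫
      (centreIso' E k l h).hom) ∧
    (Subobject.mk (wing (ofDecorated E) k).ι).Factors ((E.obj.sub l).arrow ≫
      (centreIso' E k l h).inv) := by
  subst h
  have e : (wing (ofDecorated E) k).ι ≫ (centreIso E k).hom = (E.obj.sub (k + 1)).arrow :=
    (centreIso_isHom E k).ι
  constructor
  · have : (Subobject.mk (wing (ofDecorated E) k).ι).arrow ≫ (centreIso' E k (k + 1) rfl).hom =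
        (Subobject.underlyingIso (wing (ofDecorated E) k).ι).hom ≫ (E.obj.sub (k + 1)).arrow := by
      rw [← e, ← Subobject.underlyingIso_hom_comp_eq_mk]
      simp [centreIso']
    rw [this]
    exact Subobject.factors_of_factors_right _ (Subobject.factors_self _)
  · refine mk_factors_of_fac (𝟙 _) ?_
    rw [Category.id_comp, Iso.eq_comp_inv, ← e]
    simp [centreIso']

/-- A compatibly decorated complex is recovered from its complex in `B`. -/
def totOfDecoratedIso : (Tot t).obj (ofDecorated E) ≅ E :=
  let i : (decorated (ofDecorated E)).cx ≅ E.obj.cx :=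
    HomologicalComplex.Hom.isoOfComponents
      (fun n => centreIso' E (n - 1) n (sub_add_cancel n 1))
      fun n m h => centreIso'_comm E (n - 1) (m - 1) n m _ _ (by
        have h : n + 1 = m := h
        omega)
  (compatible t).isoMk
    { hom := ⟨i.hom, fun n => (centreIso'_factors E (n - 1) n _).1⟩
      inv := ⟨i.inv, fun n => (centreIso'_factors E (n - 1) n _).2⟩
      hom_inv_id := Decorated.Hom.ext i.hom_inv_id
      inv_hom_id := Decorated.Hom.ext i.inv_hom_id }

end

instance : (Tot t).EssSurj := ⟨fun E => ⟨ofDecorated E, ⟨totOfDecoratedIso E⟩⟩⟩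

instance isEquivalence : (Tot t).IsEquivalence where

end Tot

end
end HRS

/-! ### `sis` corresponds to the morphisms inverted in `Ch(B)` -/

namespace HRS

noncomputable section

variable {A : Type u} [Category.{v} A] [Abelian A] {t : TorsionPair A}

namespace Decorated

/-- The two-term complex `Mⁿ ⟶ Eⁿ⁺¹ / Mⁿ⁺¹` as a functor. -/
def twoFunctor (n : ℤ) : Decorated A ⥤ Arrow A where
  obj E := Arrow.mk (E.two n)
  map φ := Arrow.homMk (subMap φ n) (quotMap φ (n + 1)) (two_comm φ n).symm
  map_id E := by
    apply Arrow.hom_ext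
    · refine (cancel_mono (E.sub n).arrow).1 ((subMap_arrow (𝟙 E) n).trans ?_)
      exact (Category.comp_id _).trans (Category.id_comp _).symm
    · refine (cancel_epi (cokernel.π (E.sub (n + 1)).arrow)).1 ((cokernel.π_desc _ _ _).trans ?_)
      exact (Category.id_comp _).trans (Category.comp_id _).symm
  map_comp {E F G} φ ψ := by
    apply Arrow.hom_ext
    · refine (cancel_mono (G.sub n).arrow).1 ((subMap_arrow (φ ≫ ψ) n).trans ?_)
      change _ ≫ φ.map.f n ≫ ψ.map.f n = (subMap φ n ≫ subMap ψ n) ≫ _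
      rw [Category.assoc, subMap_arrow, ← Category.assoc, ← Category.assoc, subMap_arrow]
    · refine (cancel_epi (cokernel.π (E.sub (n + 1)).arrow)).1 ((cokernel.π_desc _ _ _).trans ?_)
      change (φ.map.f (n + 1) ≫ ψ.map.f (n + 1)) ≫ _ =
        _ ≫ quotMap φ (n + 1) ≫ quotMap ψ (n + 1)
      rw [quotMap, quotMap, cokernel.π_desc_assoc, Category.assoc, Category.assoc, cokernel.π_desc]

/-- The underlying complex of a decorated complex. -/
def forget : Decorated A ⥤ CochainComplex A ℤ where
  obj E := E.cx
  map φ := φ.map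

end Decorated

lemma sis_iff {E F : CompatibleComplex t} (φ : E ⟶ F) :
    sis t φ ↔ ∀ n, arrowQis ((Decorated.twoFunctor n).map φ.hom) := Iff.rfl

/-- Stability under isomorphism, here and for `qis`, is what lets the class be moved along the
equivalence `Tot`. -/
instance : (sis t).RespectsIso :=
  MorphismProperty.RespectsIso.of_respects_arrow_iso _ fun _ _ e h n =>
    (arrowQis.arrow_mk_iso_iff
      (((compatible t).ι ⋙ Decorated.twoFunctor n).mapArrow.mapIso e)).1 (h n)

instance : (qis t).RespectsIso :=
  MorphismProperty.RespectsIso.of_respects_arrow_iso _ fun _ _ e h =>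
    ((HomologicalComplex.quasiIso A (ComplexShape.up ℤ)).arrow_mk_iso_iff
      (((compatible t).ι ⋙ Decorated.forget).mapArrow.mapIso e)).1 h

/-- The quotient of the centre of a butterfly by the image of `ι`. -/
def Butterfly.quotIso {X Y : Arrow A} (P : Butterfly X Y) :
    cokernel (Subobject.mk P.ι).arrow ≅ X.right where
  hom := cokernel.desc _ P.σ (by
    rw [← Subobject.underlyingIso_hom_comp_eq_mk, Category.assoc, P.ι_σ, Limits.comp_zero])
  inv := P.shortExact.exact.desc (cokernel.π _) (by
    change P.ι ≫ _ = 0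
    rw [← cancel_epi (Subobject.underlyingIso P.ι).hom, ← Category.assoc,
      Subobject.underlyingIso_hom_comp_eq_mk, cokernel.condition, Limits.comp_zero])
  hom_inv_id := by
    rw [← cancel_epi (cokernel.π _), cokernel.π_desc_assoc, Category.comp_id]
    exact P.shortExact.exact.g_desc _ _
  inv_hom_id := by
    rw [← cancel_epi P.σ, ← Category.assoc]
    refine (congrArg (· ≫ _) (P.shortExact.exact.g_desc _ _)).trans ?_
    rw [cokernel.π_desc, Category.comp_id]

lemma Butterfly.π_quotIso_hom {X Y : Arrow A} (P : Butterfly X Y) :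
    cokernel.π _ ≫ P.quotIso.hom = P.σ := cokernel.π_desc _ _ _

namespace Tot

variable {X Y : StrictComplex t}

lemma underlyingIso_two (X : StrictComplex t) (k : ℤ) :
    (Subobject.underlyingIso (wing X k).ι).hom ≫ (X.cx.X (k + 1)).arrow.hom =
      ((Subobject.mk (wing X k).ι).arrow ≫ (aux X).d k (k + 1) ≫
        cokernel.π (Subobject.mk (wing X (k + 1)).ι).arrow) ≫ (wing X (k + 1)).quotIso.hom := by
  rw [aux_d]
  simp only [Category.assoc, Butterfly.π_quotIso_hom]
  rw [(isLink X k).δ_σ, ← Subobject.underlyingIso_hom_comp_eq_mk, Category.assoc, Butterfly.ι_ρ]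

/-- The two-term complex of the decorated complex of `X` is the one of `X`. -/
def twoIso (X : StrictComplex t) (k : ℤ) :
    Arrow.mk ((Subobject.mk (wing X k).ι).arrow ≫ (aux X).d k (k + 1) ≫
        cokernel.π (Subobject.mk (wing X (k + 1)).ι).arrow) ≅ (X.cx.X (k + 1)).arrow :=
  Arrow.isoMk (Subobject.underlyingIso (wing X k).ι) (wing X (k + 1)).quotIso
    (underlyingIso_two X k)

/-- Through `twoIso` the map `(u, v)` becomes `φ.f (k + 1)`, because `mapE` is compatible with `ι`
and `σ`. The index `l` is free since in degree `n` of the decorated complex it occurs as `n + 1 -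
1`, with `k = n - 1`. -/
lemma arrowQis_iff (φ : X ⟶ Y) (k l : ℤ) (h : k + 1 = l)
    (u : (Subobject.mk (wing X k).ι : A) ⟶ (Subobject.mk (wing Y k).ι : A))
    (v : cokernel (Subobject.mk (wing X l).ι).arrow ⟶ cokernel (Subobject.mk (wing Y l).ι).arrow)
    (hu : u ≫ (Subobject.mk (wing Y k).ι).arrow = (Subobject.mk (wing X k).ι).arrow ≫ mapE φ k)
    (hv : cokernel.π _ ≫ v = mapE φ l ≫ cokernel.π _)
    (w : u ≫ (Subobject.mk (wing Y k).ι).arrow ≫ (aux Y).d k l ≫ cokernel.π _ =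
      ((Subobject.mk (wing X k).ι).arrow ≫ (aux X).d k l ≫ cokernel.π _) ≫ v) :
    arrowQis (Arrow.homMk (f := Arrow.mk ((Subobject.mk (wing X k).ι).arrow ≫ (aux X).d k l ≫
      cokernel.π (Subobject.mk (wing X l).ι).arrow))
      (g := Arrow.mk ((Subobject.mk (wing Y k).ι).arrow ≫ (aux Y).d k l ≫
      cokernel.π (Subobject.mk (wing Y l).ι).arrow)) u v w) ↔ arrowQis (φ.f (k + 1)) := by
  subst h
  refine arrowQis.arrow_mk_iso_iff (Arrow.isoMk (twoIso X k) (twoIso Y k) ?_)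
  apply Arrow.hom_ext
  · change (Subobject.underlyingIso (wing X k).ι).hom ≫ (φ.f (k + 1)).left =
      u ≫ (Subobject.underlyingIso (wing Y k).ι).hom
    rw [← cancel_mono (wing Y k).ι, Category.assoc, Category.assoc,
      Subobject.underlyingIso_hom_comp_eq_mk, hu, ← (isMap φ k).ι_s,
      ← Subobject.underlyingIso_hom_comp_eq_mk, Category.assoc]
  · change (wing X (k + 1)).quotIso.hom ≫ (φ.f (k + 1)).right =
      v ≫ (wing Y (k + 1)).quotIso.hom
    rw [← cancel_epi (cokernel.π _), ← Category.assoc, Butterfly.π_quotIso_hom, ← Category.assoc,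
      hv, Category.assoc, Butterfly.π_quotIso_hom, (isMap φ (k + 1)).s_σ]

lemma sis_map_iff (φ : X ⟶ Y) : sis t ((Tot t).map φ) ↔ ∀ n, arrowQis (φ.f n) := by
  have key : ∀ n : ℤ, arrowQis ((Decorated.twoFunctor n).map (decoratedMap φ)) ↔
      arrowQis (φ.f (n - 1 + 1)) := fun n =>
    arrowQis_iff φ (n - 1) (n + 1 - 1) (by omega) _ _
      (Decorated.subMap_arrow (decoratedMap φ) n) (cokernel.π_desc _ _ _) _
  rw [sis_iff]
  refine (forall_congr' key).trans ⟨fun h n => ?_, fun h n => h _⟩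
  have := h n
  rwa [sub_add_cancel] at this

/-- Both classes consist of the strict morphisms that are quasi-isomorphisms of two-term complexes
in every degree. -/
lemma sis_inverseImage : (sis t).inverseImage (Tot t) = invertedBy (StrictComplex.incl t) := by
  ext X Y φ
  refine (sis_map_iff φ).trans ⟨fun h => StrictComplex.isIso_incl_map φ fun n =>
    (Tilt.isIso_strictHom_iff _).2 (h n), fun h n => ?_⟩
  have : IsIso ((StrictComplex.incl t).map φ) := h
  exact (Tilt.isIso_strictHom_iff (X := X.cx.X n) (Y := Y.cx.X n) _).1
    (inferInstanceAs (IsIso (((StrictComplex.incl t).map φ).f n)))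

end Tot

end
end HRS

/-! ### Homology as an extension of a torsion-free by a torsion object -/

namespace HRS

noncomputable section

variable {A : Type u} [Category.{v} A] [Abelian A] {t : TorsionPair A}

namespace TorsionPair

/-- A map between extensions of torsion-free by torsion objects is an isomorphism if and only if
it is one on the torsion parts and on the torsion-free parts. -/
lemma isIso_iff {S S' : ShortComplex A} (φ : S ⟶ S') (hS : S.ShortExact) (hS' : S'.ShortExact)
    (hF : t.F S.X₃) (hT' : t.T S'.X₁) :
    IsIso φ.τ₂ ↔ IsIso φ.τ₁ ∧ IsIso φ.τ₃ := by
  constructor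
  · intro _
    have := hS.mono_f
    have := hS'.mono_f
    have := hS.epi_g
    have := hS'.epi_g
    -- There is no nonzero map from the torsion end of `S'` to the torsion-free end of `S`, so the
    -- inverse of the middle map respects the extensions and induces inverses at both ends.
    have h0 : (S'.f ≫ inv φ.τ₂) ≫ S.g = 0 := t.hom_eq_zero hT' hF _
    obtain ⟨u, hu⟩ : ∃ u, u ≫ S.f = S'.f ≫ inv φ.τ₂ := ⟨_, hS.exact.lift_f _ h0⟩
    obtain ⟨v, hv⟩ : ∃ v, S'.g ≫ v = inv φ.τ₂ ≫ S.g :=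
      ⟨_, hS'.exact.g_desc _ ((Category.assoc _ _ _).symm.trans h0)⟩
    refine ⟨⟨u, ?_, ?_⟩, ⟨v, ?_, ?_⟩⟩
    · rw [← cancel_mono S.f, Category.assoc, hu, φ.comm₁₂_assoc]
      simp
    · rw [← cancel_mono S'.f, Category.assoc, φ.comm₁₂, ← Category.assoc, hu]
      simp
    · rw [← cancel_epi S.g, ← Category.assoc, ← φ.comm₂₃, Category.assoc, hv]
      simp
    · rw [← cancel_epi S'.g, ← Category.assoc, hv, Category.assoc, ← φ.comm₂₃]
      simp
  · rintro ⟨_, _⟩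
    exact ShortComplex.isIso₂_of_shortExact_of_isIso₁₃ φ hS hS'

end TorsionPair

/-- A factorization of the maps of a short complex `X₁ ⟶ X₂ ⟶ X₃` through a subobject `S₂` of `X₂`
with `im f ⊆ S₂ ⊆ ker g`, a quotient `Q` of `X₁` and a subobject `S₃` of `X₃`. -/
structure Interpolation (S : ShortComplex A) where
  (Q S₂ S₃ : A)
  π : S.X₁ ⟶ Q
  a : S₂ ⟶ S.X₂
  a₃ : S₃ ⟶ S.X₃
  l : Q ⟶ S₂
  r : cokernel a ⟶ S₃
  [epi_π : Epi π]
  [mono_a : Mono a]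
  [mono_a₃ : Mono a₃]
  fac_f : π ≫ l ≫ a = S.f
  fac_g : cokernel.π a ≫ r ≫ a₃ = S.g

namespace Interpolation

attribute [instance] epi_π mono_a mono_a₃

variable {S S' : ShortComplex A} (I : Interpolation S) (I' : Interpolation S')

lemma a_g : I.a ≫ S.g = 0 := by
  rw [← I.fac_g, ← Category.assoc, cokernel.condition, zero_comp]

lemma iCycles_r : (S.iCycles ≫ cokernel.π I.a) ≫ I.r = 0 := by
  rw [← cancel_mono I.a₃, zero_comp, Category.assoc, Category.assoc, I.fac_g, S.iCycles_g]

/-- The inclusion of `S₂` in the cycles. -/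
def toCycles : I.S₂ ⟶ S.cycles := S.liftCycles I.a I.a_g

@[simp] lemma toCycles_i : I.toCycles ≫ S.iCycles = I.a := S.liftCycles_i _ _

lemma π_l_toCycles : I.π ≫ I.l ≫ I.toCycles = S.toCycles := by
  rw [← cancel_mono S.iCycles]
  simp [I.fac_f]

lemma l_toHomology : I.l ≫ I.toCycles ≫ S.homologyπ = 0 := by
  rw [← cancel_epi I.π, comp_zero]
  calc I.π ≫ I.l ≫ I.toCycles ≫ S.homologyπ = (I.π ≫ I.l ≫ I.toCycles) ≫ S.homologyπ := by simp
    _ = 0 := by rw [π_l_toCycles, S.toCycles_comp_homologyπ]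

/-- The map from `S₂ / im f` to the homology. -/
def fromCoker : cokernel I.l ⟶ S.homology := cokernel.desc _ _ I.l_toHomology

/-- The map from the cycles to `ker g / S₂`. -/
def cyclesToKer : S.cycles ⟶ kernel I.r := kernel.lift _ _ I.iCycles_r

lemma cyclesToKer_ι : I.cyclesToKer ≫ kernel.ι _ = S.iCycles ≫ cokernel.π I.a :=
  kernel.lift_ι _ _ _

lemma toCycles_cyclesToKer : I.toCycles ≫ I.cyclesToKer = 0 := by
  rw [← cancel_mono (kernel.ι _), Category.assoc, cyclesToKer_ι, ← Category.assoc, toCycles_i,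
    cokernel.condition, zero_comp]

/-- The map from the homology to `ker g / S₂`. -/
def toKer : S.homology ⟶ kernel I.r := S.descHomology I.cyclesToKer (by
  rw [← I.π_l_toCycles, Category.assoc, Category.assoc, toCycles_cyclesToKer, comp_zero,
    comp_zero])

lemma homologyπ_toKer : S.homologyπ ≫ I.toKer = I.cyclesToKer := S.π_descHomology _ _

lemma fromCoker_toKer : I.fromCoker ≫ I.toKer = 0 := by
  rw [← cancel_epi (cokernel.π _), fromCoker, cokernel.π_desc_assoc, Category.assoc,
    homologyπ_toKer, toCycles_cyclesToKer, comp_zero]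

/-- The homology as an extension of `ker g / S₂` by `S₂ / im f`. -/
abbrev sequence : ShortComplex A := ShortComplex.mk I.fromCoker I.toKer I.fromCoker_toKer

/-- For `im f ⊆ S₂ ⊆ ker g` this is `S₂ / im f ⟶ ker g / im f ⟶ ker g / S₂`. The image of `l` is `im
f` because `π` is an epimorphism, and the kernel of `r` is `ker g / S₂` because `a₃` is a
monomorphism. -/
lemma shortExact_sequence : I.sequence.ShortExact := by
  refine ShortComplex.ShortExact.mk' ?_ ?_ ?_
  · rw [ShortComplex.exact_iff_exact_up_to_refinements]
    intro T x hx
    have hx : x ≫ I.toKer = 0 := hx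
    obtain ⟨T', p, hp, z, hz⟩ := surjective_up_to_refinements_of_epi S.homologyπ x
    have h0 : (z ≫ S.iCycles) ≫ cokernel.π I.a = 0 := by
      rw [Category.assoc, ← cyclesToKer_ι, ← homologyπ_toKer, Category.assoc, ← Category.assoc z,
        ← hz, Category.assoc, ← Category.assoc x, hx, zero_comp, comp_zero]
    -- A cycle whose class dies in `ker g / S₂` lies in `S₂`.
    have h1 := Abelian.monoLift_comp I.a _ h0
    refine ⟨T', p, hp, Abelian.monoLift I.a _ h0 ≫ cokernel.π _, ?_⟩
    change p ≫ x = _ ≫ I.fromCoker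
    rw [hz, fromCoker, Category.assoc, cokernel.π_desc, ← Category.assoc]
    congr 1
    rw [← cancel_mono S.iCycles, Category.assoc, toCycles_i, h1]
  · change Mono I.fromCoker
    rw [Preadditive.mono_iff_cancel_zero]
    intro T x hx
    obtain ⟨T', p, hp, y, hy⟩ := surjective_up_to_refinements_of_epi (cokernel.π I.l) x
    have h0 : (y ≫ I.toCycles) ≫ S.homologyπ = 0 := by
      have : y ≫ cokernel.π I.l ≫ I.fromCoker = 0 := by
        rw [← Category.assoc, ← hy, Category.assoc, hx, comp_zero]
      rwa [fromCoker, cokernel.π_desc, ← Category.assoc] at this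
    obtain ⟨T'', q, hq, z, hz⟩ := (CokernelCofork.IsColimit.comp_π_eq_zero_iff_up_to_refinements
      S.homologyIsCokernel _).1 h0
    have h1 : q ≫ y = (z ≫ I.π) ≫ I.l := by
      rw [← cancel_mono I.a, ← toCycles_i]
      simp only [← Category.assoc] at hz ⊢
      rw [hz, ← I.π_l_toCycles]
      simp
    rw [← cancel_epi p, ← cancel_epi q, hy, ← Category.assoc, h1, Category.assoc,
      cokernel.condition, comp_zero, comp_zero, comp_zero]
  · change Epi I.toKer
    have : Epi I.cyclesToKer := by
      rw [epi_iff_surjective_up_to_refinements]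
      intro T x
      obtain ⟨T', p, hp, y, hy⟩ := surjective_up_to_refinements_of_epi (cokernel.π I.a)
        (x ≫ kernel.ι _)
      have h0 : y ≫ S.g = 0 := by
        rw [← I.fac_g, ← Category.assoc, ← hy]
        simp
      refine ⟨T', p, hp, S.liftCycles y h0, ?_⟩
      rw [← cancel_mono (kernel.ι _), Category.assoc, Category.assoc, cyclesToKer_ι, hy,
        ← Category.assoc, S.liftCycles_i]
    rw [← I.homologyπ_toKer] at this
    exact epi_of_epi S.homologyπ _

variable {I I'} in
/-- A map of short complexes compatible with interpolations is a quasi-isomorphism if and only if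
it induces isomorphisms on `S₂ / im f` and on `ker g / S₂`, which are torsion and torsion-free
respectively. -/
lemma quasiIso_iff (φ : S ⟶ S') (hF : t.F (kernel I.r)) (hT' : t.T (cokernel I'.l))
    (u : Arrow.mk I.l ⟶ Arrow.mk I'.l) (v : Arrow.mk I.r ⟶ Arrow.mk I'.r)
    (hu : u.right ≫ I'.a = I.a ≫ φ.τ₂) (hv : cokernel.π I.a ≫ v.left = φ.τ₂ ≫ cokernel.π I'.a) :
    ShortComplex.QuasiIso φ ↔ IsIso (arrowCoker u) ∧ IsIso (arrowKer v) := by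
  let ψ : I.sequence ⟶ I'.sequence :=
    { τ₁ := arrowCoker u
      τ₂ := ShortComplex.homologyMap φ
      τ₃ := arrowKer v
      comm₁₂ := by
        refine (cancel_epi (cokernel.π I.l)).1 ?_
        have h := π_arrowCoker u
        change cokernel.π I.l ≫ arrowCoker u = u.right ≫ cokernel.π I'.l at h
        change cokernel.π I.l ≫ arrowCoker u ≫ I'.fromCoker = _ ≫ I.fromCoker ≫ _
        rw [← Category.assoc, h, Category.assoc, fromCoker, fromCoker, cokernel.π_desc,
          cokernel.π_desc_assoc, Category.assoc, ShortComplex.homologyπ_naturality,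
          ← Category.assoc, ← Category.assoc]
        congr 1
        rw [← cancel_mono S'.iCycles]
        rw [Category.assoc, Category.assoc, toCycles_i, hu, ShortComplex.cyclesMap_i,
          ← Category.assoc, toCycles_i]
      comm₂₃ := by
        refine (cancel_epi S.homologyπ).1 ((cancel_mono (kernel.ι I'.r)).1 ?_)
        have h := arrowKer_ι v
        change arrowKer v ≫ kernel.ι I'.r = kernel.ι I.r ≫ v.left at h
        change (_ ≫ _ ≫ I'.toKer) ≫ _ = (_ ≫ I.toKer ≫ arrowKer v) ≫ _
        rw [ShortComplex.homologyπ_naturality_assoc, homologyπ_toKer, Category.assoc,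
          cyclesToKer_ι, ← Category.assoc S.homologyπ, homologyπ_toKer, Category.assoc, h,
          ← Category.assoc I.cyclesToKer, cyclesToKer_ι]
        simp [hv] }
  rw [ShortComplex.quasiIso_iff]
  exact TorsionPair.isIso_iff ψ I.shortExact_sequence I'.shortExact_sequence hF hT'

end Interpolation

end
end HRS

/-! ### Homology in `B` and quasi-isomorphisms -/

namespace HRS

noncomputable section

variable {A : Type u} [Category.{v} A] [Abelian A] {t : TorsionPair A}

namespace Tilt

section

variable {X Y Z : Tilt t} {P : Butterfly X.arrow Y.arrow} {Q : Butterfly Y.arrow Z.arrow}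
  {δ : P.E ⟶ Q.E}

namespace IsLink

/-- The map `S ⟶ E'` kills `im κ`, so it factors through the torsion object `S / im κ`. It is killed
by `σ` and `ρ` of `Q`, whose common kernel `ker d_Z` is torsion-free. -/
lemma a_δ (h : IsLink P Q δ) (τ : Factor P) : τ.a ≫ δ = 0 := by
  have hk : τ.k ≫ τ.a ≫ δ = 0 := by rw [← Category.assoc, τ.k_a, h.κ_δ]
  have : cokernel.desc τ.k _ hk = 0 := by
    apply zero_of_torsion Q τ.coker_mem
    · rw [← cancel_epi (cokernel.π _), ← Category.assoc, cokernel.π_desc, Category.assoc, h.δ_σ]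
      simp
    · rw [← cancel_epi (cokernel.π _), ← Category.assoc, cokernel.π_desc, Category.assoc, h.δ_ρ]
      simp
  rw [← cokernel.π_desc τ.k _ hk, this, comp_zero]

/-- Dual to `a_δ`: the map to `E' / S'` lands in the torsion-free kernel of `b` and factors through
the torsion object `coker d_X`. With `a_δ`, the link induces a map `E / S ⟶ S'`. -/
lemma δ_π (h : IsLink P Q δ) (τ' : Factor Q) : δ ≫ cokernel.π τ'.a = 0 := by
  have hb : (δ ≫ cokernel.π τ'.a) ≫ τ'.b = 0 := by simp [h.δ_ρ]
  have : kernel.lift τ'.b _ hb = 0 := by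
    apply zero_of_free P τ'.ker_mem
    · rw [← cancel_mono (kernel.ι _), Category.assoc, kernel.lift_ι, ← Category.assoc, h.κ_δ]
      simp
    · rw [← cancel_mono (kernel.ι _), Category.assoc, kernel.lift_ι, ← Category.assoc, h.ι_δ,
        τ'.κ_π, zero_comp]
  rw [← kernel.lift_ι τ'.b _ hb, this, zero_comp]

/-- A link factors through the subobject `S` of its target. -/
def lift (h : IsLink P Q δ) (τ' : Factor Q) : P.E ⟶ τ'.S := Abelian.monoLift τ'.a δ (h.δ_π τ')

lemma lift_a (h : IsLink P Q δ) (τ' : Factor Q) : h.lift τ' ≫ τ'.a = δ :=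
  Abelian.monoLift_comp τ'.a δ (h.δ_π τ')

lemma a_lift (h : IsLink P Q δ) (τ : Factor P) (τ' : Factor Q) : τ.a ≫ h.lift τ' = 0 := by
  rw [← cancel_mono τ'.a, Category.assoc, h.lift_a, h.a_δ, zero_comp]

/-- The butterfly from `X` to the kernel of `Q`. -/
abbrev toKer (h : IsLink P Q δ) (τ' : Factor Q) : Butterfly X.arrow τ'.ker.arrow where
  E := P.E
  κ := P.κ
  ι := P.ι
  σ := P.σ
  ρ := h.lift τ'
  κ_σ := P.κ_σ
  ι_ρ := by
    rw [← cancel_mono τ'.a, Category.assoc, h.lift_a, h.ι_δ]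
    exact τ'.k_a.symm
  κ_ρ := by rw [← cancel_mono τ'.a, Category.assoc, h.lift_a, h.κ_δ, zero_comp]
  ι_σ := P.ι_σ
  shortExact := P.shortExact

lemma toKer_incl (h : IsLink P Q δ) (τ' : Factor Q) :
    toHom (Y := τ'.ker) (h.toKer τ') ≫ strictHom (X := τ'.ker) (Y := Y) τ'.incl = toHom P := by
  refine comp_strictHom_eq.2 ⟨𝟙 _, by simp, by simp, by simp, ?_⟩
  change 𝟙 _ ≫ P.ρ = h.lift τ' ≫ τ'.a ≫ Q.σ
  rw [Category.id_comp, ← Category.assoc, h.lift_a, h.δ_σ]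

/-- The factor of `P` is also one of the butterfly to the kernel of `Q`. -/
abbrev factor (h : IsLink P Q δ) (τ : Factor P) (τ' : Factor Q) :
    Factor (X := X) (Y := τ'.ker) (h.toKer τ') where
  S := τ.S
  a := τ.a
  k := τ.k
  mono := τ.mono
  a_ρ := h.a_lift τ τ'
  k_a := τ.k_a
  coker_mem := τ.coker_mem
  -- The map `E / S ⟶ S'` followed by `S' ⟶ Y⁰` is `τ.b`, so its kernel embeds in the torsion-free
  -- kernel of `τ.b`.
  ker_mem := t.F_kernel_of_comp _ (τ'.a ≫ Q.σ) τ.b (by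
    rw [← cancel_epi (cokernel.π τ.a), cokernel.π_desc_assoc, cokernel.π_desc, ← Category.assoc]
    change (h.lift τ' ≫ τ'.a) ≫ Q.σ = P.ρ
    rw [h.lift_a, h.δ_σ]) τ.ker_mem

/-- The homology `[E / S ⟶ S']` of two consecutive butterflies. -/
abbrev homology (h : IsLink P Q δ) (τ : Factor P) (τ' : Factor Q) : Tilt t := (h.factor τ τ').coker

end IsLink

/-- `[X⁻¹ ⟶ S]` is the kernel. -/
def Factor.isLimit (τ : Factor P) {f : X ⟶ Y} (hf : toHom P = f)
    (w : strictHom (X := τ.ker) (Y := X) τ.incl ≫ f = 0) :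
    IsLimit (KernelFork.ofι (strictHom (X := τ.ker) (Y := X) τ.incl) w) :=
  Fork.IsLimit.ofExistsUnique fun s => by
    obtain ⟨l, hl⟩ := τ.exists_lift (q := s.ι) (by rw [hf]; exact KernelFork.condition s)
    exact ⟨l, hl, fun m hm => τ.incl_cancel (Eq.trans hm hl.symm)⟩

/-- `[E / S ⟶ Y⁰]` is the cokernel. -/
def Factor.isColimit (τ : Factor P) {f : X ⟶ Y} (hf : toHom P = f)
    (w : f ≫ strictHom (X := Y) (Y := τ.coker) τ.proj = 0) :
    IsColimit (CokernelCofork.ofπ (strictHom (X := Y) (Y := τ.coker) τ.proj) w) :=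
  Cofork.IsColimit.ofExistsUnique fun s => by
    obtain ⟨l, hl⟩ := τ.exists_desc (q := s.π) (by rw [hf]; exact CokernelCofork.condition s)
    exact ⟨l, hl, fun m hm => τ.proj_cancel (Eq.trans hm hl.symm)⟩

end

/-- The homology of a short complex in `B` in terms of butterflies. -/
def leftHomologyData (S : ShortComplex (Tilt t)) {P : Butterfly S.X₁.arrow S.X₂.arrow}
    {Q : Butterfly S.X₂.arrow S.X₃.arrow} (hP : toHom P = S.f) (hQ : toHom Q = S.g)
    {δ : P.E ⟶ Q.E} (h : IsLink P Q δ) (τ : Factor P) (τ' : Factor Q) : S.LeftHomologyData :=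
  have wi : strictHom (X := τ'.ker) (Y := S.X₂) τ'.incl ≫ S.g = 0 := by
    rw [← hQ]; exact τ'.incl_comp
  -- The cokernel must be taken of the map that `S.f` induces into the kernel of `S.g`. That map is
  -- the class of `h.toKer τ'`, since both have the same composite with the inclusion.
  have hf' : toHom (Y := τ'.ker) (h.toKer τ') =
      (τ'.isLimit hQ wi).lift (KernelFork.ofι S.f S.zero) :=
    Fork.IsLimit.hom_ext (τ'.isLimit hQ wi)
      ((h.toKer_incl τ').trans (hP.trans
        ((τ'.isLimit hQ wi).fac (KernelFork.ofι S.f S.zero) WalkingParallelPair.zero).symm))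
  have wπ : (τ'.isLimit hQ wi).lift (KernelFork.ofι S.f S.zero) ≫
      strictHom (X := τ'.ker) (Y := h.homology τ τ') (h.factor τ τ').proj = 0 := by
    rw [← hf']; exact (h.factor τ τ').comp_proj
  { K := τ'.ker
    H := h.homology τ τ'
    i := strictHom (X := τ'.ker) (Y := S.X₂) τ'.incl
    π := strictHom (X := τ'.ker) (Y := h.homology τ τ') (h.factor τ τ').proj
    wi := wi
    hi := τ'.isLimit hQ wi
    wπ := wπ
    hπ := (h.factor τ τ').isColimit hf' wπ }

section

variable {X Y Z X₁ Y₁ Z₁ : Tilt t} {P : Butterfly X.arrow Y.arrow} {Q : Butterfly Y.arrow Z.arrow}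
  {δ : P.E ⟶ Q.E} {P₁ : Butterfly X₁.arrow Y₁.arrow} {Q₁ : Butterfly Y₁.arrow Z₁.arrow}
  {δ₁ : P₁.E ⟶ Q₁.E} {f : X.arrow ⟶ X₁.arrow} {g : Y.arrow ⟶ Y₁.arrow} {l : Z.arrow ⟶ Z₁.arrow}
  {s : P.E ⟶ P₁.E} {r : Q.E ⟶ Q₁.E}

namespace IsMap

/-- Maps of centres respect the subobjects `S`, as torsion parts are functorial: `S ⟶ E₁ / S₁`
factors through the torsion object `S / im κ` and lands in the torsion-free kernel of `τ₁.b`. -/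
lemma a_s_π (hs : IsMap P P₁ f g s) (τ : Factor P) (τ₁ : Factor P₁) :
    (τ.a ≫ s) ≫ cokernel.π τ₁.a = 0 := by
  have hb : ((τ.a ≫ s) ≫ cokernel.π τ₁.a) ≫ τ₁.b = 0 := by
    rw [Category.assoc, cokernel.π_desc, Category.assoc, hs.s_ρ, ← Category.assoc, τ.a_ρ,
      zero_comp]
  have hk : τ.k ≫ kernel.lift τ₁.b _ hb = 0 := by
    rw [← cancel_mono (kernel.ι _), Category.assoc, kernel.lift_ι, ← Category.assoc,
      ← Category.assoc, τ.k_a, hs.κ_s, Category.assoc, τ₁.κ_π, comp_zero, zero_comp]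
  have h0 : kernel.lift τ₁.b _ hb = 0 := by
    rw [← cokernel.π_desc τ.k _ hk, t.hom_eq_zero τ.coker_mem τ₁.ker_mem (cokernel.desc τ.k _ hk),
      comp_zero]
  rw [← kernel.lift_ι τ₁.b _ hb, h0, zero_comp]

/-- The map induced on the subobjects `S`. -/
def mapS (hs : IsMap P P₁ f g s) (τ : Factor P) (τ₁ : Factor P₁) : τ.S ⟶ τ₁.S :=
  Abelian.monoLift τ₁.a _ (hs.a_s_π τ τ₁)

lemma mapS_a (hs : IsMap P P₁ f g s) (τ : Factor P) (τ₁ : Factor P₁) :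
    hs.mapS τ τ₁ ≫ τ₁.a = τ.a ≫ s := Abelian.monoLift_comp _ _ _

/-- The map induced on the kernels `[X⁻¹ ⟶ S]`. -/
abbrev mapKer (hs : IsMap P P₁ f g s) (τ : Factor P) (τ₁ : Factor P₁) :
    τ.ker.arrow ⟶ τ₁.ker.arrow :=
  Arrow.homMk f.left (hs.mapS τ τ₁) (by
    change f.left ≫ τ₁.k = τ.k ≫ _
    rw [← cancel_mono τ₁.a, Category.assoc, τ₁.k_a, Category.assoc, mapS_a, ← Category.assoc,
      τ.k_a, hs.κ_s])

/-- The map induced on the homology `[E / S ⟶ S']`. -/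
abbrev mapHomology (hs : IsMap P P₁ f g s) (hr : IsMap Q Q₁ g l r) (h : IsLink P Q δ)
    (h₁ : IsLink P₁ Q₁ δ₁) (τ : Factor P) (τ₁ : Factor P₁) (τ' : Factor Q) (τ'₁ : Factor Q₁) :
    (h.homology τ τ').arrow ⟶ (h₁.homology τ₁ τ'₁).arrow :=
  Arrow.homMk (cokernel.map τ.a τ₁.a (hs.mapS τ τ₁) s (hs.mapS_a τ τ₁).symm) (hr.mapS τ' τ'₁) (by
    change cokernel.map τ.a τ₁.a _ s _ ≫ cokernel.desc τ₁.a (h₁.lift τ'₁) _ =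
      cokernel.desc τ.a (h.lift τ') _ ≫ hr.mapS τ' τ'₁
    rw [← cancel_epi (cokernel.π τ.a), cokernel.π_desc_assoc, cokernel.π_desc_assoc,
      Category.assoc, cokernel.π_desc, ← cancel_mono τ'₁.a, Category.assoc, h₁.lift_a,
      Category.assoc, mapS_a, ← Category.assoc, h.lift_a]
    exact hs.link_comm hr h h₁)

end IsMap

end

/-- A strict morphism of short complexes in `B` is a quasi-isomorphism if and only if the map
`[E / S ⟶ S'] ⟶ [E₁ / S₁ ⟶ S₁']` is. -/
lemma quasiIso_iff {S S₁ : ShortComplex (Tilt t)} (φ : S ⟶ S₁)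
    {P : Butterfly S.X₁.arrow S.X₂.arrow} {Q : Butterfly S.X₂.arrow S.X₃.arrow}
    (hP : toHom P = S.f) (hQ : toHom Q = S.g)
    {P₁ : Butterfly S₁.X₁.arrow S₁.X₂.arrow} {Q₁ : Butterfly S₁.X₂.arrow S₁.X₃.arrow}
    (hP₁ : toHom P₁ = S₁.f) (hQ₁ : toHom Q₁ = S₁.g) {δ : P.E ⟶ Q.E} {δ₁ : P₁.E ⟶ Q₁.E}
    (h : IsLink P Q δ) (h₁ : IsLink P₁ Q₁ δ₁) {f : S.X₁.arrow ⟶ S₁.X₁.arrow}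
    {g : S.X₂.arrow ⟶ S₁.X₂.arrow} {l : S.X₃.arrow ⟶ S₁.X₃.arrow} {s : P.E ⟶ P₁.E}
    {r : Q.E ⟶ Q₁.E} (hs : IsMap P P₁ f g s) (hr : IsMap Q Q₁ g l r)
    (hg : φ.τ₂ = strictHom g) (τ : Factor P) (τ₁ : Factor P₁) (τ' : Factor Q) (τ'₁ : Factor Q₁) :
    ShortComplex.QuasiIso φ ↔ arrowQis (hs.mapHomology hr h h₁ τ τ₁ τ' τ'₁) := by
  let D := leftHomologyData S hP hQ h τ τ'
  let D₁ := leftHomologyData S₁ hP₁ hQ₁ h₁ τ₁ τ'₁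
  have hi : strictHom (X := τ'.ker) (Y := τ'₁.ker) (hr.mapKer τ' τ'₁) ≫ D₁.i = D.i ≫ φ.τ₂ := by
    rw [hg]
    refine (strictHom_comp _ _).trans (Eq.trans ?_ (strictHom_comp _ _).symm)
    congr 1
    apply Arrow.hom_ext
    · change g.left ≫ 𝟙 _ = 𝟙 _ ≫ g.left
      rw [Category.id_comp, Category.comp_id]
    · change hr.mapS τ' τ'₁ ≫ τ'₁.a ≫ Q₁.σ = (τ'.a ≫ Q.σ) ≫ g.right
      rw [← Category.assoc, IsMap.mapS_a, Category.assoc, hr.s_σ, Category.assoc]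
  -- Only the middle component of `φ` has to be identified: it determines the map on kernels, and
  -- that one the map on homology.
  let γ : ShortComplex.LeftHomologyMapData φ D D₁ :=
    { φK := strictHom (X := τ'.ker) (Y := τ'₁.ker) (hr.mapKer τ' τ'₁)
      φH := strictHom (X := h.homology τ τ') (Y := h₁.homology τ₁ τ'₁)
        (hs.mapHomology hr h h₁ τ τ₁ τ' τ'₁)
      commi := hi
      commf' := by
        refine (cancel_mono D₁.i).1 ((Category.assoc _ _ _).trans
          ((congrArg (D.f' ≫ ·) hi).trans ?_))
        rw [D.f'_i_assoc, Category.assoc, D₁.f'_i, φ.comm₁₂]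
      commπ := by
        refine (strictHom_comp _ _).trans (Eq.trans ?_ (strictHom_comp _ _).symm)
        congr 1
        apply Arrow.hom_ext
        · change (P.ι ≫ cokernel.π τ.a) ≫
            cokernel.map τ.a τ₁.a (hs.mapS τ τ₁) s (hs.mapS_a τ τ₁).symm =
            g.left ≫ P₁.ι ≫ cokernel.π τ₁.a
          rw [Category.assoc, cokernel.π_desc, ← Category.assoc, hs.ι_s, Category.assoc]
        · change 𝟙 _ ≫ hr.mapS τ' τ'₁ = hr.mapS τ' τ'₁ ≫ 𝟙 _
          rw [Category.id_comp, Category.comp_id] }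
  rw [γ.quasiIso_iff]
  exact isIso_strictHom_iff (X := h.homology τ τ') (Y := h₁.homology τ₁ τ'₁) _

end Tilt

namespace Tot

open _root_.HRS.Tilt

variable {X Y : StrictComplex t}

/-- A chosen factor of the butterfly of a differential. -/
def factor (X : StrictComplex t) (k : ℤ) : Factor (wing X k) := (Factor.nonempty _).some

/-- The map induced on the homology in `B`. -/
abbrev mapH (φ : X ⟶ Y) (k : ℤ) :
    ((isLink X k).homology (factor X k) (factor X (k + 1))).arrow ⟶
      ((isLink Y k).homology (factor Y k) (factor Y (k + 1))).arrow :=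
  (isMap φ k).mapHomology (isMap φ (k + 1)) (isLink X k) (isLink Y k) _ _ _ _

lemma quasiIsoAt_incl_iff (φ : X ⟶ Y) (k : ℤ) :
    QuasiIsoAt ((StrictComplex.incl t).map φ) (k + 1) ↔ arrowQis (mapH φ k) := by
  rw [quasiIsoAt_iff' _ k (k + 1) (k + 1 + 1) (by simp) (by simp)]
  exact Tilt.quasiIso_iff _ (toHom_out _) (toHom_out _) (toHom_out _) (toHom_out _)
    (isLink X k) (isLink Y k) (isMap φ k) (isMap φ (k + 1)) rfl _ _ _ _

lemma quasiIso_incl_iff (φ : X ⟶ Y) :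
    QuasiIso ((StrictComplex.incl t).map φ) ↔ ∀ k, arrowQis (mapH φ k) := by
  rw [_root_.quasiIso_iff]
  refine ⟨fun h k => (quasiIsoAt_incl_iff φ k).1 (h _), fun h n => ?_⟩
  obtain ⟨k, rfl⟩ := exists_eq_add_one n
  exact (quasiIsoAt_incl_iff φ k).2 (h k)

/-- The subobjects `S` interpolate the complex of centres. -/
abbrev interpolation (X : StrictComplex t) (k : ℤ) :
    Interpolation ((aux X).sc' k (k + 1) (k + 1 + 1)) where
  Q := cokernel (factor X k).a
  S₂ := (factor X (k + 1)).S
  S₃ := (factor X (k + 1 + 1)).S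
  π := cokernel.π (factor X k).a
  a := (factor X (k + 1)).a
  a₃ := (factor X (k + 1 + 1)).a
  l := ((isLink X k).homology (factor X k) (factor X (k + 1))).arrow.hom
  r := ((isLink X (k + 1)).homology (factor X (k + 1)) (factor X (k + 1 + 1))).arrow.hom
  epi_π := inferInstanceAs (Epi (cokernel.π (factor X k).a))
  mono_a := (factor X (k + 1)).mono
  mono_a₃ := (factor X (k + 1 + 1)).mono
  fac_f := by
    refine Eq.trans ?_ (aux_d X k).symm
    refine (Category.assoc _ _ _).symm.trans ((congrArg (· ≫ _) (cokernel.π_desc _ _ _)).trans ?_)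
    exact (isLink X k).lift_a _
  fac_g := by
    refine Eq.trans ?_ (aux_d X (k + 1)).symm
    refine (Category.assoc _ _ _).symm.trans ((congrArg (· ≫ _) (cokernel.π_desc _ _ _)).trans ?_)
    exact (isLink X (k + 1)).lift_a _

/-- The chain map between the complexes of centres. -/
abbrev auxMap (φ : X ⟶ Y) : aux X ⟶ aux Y where
  f k := mapE φ k
  comm' k l h := mapE_comm φ k l h

/-- The homology of the centres in degree `k + 1` is an extension of the kernel of the homology
complex with index `k + 1` by the cokernel of the one with index `k`. -/
lemma quasiIsoAt_auxMap_iff (φ : X ⟶ Y) (k : ℤ) :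
    QuasiIsoAt (auxMap φ) (k + 1) ↔
      IsIso (arrowCoker (mapH φ k)) ∧ IsIso (arrowKer (mapH φ (k + 1))) := by
  rw [quasiIsoAt_iff' _ k (k + 1) (k + 1 + 1) (by simp) (by simp)]
  exact Interpolation.quasiIso_iff (t := t) (I := interpolation X k) (I' := interpolation Y k) _
    ((isLink X (k + 1)).homology (factor X (k + 1)) (factor X (k + 1 + 1))).ker_mem
    ((isLink Y k).homology (factor Y k) (factor Y (k + 1))).coker_mem
    (mapH φ k) (mapH φ (k + 1)) ((isMap φ (k + 1)).mapS_a _ _) (cokernel.π_desc _ _ _)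

/-- Each degree tests the cokernel of one homology complex and the kernel of the next, so all
degrees together test every kernel and every cokernel. -/
lemma quasiIso_auxMap_iff (φ : X ⟶ Y) :
    QuasiIso (auxMap φ) ↔ ∀ k, arrowQis (mapH φ k) := by
  rw [_root_.quasiIso_iff]
  constructor
  · intro h k
    refine ⟨?_, ((quasiIsoAt_auxMap_iff φ k).1 (h _)).1⟩
    obtain ⟨m, rfl⟩ := exists_eq_add_one k
    exact ((quasiIsoAt_auxMap_iff φ m).1 (h _)).2
  · intro h n
    obtain ⟨k, rfl⟩ := exists_eq_add_one n
    exact (quasiIsoAt_auxMap_iff φ k).2 ⟨(h k).2, (h (k + 1)).1⟩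

/-- The decorated complex is the complex of centres shifted by one degree, with the same
differentials and maps and no sign. -/
lemma quasiIsoAt_decoratedMap_iff (φ : X ⟶ Y) (n : ℤ) :
    QuasiIsoAt (decoratedMap φ).map n ↔ QuasiIsoAt (auxMap φ) (n - 1) := by
  rw [quasiIsoAt_iff' _ (n - 1) n (n + 1) (by simp) (by simp),
    quasiIsoAt_iff' _ (n - 1 - 1) (n - 1) (n + 1 - 1) (by simp) (by simp)]
  rfl

lemma qis_map_iff (φ : X ⟶ Y) :
    qis t ((Tot t).map φ) ↔ QuasiIso ((StrictComplex.incl t).map φ) := by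
  rw [quasiIso_incl_iff, ← quasiIso_auxMap_iff, _root_.quasiIso_iff]
  refine (_root_.quasiIso_iff (decoratedMap φ).map).trans ⟨fun h k => ?_, fun h n =>
    (quasiIsoAt_decoratedMap_iff φ n).2 (h _)⟩
  obtain ⟨n, rfl⟩ := exists_eq_sub_one k
  exact (quasiIsoAt_decoratedMap_iff φ n).1 (h n)

lemma qis_inverseImage : (qis t).inverseImage (Tot t) =
    (HomologicalComplex.quasiIso (Tilt t) (ComplexShape.up ℤ)).inverseImage
      (StrictComplex.incl t) := by
  ext X Y φ
  exact qis_map_iff φ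

end Tot

end
end HRS

/-! ### Comparison of the localizations -/

namespace HRS

variable {A : Type u} [Category.{v} A] [Abelian A] (t : TorsionPair A)

/-- A composite of two localizations. The morphisms inverted by `incl` become isomorphisms, hence
quasi-isomorphisms; and by `HasRoofs.le_map` every quasi-isomorphism of `Ch(B)` is, up to
isomorphism, the image of a strict one. -/
instance StrictComplex.isLocalization_incl_comp_Q [HasDerivedCategory.{w} (Tilt t)] :
    (StrictComplex.incl t ⋙ DerivedCategory.Q).IsLocalization
      ((HomologicalComplex.quasiIso (Tilt t) (ComplexShape.up ℤ)).inverseImage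
        (StrictComplex.incl t)) :=
  Functor.IsLocalization.comp _ _ (invertedBy (StrictComplex.incl t))
    (HomologicalComplex.quasiIso (Tilt t) (ComplexShape.up ℤ)) _
    (fun _ _ _ h => Localization.inverts DerivedCategory.Q
      (HomologicalComplex.quasiIso (Tilt t) (ComplexShape.up ℤ)) _ h)
    (fun _ _ f h => by
      have : IsIso ((StrictComplex.incl t).map f) := h
      exact (inferInstance : QuasiIso ((StrictComplex.incl t).map f)))
    ((StrictComplex.hasRoofs_incl t).le_map _)

/-- The localization of decorated complexes is a localization of strict complexes. -/
lemma Tot.isLocalization_comp_Q (W : MorphismProperty (CompatibleComplex t)) [W.RespectsIso] :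
    (Tot t ⋙ W.Q).IsLocalization (W.inverseImage (Tot t)) := by
  let Φ : LocalizerMorphism (W.inverseImage (Tot t)) W := { functor := Tot t, map := le_rfl }
  have : Φ.IsInduced := ⟨rfl⟩
  have : Φ.functor.IsEquivalence := inferInstanceAs (Tot t).IsEquivalence
  have : Φ.IsLocalizedEquivalence := Φ.isLocalizedEquivalence_of_isInduced
  exact LocalizerMorphism.IsLocalizedEquivalence.isLocalization Φ W.Q

end HRS

theorem corollaryC {A : Type u} [Category.{v} A] [Abelian A] (t : HRS.TorsionPair A)
    [HasDerivedCategory.{w} (HRS.Tilt t)] :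
    (∃ Φ : CochainComplex (HRS.Tilt t) ℤ ⥤ (HRS.sis t).Localization,
      Φ.IsEquivalence ∧
        Nonempty (HRS.StrictComplex.incl t ⋙ Φ ≅ HRS.Tot t ⋙ (HRS.sis t).Q)) ∧
    (∃ Ψ : DerivedCategory (HRS.Tilt t) ⥤ (HRS.qis t).Localization,
      Ψ.IsEquivalence ∧
        Nonempty (HRS.StrictComplex.incl t ⋙ DerivedCategory.Q ⋙ Ψ ≅
          HRS.Tot t ⋙ (HRS.qis t).Q)) := by
  have h₁ := HRS.Tot.isLocalization_comp_Q t (HRS.sis t)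
  have h₂ := HRS.Tot.isLocalization_comp_Q t (HRS.qis t)
  -- After these rewritings both functors out of `Chˢᵗ(B)` in each of the two comparisons are
  -- localizations at the same class, so uniqueness of localizations applies.
  rw [HRS.Tot.sis_inverseImage] at h₁
  rw [HRS.Tot.qis_inverseImage] at h₂
  exact ⟨⟨(Localization.uniq (HRS.StrictComplex.incl t) (HRS.Tot t ⋙ (HRS.sis t).Q)
      (HRS.invertedBy (HRS.StrictComplex.incl t))).functor, inferInstance,
      ⟨Localization.compUniqFunctor _ _ _⟩⟩,
    ⟨(Localization.uniq (HRS.StrictComplex.incl t ⋙ DerivedCategory.Q)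
      (HRS.Tot t ⋙ (HRS.qis t).Q) ((HomologicalComplex.quasiIso (HRS.Tilt t)
        (ComplexShape.up ℤ)).inverseImage (HRS.StrictComplex.incl t))).functor,
      inferInstance, ⟨(Functor.associator _ _ _).symm ≪≫ Localization.compUniqFunctor _ _ _⟩⟩⟩
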